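/- Let $k$ be a commutative ring. \emph{Chain complexes.} Let $\operatorname{Ch}$ be the category of unbounded ($\mathbb Z$-graded) chain complexes of $k$-modules, with the usual symmetric monoidal structure: tensor product over $k$ with $d(x\otimes y)=dx\otimes y+(-1)^{|x|}x\otimes dy$, unit $k$ in degree $0$, symmetry $x\otimes y\mapsto(-1)^{|x||y|}y\otimes x$. Its projective model structure has the quasi-isomorphisms as weak equivalences and the degreewise surjections as fibrations. \emph{Twisted complexes.} A twisted complex $X$ consists of $k$-modules $X_{p,q}$, $p\ge 0$, $q\in\mathbb Z$ (and $X_{p,q}=0$ for $p<0$), and maps $d_i\colon X_{p,q}\to X_{p-i,q+i-1}$, $i\ge 0$, with $\sum_{i+j=n}d_id_j=0$ for all $n\ge0$. A morphism is a family of $k$-linear maps $f_{p,q}\colon X_{p,q}\to Y_{p,q}$ that commutes with all $d_i$. Let $\operatorname{tCh}$ be the resulting category. It is symmetric monoidal, with the tensor product of bigraded modules equipped with $d_i(x\otimes y)=d_ix\otimes y+(-1)^{|x|}x\otimes d_iy$, unit $k$ in bidegree $(0,0)$ and symmetry $x\otimes y\mapsto(-1)^{|x||y|}y\otimes x$, where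 $|x|=p+q$ for $x\in X_{p,q}$. For $p\ge0$, $X_{p,*}$ is a chain complex with differential $d_0$, and the vertical homology of $X$ is $H^v_{p,q}(X)=H_q(X_{p,*})$. The total complex is $\operatorname{Tot}(X)_n=\bigoplus_{p+q=n}X_{p,q}$ with differential $\sum_i d_i$. The total model structure on $\operatorname{tCh}$ has as weak equivalences the maps $f$ such that $\operatorname{Tot}(f)$ is a quasi-isomorphism, and as fibrations the maps $f$ such that every $f_{p,q}$ is surjective and $H^v_{p,q}(f)$ is an isomorphism for all $p>0$ and $q\in\mathbb Z$. \textbf{Proposition.} The projective model structure on $\operatorname{Ch}$ and the total model structure on $\operatorname{tCh}$ exist. The functor $i\colon\operatorname{Ch}\to\operatorname{tCh}$ that includes chain complexes as twisted complexes concentrated in horizontal degree $p=0$ (with $d_0=d$) is left adjoint to $X\mapsto X_{0,*}$, and it is the left adjoint of a strong symmetric monoidal Quillen equivalence \[\operatorname{Ch}\rightleftarrows\operatorname{tCh},\] that is: (1) $i$ preserves cofibrations and trivial cofibrations; (2) for every cofibrant $K$ in $\operatorname{Ch}$ and every fibrant $Y$ in $\operatorname{tCh}$, a map $iK\to Y$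 is a weak equivalence if and only if the adjoint map $K\to Y_{0,*}$ is; (3) $i$ admits the structure of a strong symmetric monoidal functor, and for every weak equivalence $Q\to k$ in $\operatorname{Ch}$ with $Q$ cofibrant the map $iQ\to i k$ is a weak equivalence. -/

import Mathlib

open CategoryTheory Limits MonoidalCategory
universe u

namespace KoszulGraded
open GradedObject Category
open GradedObject.Monoidal (ιTensorObj tensorObjDesc tensorObj_ext ι_tensorObjDesc
  ι_tensorObjDesc_assoc ιTensorObj₃ ιTensorObj₃' tensorObj₃_ext tensorObj₃'_ext ι_tensorHom
  ι_tensorHom_assoc ιTensorObj₃_eq ιTensorObj₃'_eq ιTensorObj₃_eq_assoc ιTensorObj₃'_eq_assoc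
  ιTensorObj₃'_associator_hom ιTensorObj₃_associator_inv ιTensorObj₃'_associator_hom_assoc
  ιTensorObj₃_associator_inv_assoc)

lemma units_smul_comp {C : Type*} [Category* C] [Preadditive C] {X Y Z : C} (e : ℤˣ)
    (f : X ⟶ Y) (g : Y ⟶ Z) : (e • f) ≫ g = e • (f ≫ g) := by
  rcases Int.units_eq_one_or e with rfl | rfl <;> simp

lemma comp_units_smul {C : Type*} [Category* C] [Preadditive C] {X Y Z : C} (e : ℤˣ)
    (f : X ⟶ Y) (g : Y ⟶ Z) : f ≫ (e • g) = e • (f ≫ g) := by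
  rcases Int.units_eq_one_or e with rfl | rfl <;> simp

section Signs
variable {C : Type*} [Category* C] [Preadditive C] [MonoidalCategory C] [MonoidalPreadditive C]

lemma whiskerLeft_neg {Y Z : C} (X : C) (f : Y ⟶ Z) : X ◁ (-f) = - (X ◁ f) :=
  (tensorLeft X).map_neg

lemma neg_whiskerRight {Y Z : C} (X : C) (f : Y ⟶ Z) : (-f) ▷ X = - (f ▷ X) :=
  (tensorRight X).map_neg

lemma whiskerLeft_units_smul {Y Z : C} (X : C) (e : ℤˣ) (f : Y ⟶ Z) :
    X ◁ (e • f) = e • (X ◁ f) := by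
  rcases Int.units_eq_one_or e with rfl | rfl <;> simp [whiskerLeft_neg]

lemma units_smul_whiskerRight {Y Z : C} (X : C) (e : ℤˣ) (f : Y ⟶ Z) :
    (e • f) ▷ X = e • (f ▷ X) := by
  rcases Int.units_eq_one_or e with rfl | rfl <;> simp [neg_whiskerRight]

end Signs

/-- The sign `(-1) ^ (|i| |j|)`, where `|i| = deg i`. -/
abbrev sgn {I : Type} [AddCommMonoid I] (deg : I →+ ℤ) (i j : I) : ℤˣ :=
  (deg i * deg j).negOnePow

lemma sgn_mul_sgn {I : Type} [AddCommMonoid I] (deg : I →+ ℤ) (i j : I) :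
    sgn deg i j * sgn deg j i = 1 := by
  rw [sgn, sgn, mul_comm (deg j), Int.units_mul_self]

lemma sgn_comm {I : Type} [AddCommMonoid I] (deg : I →+ ℤ) (i j : I) :
    sgn deg i j = sgn deg j i := by
  rw [sgn, sgn, mul_comm (deg j)]

lemma sgn_add_right {I : Type} [AddCommMonoid I] (deg : I →+ ℤ) (i j l : I) :
    sgn deg i (j + l) = sgn deg i j * sgn deg i l := by
  rw [sgn, map_add, mul_add, Int.negOnePow_add]

lemma sgn_add_left {I : Type} [AddCommMonoid I] (deg : I →+ ℤ) (i j l : I) :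
    sgn deg (i + j) l = sgn deg i l * sgn deg j l := by
  rw [sgn, map_add, add_mul, Int.negOnePow_add]

variable {k : Type u} [CommRing k] {I : Type} [AddCommMonoid I] [DecidableEq I] (deg : I →+ ℤ)

noncomputable instance monoidalGraded : MonoidalCategory (GradedObject I (ModuleCat.{u} k)) :=
  GradedObject.monoidalCategory

variable (X Y Z : GradedObject I (ModuleCat.{u} k))

/-- One direction of the symmetry constraint. -/
noncomputable def braidingHom : Monoidal.tensorObj X Y ⟶ Monoidal.tensorObj Y X :=
  fun l => tensorObjDesc (fun i j hij => sgn deg i j • ((β_ (X i) (Y j)).hom ≫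
    ιTensorObj Y X j i l (by rw [add_comm, hij])))

lemma ι_braidingHom (i j l : I) (h : i + j = l) :
    ιTensorObj X Y i j l h ≫ braidingHom deg X Y l =
      sgn deg i j • ((β_ (X i) (Y j)).hom ≫ ιTensorObj Y X j i l (by rw [add_comm, h])) :=
  ι_tensorObjDesc _ _ _ _

lemma ι_braidingHom_assoc (i j l : I) (h : i + j = l) {W : ModuleCat.{u} k}
    (f : Monoidal.tensorObj Y X l ⟶ W) :
    ιTensorObj X Y i j l h ≫ braidingHom deg X Y l ≫ f =
      sgn deg i j • ((β_ (X i) (Y j)).hom ≫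
        ιTensorObj Y X j i l (by rw [add_comm, h]) ≫ f) := by
  rw [← assoc, ι_braidingHom, units_smul_comp, assoc]

lemma braidingHom_comp_braidingHom : braidingHom deg X Y ≫ braidingHom deg Y X = 𝟙 _ := by
  funext l
  apply tensorObj_ext
  intro i j h
  refine (ι_braidingHom_assoc deg X Y i j l h _).trans ?_
  rw [ι_braidingHom, comp_units_smul, SymmetricCategory.symmetry_assoc, smul_smul, sgn_mul_sgn,
    one_smul]
  exact (comp_id _).symm

/-- The symmetry constraint `x ⊗ y ↦ (-1) ^ (|x| |y|) y ⊗ x` on graded modules. -/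
noncomputable def braiding : Monoidal.tensorObj X Y ≅ Monoidal.tensorObj Y X where
  hom := braidingHom deg X Y
  inv := braidingHom deg Y X
  hom_inv_id := braidingHom_comp_braidingHom deg X Y
  inv_hom_id := braidingHom_comp_braidingHom deg Y X

lemma braidingHom_naturality_right {Y Z : GradedObject I (ModuleCat.{u} k)} (f : Y ⟶ Z) :
    Monoidal.whiskerLeft X f ≫ braidingHom deg X Z =
      braidingHom deg X Y ≫ Monoidal.whiskerRight f X := by
  funext l
  apply tensorObj_ext
  intro i j h
  refine (ι_tensorHom_assoc _ _ _ _ _ h _).trans ?_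
  rw [ι_braidingHom, comp_units_smul]
  refine Eq.trans ?_ (ι_braidingHom_assoc deg X Y i j l h _).symm
  rw [ι_tensorHom]
  dsimp
  rw [id_tensorHom, tensorHom_id, BraidedCategory.braiding_naturality_right_assoc]

lemma braidingHom_naturality_left {X Y : GradedObject I (ModuleCat.{u} k)} (f : X ⟶ Y)
    (Z : GradedObject I (ModuleCat.{u} k)) :
    Monoidal.whiskerRight f Z ≫ braidingHom deg Y Z =
      braidingHom deg X Z ≫ Monoidal.whiskerLeft Z f := by
  funext l
  apply tensorObj_ext
  intro i j h
  refine (ι_tensorHom_assoc _ _ _ _ _ h _).trans ?_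
  rw [ι_braidingHom, comp_units_smul]
  refine Eq.trans ?_ (ι_braidingHom_assoc deg X Z i j l h _).symm
  rw [ι_tensorHom]
  dsimp
  rw [id_tensorHom, tensorHom_id, BraidedCategory.braiding_naturality_left_assoc]

lemma hexagon_forward :
    (Monoidal.associator X Y Z).hom ≫ braidingHom deg X (Monoidal.tensorObj Y Z) ≫
        (Monoidal.associator Y Z X).hom =
      Monoidal.whiskerRight (braidingHom deg X Y) Z ≫ (Monoidal.associator Y X Z).hom ≫
        Monoidal.whiskerLeft Y (braidingHom deg X Z) := by
  funext l
  apply tensorObj₃'_ext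
  intro i₁ i₂ i₃ h
  have e₁ : i₂ + i₃ + i₁ = l := by rw [add_comm _ i₁, ← add_assoc, h]
  have e₂ : i₂ + i₁ + i₃ = l := by rw [add_comm i₂ i₁, h]
  trans sgn deg i₁ (i₂ + i₃) • ((α_ (X i₁) (Y i₂) (Z i₃)).hom ≫
    (β_ (X i₁) (Y i₂ ⊗ Z i₃)).hom ≫ (α_ (Y i₂) (Z i₃) (X i₁)).hom ≫
      ιTensorObj₃ Y Z X i₂ i₃ i₁ l e₁)
  · refine (ιTensorObj₃'_associator_hom_assoc X Y Z i₁ i₂ i₃ l h _).trans ?_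
    rw [← comp_units_smul]
    congr 1
    rw [ιTensorObj₃_eq X Y Z i₁ i₂ i₃ l h _ rfl, assoc]
    refine (congrArg _ (ι_braidingHom_assoc deg X (Monoidal.tensorObj Y Z) i₁ (i₂ + i₃) l
      (by rw [← add_assoc, h]) _)).trans ?_
    rw [comp_units_smul, BraidedCategory.braiding_naturality_right_assoc]
    congr 2
    rw [← ιTensorObj₃'_eq_assoc Y Z X i₂ i₃ i₁ l e₁ _ rfl, ιTensorObj₃'_associator_hom]
  · rw [BraidedCategory.hexagon_forward_assoc]
    rw [ιTensorObj₃'_eq X Y Z i₁ i₂ i₃ l h _ rfl, assoc]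
    refine Eq.trans ?_ (congrArg _ (ι_tensorHom_assoc _ _ _ _ _ h _)).symm
    dsimp
    rw [tensorHom_id, ← MonoidalCategory.comp_whiskerRight_assoc, ι_braidingHom,
      units_smul_whiskerRight, units_smul_comp, sgn_add_right, ← smul_smul]
    congr 1
    rw [MonoidalCategory.comp_whiskerRight, assoc, ← comp_units_smul]
    congr 1
    rw [← ιTensorObj₃'_eq_assoc Y X Z i₂ i₁ i₃ l e₂ (i₁ + i₂) (add_comm _ _),
      ιTensorObj₃'_associator_hom_assoc, ← comp_units_smul]
    congr 1
    rw [ιTensorObj₃_eq Y X Z i₂ i₁ i₃ l e₂ _ rfl, assoc, ι_tensorHom]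
    dsimp
    rw [id_tensorHom, ← MonoidalCategory.whiskerLeft_comp_assoc, ι_braidingHom,
      whiskerLeft_units_smul, units_smul_comp, MonoidalCategory.whiskerLeft_comp, assoc,
      ← ιTensorObj₃_eq Y Z X i₂ i₃ i₁ l e₁ (i₁ + i₃) (add_comm _ _)]

lemma hexagon_reverse :
    (Monoidal.associator X Y Z).inv ≫ braidingHom deg (Monoidal.tensorObj X Y) Z ≫
        (Monoidal.associator Z X Y).inv =
      Monoidal.whiskerLeft X (braidingHom deg Y Z) ≫ (Monoidal.associator X Z Y).inv ≫
        Monoidal.whiskerRight (braidingHom deg X Z) Y := by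
  funext l
  apply tensorObj₃_ext
  intro i₁ i₂ i₃ h
  have e₁ : i₃ + i₁ + i₂ = l := by rw [add_assoc, add_comm i₃, h]
  have e₂ : i₁ + i₃ + i₂ = l := by rw [add_assoc, add_comm i₃, ← add_assoc, h]
  trans sgn deg (i₁ + i₂) i₃ • ((α_ (X i₁) (Y i₂) (Z i₃)).inv ≫
    (β_ (X i₁ ⊗ Y i₂) (Z i₃)).hom ≫ (α_ (Z i₃) (X i₁) (Y i₂)).inv ≫
      ιTensorObj₃' Z X Y i₃ i₁ i₂ l e₁)
  · refine (ιTensorObj₃_associator_inv_assoc X Y Z i₁ i₂ i₃ l h _).trans ?_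
    rw [← comp_units_smul]
    congr 1
    rw [ιTensorObj₃'_eq X Y Z i₁ i₂ i₃ l h _ rfl, assoc]
    refine (congrArg _ (ι_braidingHom_assoc deg (Monoidal.tensorObj X Y) Z (i₁ + i₂) i₃ l
      h _)).trans ?_
    rw [comp_units_smul, BraidedCategory.braiding_naturality_left_assoc]
    congr 2
    rw [← ιTensorObj₃_eq_assoc Z X Y i₃ i₁ i₂ l e₁ _ rfl, ιTensorObj₃_associator_inv]
  · rw [BraidedCategory.hexagon_reverse_assoc]
    rw [ιTensorObj₃_eq X Y Z i₁ i₂ i₃ l h _ rfl, assoc]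
    refine Eq.trans ?_ (congrArg _ (ι_tensorHom_assoc _ _ _ _ _ (by rw [← add_assoc, h]) _)).symm
    dsimp
    rw [id_tensorHom, ← MonoidalCategory.whiskerLeft_comp_assoc, ι_braidingHom,
      whiskerLeft_units_smul, units_smul_comp, sgn_add_left, mul_comm, ← smul_smul]
    congr 1
    rw [MonoidalCategory.whiskerLeft_comp, assoc, ← comp_units_smul]
    congr 1
    rw [← ιTensorObj₃_eq_assoc X Z Y i₁ i₃ i₂ l e₂ (i₂ + i₃) (add_comm _ _),
      ιTensorObj₃_associator_inv_assoc, ← comp_units_smul]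
    congr 1
    rw [ιTensorObj₃'_eq X Z Y i₁ i₃ i₂ l e₂ _ rfl, assoc, ι_tensorHom]
    dsimp
    rw [tensorHom_id, ← MonoidalCategory.comp_whiskerRight_assoc, ι_braidingHom,
      units_smul_whiskerRight, units_smul_comp, MonoidalCategory.comp_whiskerRight, assoc,
      ← ιTensorObj₃'_eq Z X Y i₃ i₁ i₂ l e₁ (i₁ + i₃) (add_comm _ _)]

/-- The symmetric monoidal structure on graded modules given by the Koszul sign rule. -/
noncomputable abbrev braidedCategory :
    BraidedCategory (GradedObject I (ModuleCat.{u} k)) where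
  braiding X Y := braiding deg X Y
  braiding_naturality_left f Z := braidingHom_naturality_left deg f Z
  braiding_naturality_right X _ _ f := braidingHom_naturality_right deg X f
  hexagon_forward X Y Z := hexagon_forward deg X Y Z
  hexagon_reverse X Y Z := hexagon_reverse deg X Y Z

noncomputable abbrev symmetricCategory :
    SymmetricCategory (GradedObject I (ModuleCat.{u} k)) where
  toBraidedCategory := braidedCategory deg
  symmetry X Y := braidingHom_comp_braidingHom deg X Y

end KoszulGraded

namespace ChainTensor
open Category KoszulGraded

/-- The sign `(-1) ^ |x|` used in the differential of a tensor product of chain complexes. -/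
instance tensorSigns : ComplexShape.TensorSigns (ComplexShape.down ℤ) where
  ε' := MonoidHom.mk' (fun (i : Multiplicative ℤ) => (Multiplicative.toAdd i).negOnePow)
    (fun i j => Int.negOnePow_add i.toAdd j.toAdd)
  rel_add p q r (hpq : q + 1 = p) := by change (q + r) + 1 = p + r; lia
  add_rel p q r (hpq : q + 1 = p) := by change (r + q) + 1 = r + p; lia
  ε'_succ := by
    rintro p q (hpq : q + 1 = p)
    subst hpq
    change q.negOnePow = - (q + 1).negOnePow
    rw [Int.negOnePow_succ, neg_neg]

end ChainTensor

/-- Unbounded chain complexes of `k`-modules. -/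
abbrev Ch (k : Type u) [CommRing k] := ChainComplex (ModuleCat.{u} k) ℤ

namespace ChainTensor
open Category KoszulGraded

variable {k : Type u} [CommRing k] (K L : Ch k)

lemma ι_d (i j s t : ℤ) (h : i + j = s) (hst : t + 1 = s) :
    HomologicalComplex.ιTensorObj K L i j s h ≫ (HomologicalComplex.tensorObj K L).d s t =
      (K.d i (i - 1) ▷ L.X j) ≫ HomologicalComplex.ιTensorObj K L (i - 1) j t (by lia) +
        i.negOnePow • ((K.X i ◁ L.d j (j - 1)) ≫
          HomologicalComplex.ιTensorObj K L i (j - 1) t (by lia)) := by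
  have e₁ := HomologicalComplex.mapBifunctor.d₁_eq K L (curriedTensor (ModuleCat.{u} k))
    (ComplexShape.down ℤ) (i₁ := i) (i₁' := i - 1) (by simp) j t (by simp; lia)
  have e₂ := HomologicalComplex.mapBifunctor.d₂_eq K L (curriedTensor (ModuleCat.{u} k))
    (ComplexShape.down ℤ) i (i₂ := j) (i₂' := j - 1) (by simp) t (by simp; lia)
  rw [HomologicalComplex.mapBifunctor.d_eq, Preadditive.comp_add,
    HomologicalComplex.mapBifunctor.ι_D₁, HomologicalComplex.mapBifunctor.ι_D₂, e₁, e₂]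
  dsimp
  rw [one_smul]
  rfl

/-- The symmetry constraint on chain complexes, in a given degree. -/
noncomputable def braidingF (s : ℤ) :
    (HomologicalComplex.tensorObj K L).X s ⟶ (HomologicalComplex.tensorObj L K).X s :=
  braidingHom (AddMonoidHom.id ℤ) K.X L.X s

lemma ι_braidingF (i j s : ℤ) (h : i + j = s) :
    HomologicalComplex.ιTensorObj K L i j s h ≫ braidingF K L s =
      (i * j).negOnePow • ((β_ (K.X i) (L.X j)).hom ≫
        HomologicalComplex.ιTensorObj L K j i s (by rw [add_comm, h])) :=
  ι_braidingHom (AddMonoidHom.id ℤ) K.X L.X i j s h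

lemma braidingF_comm (s t : ℤ) (hst : (ComplexShape.down ℤ).Rel s t) :
    braidingF K L s ≫ (HomologicalComplex.tensorObj L K).d s t =
      (HomologicalComplex.tensorObj K L).d s t ≫ braidingF K L t := by
  apply HomologicalComplex.mapBifunctor.hom_ext
  intro i j h
  change i + j = s at h
  change t + 1 = s at hst
  change HomologicalComplex.ιTensorObj K L i j s h ≫ _ =
    HomologicalComplex.ιTensorObj K L i j s h ≫ _
  rw [← assoc, ι_braidingF, ← assoc, ι_d K L i j s t h hst, units_smul_comp, assoc,
    ι_d L K j i s t (by lia) hst, Preadditive.add_comp, assoc, units_smul_comp, assoc,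
    ι_braidingF, ι_braidingF, Preadditive.comp_add, comp_units_smul, comp_units_smul,
    comp_units_smul, ← BraidedCategory.braiding_naturality_left_assoc,
    ← BraidedCategory.braiding_naturality_right_assoc, smul_add, smul_smul, smul_smul, add_comm]
  congr 2
  · rw [← Int.negOnePow_add, Int.negOnePow_eq_iff]
    exact ⟨j, by ring⟩
  · rw [← Int.negOnePow_add, Int.negOnePow_eq_iff]
    exact ⟨0, by ring⟩

/-- The symmetry constraint on chain complexes. -/
noncomputable def braiding :
    HomologicalComplex.tensorObj K L ≅ HomologicalComplex.tensorObj L K where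
  hom := { f := braidingF K L, comm' := fun s t hst => braidingF_comm K L s t hst }
  inv := { f := braidingF L K, comm' := fun s t hst => braidingF_comm L K s t hst }
  hom_inv_id := by
    ext s : 1
    exact congrFun (braidingHom_comp_braidingHom (AddMonoidHom.id ℤ) K.X L.X) s
  inv_hom_id := by
    ext s : 1
    exact congrFun (braidingHom_comp_braidingHom (AddMonoidHom.id ℤ) L.X K.X) s

/-- Forgetting the differential is a monoidal functor. -/
noncomputable instance forgetMonoidal :
    (HomologicalComplex.forget (ModuleCat.{u} k) (ComplexShape.down ℤ)).Monoidal :=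
  Monoidal.fromInducedMonoidal _
    (HomologicalComplex.Monoidal.inducingFunctorData (ModuleCat.{u} k) (ComplexShape.down ℤ))

/-- Chain complexes with the usual tensor product,
`d (x ⊗ y) = d x ⊗ y + (-1) ^ |x| x ⊗ d y`, and the symmetry constraint
`x ⊗ y ↦ (-1) ^ (|x| |y|) y ⊗ x`. -/
noncomputable instance braidedCh : BraidedCategory (Ch k) :=
  letI := KoszulGraded.braidedCategory (k := k) (AddMonoidHom.id ℤ)
  BraidedCategory.ofFaithful
    (HomologicalComplex.forget (ModuleCat.{u} k) (ComplexShape.down ℤ))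
    (fun K L => braiding K L)
    (fun K L => (Category.id_comp _).trans (Category.comp_id _).symm)

noncomputable instance symmetricCh : SymmetricCategory (Ch k) where
  symmetry K L := (braiding K L).hom_inv_id

end ChainTensor

/-- A twisted complex of `k`-modules concentrated in the right half-plane: modules `X (p, q)` for
`p : ℕ`, `q : ℤ`, with maps `d_i : X (p, q) ⟶ X (p - i, q + i - 1)` for `i ≥ 0`, such that
`∑_{i + j = n} d_i d_j = 0` for all `n ≥ 0`. As for Mathlib's homological complexes, `d i a b`
is given for all bidegrees `a`, `b`, and vanishes unless `b = (a.1 - i, a.2 + i - 1)`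
(in particular it vanishes if `i > a.1`). -/
structure TwistedComplex (k : Type u) [CommRing k] where
  X : GradedObject (ℕ × ℤ) (ModuleCat.{u} k)
  d (i : ℕ) (a b : ℕ × ℤ) : X a ⟶ X b
  shape (i : ℕ) (a b : ℕ × ℤ) : ¬ (b.1 + i = a.1 ∧ b.2 + 1 = a.2 + i) → d i a b = 0
  d_comp_d (n : ℕ) (a c : ℕ × ℤ) :
    ∑ ij ∈ Finset.HasAntidiagonal.antidiagonal n,
      d ij.2 a (a.1 - ij.2, a.2 + ij.2 - 1) ≫ d ij.1 (a.1 - ij.2, a.2 + ij.2 - 1) c = 0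

namespace TwistedComplex
open Category

variable {k : Type u} [CommRing k]

/-- Morphisms of twisted complexes: families of maps that commute with all `d_i`. -/
@[ext]
structure Hom (X Y : TwistedComplex.{u} k) where
  f (a : ℕ × ℤ) : X.X a ⟶ Y.X a
  comm (i : ℕ) (a b : ℕ × ℤ) : f a ≫ Y.d i a b = X.d i a b ≫ f b

instance : Category (TwistedComplex.{u} k) where
  Hom X Y := Hom X Y
  id X := { f := fun _ => 𝟙 _, comm := by simp }
  comp f g :=
    { f := fun a => f.f a ≫ g.f a
      comm := fun i a b => by rw [assoc, g.comm, ← assoc, f.comm, assoc] }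

@[ext]
lemma hom_ext {X Y : TwistedComplex.{u} k} (f g : X ⟶ Y) (h : ∀ a, f.f a = g.f a) : f = g :=
  Hom.ext (funext h)

@[simp]
lemma id_f (X : TwistedComplex.{u} k) (a : ℕ × ℤ) : Hom.f (𝟙 X) a = 𝟙 (X.X a) := rfl

@[simp]
lemma comp_f {X Y Z : TwistedComplex.{u} k} (f : X ⟶ Y) (g : Y ⟶ Z) (a : ℕ × ℤ) :
    (f ≫ g).f a = f.f a ≫ g.f a := rfl

/-- The bidegree in which `d_i` takes its values on bidegree `a` (if `i ≤ a.1`). -/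
abbrev nxt (i : ℕ) (a : ℕ × ℤ) : ℕ × ℤ := (a.1 - i, a.2 + i - 1)

lemma shape' (X : TwistedComplex.{u} k) (i : ℕ) (a b : ℕ × ℤ) (h : b ≠ nxt i a) :
    X.d i a b = 0 :=
  X.shape i a b (fun h' => h (Prod.ext (by simp; lia) (by simp; lia)))

lemma d_zero_comp_d_zero (X : TwistedComplex.{u} k) (a b c : ℕ × ℤ) :
    X.d 0 a b ≫ X.d 0 b c = 0 := by
  by_cases h : b = nxt 0 a
  · subst h
    have := X.d_comp_d 0 a c
    rw [Finset.Nat.antidiagonal_zero, Finset.sum_singleton] at this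
    exact this
  · rw [X.shape' 0 a b h, zero_comp]

/-! ### Vertical complexes and the total complex -/

variable (k) in
/-- The functor `X ↦ X_{p,*}`, where `X_{p,*}` has the vertical differential `d_0`.
The homology of `X_{p,*}` is the vertical homology of `X` in horizontal degree `p`. -/
def column (p : ℕ) : TwistedComplex.{u} k ⥤ Ch.{u} k where
  obj X :=
    { X := fun q => X.X (p, q)
      d := fun q q' => X.d 0 (p, q) (p, q')
      shape := fun q q' h => X.shape _ _ _ (fun h' => h (by simpa using h'.2))
      d_comp_d' := fun _ _ _ _ _ => X.d_zero_comp_d_zero _ _ _ }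
  map f :=
    { f := fun q => f.f (p, q)
      comm' := fun q q' _ => f.comm _ _ _ }

variable (k) in
/-- A chain complex, seen as a twisted complex concentrated in horizontal degree `0`. -/
def inclObjX (K : Ch.{u} k) : GradedObject (ℕ × ℤ) (ModuleCat.{u} k)
  | (0, q) => K.X q
  | (_ + 1, _) => ModuleCat.of k PUnit

def inclObjD (K : Ch.{u} k) : ∀ (i : ℕ) (a b : ℕ × ℤ), inclObjX k K a ⟶ inclObjX k K b
  | 0, (0, q), (0, q') => K.d q q'
  | _ + 1, (0, _), (0, _) => 0
  | _, (_ + 1, _), _ => 0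
  | _, (0, _), (_ + 1, _) => 0

lemma inclObjD_succ (K : Ch.{u} k) (i : ℕ) (a b : ℕ × ℤ) : inclObjD K (i + 1) a b = 0 := by
  obtain ⟨_ | _, _⟩ := a <;> obtain ⟨_ | _, _⟩ := b <;> rfl

def inclObj (K : Ch.{u} k) : TwistedComplex.{u} k where
  X := inclObjX k K
  d := inclObjD K
  shape := by
    rintro (_ | i) ⟨_ | p, q⟩ ⟨_ | p', q'⟩ h
    · exact K.shape _ _ (fun h' => h ⟨rfl, by simpa using h'⟩)
    all_goals rfl
  d_comp_d := by
    rintro (_ | n) a c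
    · simp only [Finset.Nat.antidiagonal_zero, Finset.sum_singleton]
      obtain ⟨_ | p, q⟩ := a
      · obtain ⟨_ | p', q'⟩ := c
        · exact K.d_comp_d _ _ _
        · exact comp_zero
      · exact zero_comp
    · refine Finset.sum_eq_zero ?_
      rintro ⟨_ | i, j⟩ h
      · obtain rfl : j = n + 1 := by simpa using h
        dsimp only
        rw [inclObjD_succ, zero_comp]
      · dsimp only
        rw [inclObjD_succ, comp_zero]

def inclMapF {K L : Ch.{u} k} (f : K ⟶ L) : ∀ a : ℕ × ℤ, inclObjX k K a ⟶ inclObjX k L a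
  | (0, q) => f.f q
  | (_ + 1, _) => 0

variable (k) in
/-- The inclusion of chain complexes as twisted complexes concentrated in horizontal
degree `0`. -/
def inclusion : Ch.{u} k ⥤ TwistedComplex.{u} k where
  obj K := inclObj K
  map {K L} f :=
    { f := inclMapF f
      comm := by
        rintro (_ | i) a b
        · obtain ⟨_ | p, q⟩ := a
          · obtain ⟨_ | p', q'⟩ := b
            · exact f.comm _ _
            · exact comp_zero.trans comp_zero.symm
          · exact zero_comp.trans zero_comp.symm
        · exact (congrArg _ (inclObjD_succ L i a b)).trans (comp_zero.trans
            (zero_comp.symm.trans (congrArg (· ≫ _) (inclObjD_succ K i a b).symm))) }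
  map_id K := by
    ext ⟨_ | p, q⟩ : 1
    · rfl
    · exact ModuleCat.hom_ext (LinearMap.ext fun _ => rfl)
  map_comp f g := by
    ext ⟨_ | p, q⟩ : 1
    · rfl
    · exact ModuleCat.hom_ext (LinearMap.ext fun _ => rfl)

lemma sum_d_comp_d (X : TwistedComplex.{u} k) (n : ℕ) (a c : ℕ × ℤ) (b : ℕ × ℕ → ℕ × ℤ)
    (hb : ∀ ij ∈ Finset.HasAntidiagonal.antidiagonal n, b ij = nxt ij.2 a) :
    ∑ ij ∈ Finset.HasAntidiagonal.antidiagonal n,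
      X.d ij.2 a (b ij) ≫ X.d ij.1 (b ij) c = 0 := by
  rw [← X.d_comp_d n a c]
  refine Finset.sum_congr rfl (fun ij h => ?_)
  rw [hb ij h]

open DirectSum in
/-- The differential `d = ∑ d_i` of the total complex: it maps `x` in bidegree `(p, n - p)` to
the sum of the elements `d_i x` in bidegree `(r, m - r)`, where `i + r = p` and `m = n - 1`. -/
noncomputable def totD (X : TwistedComplex.{u} k) (n m : ℤ) :
    (⨁ p : ℕ, X.X (p, n - p)) →ₗ[k] (⨁ p : ℕ, X.X (p, m - p)) :=
  DirectSum.toModule k ℕ _ fun p => ∑ ir ∈ Finset.HasAntidiagonal.antidiagonal p,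
    DirectSum.lof k ℕ (fun p : ℕ => X.X (p, m - p)) ir.2 ∘ₗ
      (X.d ir.1 (p, n - p) (ir.2, m - ir.2)).hom

open DirectSum in
lemma totD_lof (X : TwistedComplex.{u} k) (n m : ℤ) (p : ℕ) (x : X.X (p, n - p)) :
    totD X n m (DirectSum.lof k ℕ (fun p : ℕ => X.X (p, n - p)) p x) =
      ∑ ir ∈ Finset.HasAntidiagonal.antidiagonal p,
        DirectSum.lof k ℕ (fun p : ℕ => X.X (p, m - p)) ir.2
          ((X.d ir.1 (p, n - p) (ir.2, m - ir.2)).hom x) := by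
  simp [totD]

lemma totD_shape (X : TwistedComplex.{u} k) (n m : ℤ) (h : m + 1 ≠ n) : totD X n m = 0 := by
  refine DirectSum.linearMap_ext k (fun p => LinearMap.ext fun x => ?_)
  rw [LinearMap.comp_apply, totD_lof]
  refine Finset.sum_eq_zero (fun ir hir => ?_)
  rw [Finset.HasAntidiagonal.mem_antidiagonal] at hir
  rw [X.shape _ _ _ (fun h' => h (by have := h'.2; dsimp at this; lia))]
  simp

lemma sum_antidiagonal_reindex {M : Type*} [AddCommMonoid M] (p : ℕ) (F : ℕ → ℕ → ℕ → ℕ → M) :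
    ∑ ir ∈ Finset.HasAntidiagonal.antidiagonal p,
      ∑ js ∈ Finset.HasAntidiagonal.antidiagonal ir.2, F ir.1 ir.2 js.1 js.2 =
    ∑ Ns ∈ Finset.HasAntidiagonal.antidiagonal p,
      ∑ ji ∈ Finset.HasAntidiagonal.antidiagonal Ns.1, F ji.2 (Ns.2 + ji.1) ji.1 Ns.2 := by
  rw [Finset.sum_sigma', Finset.sum_sigma']
  refine Finset.sum_nbij' (fun x => ⟨(x.1.1 + x.2.1, x.2.2), (x.2.1, x.1.1)⟩)
    (fun x => ⟨(x.2.2, x.1.2 + x.2.1), (x.2.1, x.1.2)⟩) ?_ ?_ ?_ ?_ ?_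
  all_goals
    rintro ⟨⟨a, b⟩, ⟨c, d⟩⟩ h
    simp only [Finset.mem_sigma, Finset.HasAntidiagonal.mem_antidiagonal] at h ⊢
    obtain ⟨h₁, h₂⟩ := h
    try subst h₂
    try subst h₁
  · lia
  · lia
  · simp [add_comm]
  · simp [add_comm]
  · rw [add_comm]

lemma totD_comp_totD (X : TwistedComplex.{u} k) (n m l : ℤ) (h : m + 1 = n) :
    totD X m l ∘ₗ totD X n m = 0 := by
  refine DirectSum.linearMap_ext k (fun p => LinearMap.ext fun x => ?_)
  rw [LinearMap.comp_apply, LinearMap.comp_apply, totD_lof, map_sum]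
  simp only [totD_lof]
  refine (sum_antidiagonal_reindex p (fun i r j s =>
    DirectSum.lof k ℕ (fun p : ℕ => X.X (p, l - p)) s ((X.d j (r, m - r) (s, l - s)).hom
      ((X.d i (p, n - p) (r, m - r)).hom x)))).trans ?_
  refine Finset.sum_eq_zero (fun Ns hNs => ?_)
  rw [Finset.HasAntidiagonal.mem_antidiagonal] at hNs
  rw [← map_sum]
  have := X.sum_d_comp_d Ns.1 (p, n - p) (Ns.2, l - Ns.2)
    (fun ji => (Ns.2 + ji.1, m - (Ns.2 + ji.1 : ℕ))) (fun ji hji => by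
      rw [Finset.HasAntidiagonal.mem_antidiagonal] at hji
      refine Prod.ext ?_ ?_
      · dsimp; lia
      · dsimp; lia)
  have := congrArg (fun f => f.hom x) this
  simp only [ModuleCat.hom_sum, LinearMap.sum_apply, ModuleCat.hom_comp,
    LinearMap.comp_apply] at this
  exact (congrArg _ this).trans (map_zero _)

variable (k) in
/-- The total complex `Tot(X)_n = ⨁_{p + q = n} X_{p,q}` with the differential `∑ d_i`. -/
noncomputable def tot : TwistedComplex.{u} k ⥤ Ch.{u} k where
  obj X :=
    { X := fun n => ModuleCat.of k (DirectSum ℕ fun p => X.X (p, n - p))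
      d := fun n m => ModuleCat.ofHom (totD X n m)
      shape := fun n m h => by rw [totD_shape X n m h]; rfl
      d_comp_d' := fun n m l h _ => by
        rw [← ModuleCat.ofHom_comp, totD_comp_totD X n m l h]; rfl }
  map f :=
    { f := fun n => ModuleCat.ofHom (DirectSum.lmap fun p => (f.f (p, n - p)).hom)
      comm' := fun n m _ => by
        refine ModuleCat.hom_ext (DirectSum.linearMap_ext k (fun p => LinearMap.ext fun x => ?_))
        simp only [ModuleCat.hom_comp, ModuleCat.hom_ofHom, LinearMap.comp_apply, totD_lof,
          DirectSum.lmap_lof, map_sum]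
        refine Finset.sum_congr rfl (fun ir _ => ?_)
        exact congrArg _ (congrArg (fun g => g.hom x)
          (f.comm ir.1 (p, n - p) (ir.2, m - ir.2))) }
  map_id X := by
    ext n : 1
    refine ModuleCat.hom_ext (DirectSum.linearMap_ext k (fun p => LinearMap.ext fun x => ?_))
    exact DirectSum.lmap_lof _ _ _
  map_comp f g := by
    ext n : 1
    refine ModuleCat.hom_ext (DirectSum.linearMap_ext k (fun p => LinearMap.ext fun x => ?_))
    dsimp
    simp only [DirectSum.lmap_lof]
    rfl

end TwistedComplex

namespace TwistedComplex
open Category KoszulGraded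
open GradedObject.Monoidal (ιTensorObj tensorObjDesc tensorObj_ext ι_tensorObjDesc
  ι_tensorObjDesc_assoc ιTensorObj₃ ιTensorObj₃' tensorObj₃_ext tensorObj₃'_ext ι_tensorHom
  ι_tensorHom_assoc ιTensorObj₃_eq ιTensorObj₃'_eq ιTensorObj₃_eq_assoc ιTensorObj₃'_eq_assoc
  ιTensorObj₃'_associator_hom ιTensorObj₃_associator_inv ιTensorObj₃'_associator_hom_assoc
  ιTensorObj₃_associator_inv_assoc)

variable {k : Type u} [CommRing k]

/-- The total degree `p + q` of the bidegree `(p, q)`. -/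
def totDeg : ℕ × ℤ →+ ℤ where
  toFun a := a.1 + a.2
  map_zero' := by simp
  map_add' a b := by simp; ring

lemma totDeg_nxt (i : ℕ) (a : ℕ × ℤ) (h : i ≤ a.1) : totDeg (nxt i a) = totDeg a - 1 := by
  simp [totDeg]; lia

lemma nxt_add (i : ℕ) (a b : ℕ × ℤ) (h : i ≤ a.1) : nxt i a + b = nxt i (a + b) :=
  Prod.ext (by simp; lia) (by simp; lia)

lemma add_nxt (i : ℕ) (a b : ℕ × ℤ) (h : i ≤ b.1) : a + nxt i b = nxt i (a + b) :=
  Prod.ext (by simp; lia) (by simp; lia)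

lemma d_eq_zero_of_lt (X : TwistedComplex.{u} k) (i : ℕ) (a b : ℕ × ℤ) (h : ¬ i ≤ a.1) :
    X.d i a b = 0 :=
  X.shape i a b (fun h' => h (by lia))

/-- The inclusion of the summand `A a ⊗ B b` of a graded tensor product in degree `t`, which
is `0` if `t ≠ a + b`. -/
noncomputable def ιz (A B : GradedObject (ℕ × ℤ) (ModuleCat.{u} k)) (a b t : ℕ × ℤ) :
    A a ⊗ B b ⟶ GradedObject.Monoidal.tensorObj A B t :=
  if h : a + b = t then ιTensorObj A B a b t h else 0

lemma ιz_eq (A B : GradedObject (ℕ × ℤ) (ModuleCat.{u} k)) (a b t : ℕ × ℤ) (h : a + b = t) :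
    ιz A B a b t = ιTensorObj A B a b t h := dif_pos h

lemma ιz_eq_zero (A B : GradedObject (ℕ × ℤ) (ModuleCat.{u} k)) (a b t : ℕ × ℤ)
    (h : a + b ≠ t) : ιz A B a b t = 0 := dif_neg h

section
variable (X Y Z : TwistedComplex.{u} k)

/-- The maps `d_i` on the tensor product, given by
`d_i (x ⊗ y) = d_i x ⊗ y + (-1) ^ |x| x ⊗ d_i y` where `|x|` is the total degree. -/
noncomputable def tensorD (i : ℕ) (s t : ℕ × ℤ) :
    GradedObject.Monoidal.tensorObj X.X Y.X s ⟶ GradedObject.Monoidal.tensorObj X.X Y.X t :=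
  tensorObjDesc fun a b _ =>
    (X.d i a (nxt i a) ▷ Y.X b) ≫ ιz X.X Y.X (nxt i a) b t +
      (totDeg a).negOnePow • ((X.X a ◁ Y.d i b (nxt i b)) ≫ ιz X.X Y.X a (nxt i b) t)

lemma ι_tensorD (i : ℕ) (a b s t : ℕ × ℤ) (h : a + b = s) :
    ιTensorObj X.X Y.X a b s h ≫ tensorD X Y i s t =
      (X.d i a (nxt i a) ▷ Y.X b) ≫ ιz X.X Y.X (nxt i a) b t +
        (totDeg a).negOnePow • ((X.X a ◁ Y.d i b (nxt i b)) ≫ ιz X.X Y.X a (nxt i b) t) :=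
  ι_tensorObjDesc _ _ _ _

lemma tensorD_shape (i : ℕ) (s t : ℕ × ℤ) (h : ¬ (t.1 + i = s.1 ∧ t.2 + 1 = s.2 + i)) :
    tensorD X Y i s t = 0 := by
  refine tensorObj_ext _ _ (fun a b h0 => ?_)
  subst h0
  rw [ι_tensorD, comp_zero]
  have h₁ : (X.d i a (nxt i a) ▷ Y.X b) ≫ ιz X.X Y.X (nxt i a) b t = 0 := by
    by_cases hi : i ≤ a.1
    · rw [ιz_eq_zero, comp_zero]
      rintro rfl
      exact h (by simp; lia)
    · rw [X.d_eq_zero_of_lt i a _ hi]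
      simp
  have h₂ : (X.X a ◁ Y.d i b (nxt i b)) ≫ ιz X.X Y.X a (nxt i b) t = 0 := by
    by_cases hi : i ≤ b.1
    · rw [ιz_eq_zero, comp_zero]
      rintro rfl
      exact h (by simp; lia)
    · rw [Y.d_eq_zero_of_lt i b _ hi]
      simp
  rw [h₁, h₂, smul_zero, add_zero]

lemma d_ιz_tensorD_left (i j : ℕ) (a b c : ℕ × ℤ) :
    (X.d j a (nxt j a) ▷ Y.X b) ≫ ιz X.X Y.X (nxt j a) b (nxt j (a + b)) ≫
        tensorD X Y i (nxt j (a + b)) c =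
      (X.d j a (nxt j a) ▷ Y.X b) ≫ (X.d i (nxt j a) (nxt i (nxt j a)) ▷ Y.X b) ≫
          ιz X.X Y.X (nxt i (nxt j a)) b c -
        (totDeg a).negOnePow • ((X.d j a (nxt j a) ▷ Y.X b) ≫
          (X.X (nxt j a) ◁ Y.d i b (nxt i b)) ≫ ιz X.X Y.X (nxt j a) (nxt i b) c) := by
  by_cases hj : j ≤ a.1
  · rw [ιz_eq _ _ _ _ _ (nxt_add j a b hj), ι_tensorD, totDeg_nxt j a hj, Int.negOnePow_sub,
      Preadditive.comp_add, comp_units_smul, Int.negOnePow_one]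
    simp [sub_eq_add_neg]
  · rw [X.d_eq_zero_of_lt j a _ hj]
    simp

lemma d_ιz_tensorD_right (i j : ℕ) (a b c : ℕ × ℤ) :
    (X.X a ◁ Y.d j b (nxt j b)) ≫ ιz X.X Y.X a (nxt j b) (nxt j (a + b)) ≫
        tensorD X Y i (nxt j (a + b)) c =
      (X.X a ◁ Y.d j b (nxt j b)) ≫ (X.d i a (nxt i a) ▷ Y.X (nxt j b)) ≫
          ιz X.X Y.X (nxt i a) (nxt j b) c +
        (totDeg a).negOnePow • ((X.X a ◁ Y.d j b (nxt j b)) ≫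
          (X.X a ◁ Y.d i (nxt j b) (nxt i (nxt j b))) ≫
            ιz X.X Y.X a (nxt i (nxt j b)) c) := by
  by_cases hj : j ≤ b.1
  · rw [ιz_eq _ _ _ _ _ (add_nxt j a b hj), ι_tensorD, Preadditive.comp_add, comp_units_smul]
  · rw [Y.d_eq_zero_of_lt j b _ hj]
    simp

lemma sum_d_d (n : ℕ) (a : ℕ × ℤ) {W : ModuleCat.{u} k} (F : ModuleCat.{u} k ⥤ ModuleCat.{u} k)
    [F.Additive] (g : ∀ c, F.obj (X.X c) ⟶ W) :
    ∑ ij ∈ Finset.HasAntidiagonal.antidiagonal n,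
      F.map (X.d ij.2 a (nxt ij.2 a)) ≫
        F.map (X.d ij.1 (nxt ij.2 a) (nxt ij.1 (nxt ij.2 a))) ≫
          g (nxt ij.1 (nxt ij.2 a)) = 0 := by
  have h := X.d_comp_d n a (a.1 - n, a.2 + n - 2)
  rw [← zero_comp (f := g (a.1 - n, a.2 + n - 2)), ← F.map_zero, ← h, F.map_sum,
    Preadditive.sum_comp]
  refine Finset.sum_congr rfl (fun ij hij => ?_)
  rw [Finset.HasAntidiagonal.mem_antidiagonal] at hij
  have e : nxt ij.1 (nxt ij.2 a) = (a.1 - n, a.2 + n - 2) :=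
    Prod.ext (by simp; lia) (by simp; lia)
  rw [e, F.map_comp, assoc]

/-- The tensor product of twisted complexes. -/
noncomputable abbrev tensor : TwistedComplex.{u} k where
  X := GradedObject.Monoidal.tensorObj X.X Y.X
  d := tensorD X Y
  shape := tensorD_shape X Y
  d_comp_d n s c := by
    refine tensorObj_ext _ _ (fun a b h0 => ?_)
    subst h0
    rw [Preadditive.comp_sum, comp_zero]
    have key (ij : ℕ × ℕ) : ιTensorObj X.X Y.X a b (a + b) rfl ≫
        tensorD X Y ij.2 (a + b) (nxt ij.2 (a + b)) ≫ tensorD X Y ij.1 (nxt ij.2 (a + b)) c =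
        ((X.d ij.2 a (nxt ij.2 a) ▷ Y.X b) ≫
          (X.d ij.1 (nxt ij.2 a) (nxt ij.1 (nxt ij.2 a)) ▷ Y.X b) ≫
            ιz X.X Y.X (nxt ij.1 (nxt ij.2 a)) b c) +
        ((X.X a ◁ Y.d ij.2 b (nxt ij.2 b)) ≫
          (X.X a ◁ Y.d ij.1 (nxt ij.2 b) (nxt ij.1 (nxt ij.2 b))) ≫
            ιz X.X Y.X a (nxt ij.1 (nxt ij.2 b)) c) +
        ((totDeg a).negOnePow • ((X.X a ◁ Y.d ij.2 b (nxt ij.2 b)) ≫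
            (X.d ij.1 a (nxt ij.1 a) ▷ Y.X (nxt ij.2 b)) ≫
              ιz X.X Y.X (nxt ij.1 a) (nxt ij.2 b) c) -
          (totDeg a).negOnePow • ((X.X a ◁ Y.d ij.1 b (nxt ij.1 b)) ≫
            (X.d ij.2 a (nxt ij.2 a) ▷ Y.X (nxt ij.1 b)) ≫
              ιz X.X Y.X (nxt ij.2 a) (nxt ij.1 b) c)) := by
      rw [← assoc, ι_tensorD, Preadditive.add_comp, assoc, d_ιz_tensorD_left, units_smul_comp,
        assoc, d_ιz_tensorD_right, smul_add, smul_smul, Int.units_mul_self, one_smul,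
        whisker_exchange_assoc, whisker_exchange_assoc]
      abel
    refine (Finset.sum_congr rfl (fun ij _ => key ij)).trans ?_
    rw [Finset.sum_add_distrib, Finset.sum_add_distrib, Finset.sum_sub_distrib]
    have h₁ : @Eq (X.X a ⊗ Y.X b ⟶ GradedObject.Monoidal.tensorObj X.X Y.X c) _ _ :=
      X.sum_d_d n a (tensorRight (Y.X b)) (fun a' => ιz X.X Y.X a' b c)
    have h₂ : @Eq (X.X a ⊗ Y.X b ⟶ GradedObject.Monoidal.tensorObj X.X Y.X c) _ _ :=
      Y.sum_d_d n b (tensorLeft (X.X a)) (fun b' => ιz X.X Y.X a b' c)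
    refine (congrArg₂ (· + ·) (congrArg₂ (· + ·) h₁ h₂)
      (sub_eq_zero.2 (Finset.Nat.sum_antidiagonal_swap (n := n)).symm)).trans ?_
    simp

end

end TwistedComplex

namespace TwistedComplex
open Category KoszulGraded
open GradedObject.Monoidal (ιTensorObj tensorObjDesc tensorObj_ext ι_tensorObjDesc
  ι_tensorObjDesc_assoc ιTensorObj₃ ιTensorObj₃' tensorObj₃_ext tensorObj₃'_ext ι_tensorHom
  ι_tensorHom_assoc ιTensorObj₃_eq ιTensorObj₃'_eq ιTensorObj₃_eq_assoc ιTensorObj₃'_eq_assoc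
  ιTensorObj₃'_associator_hom ιTensorObj₃_associator_inv ιTensorObj₃'_associator_hom_assoc
  ιTensorObj₃_associator_inv_assoc)

variable {k : Type u} [CommRing k]

/-- An isomorphism of bigraded modules that commutes with all `d_i` is an isomorphism of
twisted complexes. -/
def isoMk {X Y : TwistedComplex.{u} k} (e : X.X ≅ Y.X)
    (h : ∀ i a b, e.hom a ≫ Y.d i a b = X.d i a b ≫ e.hom b) : X ≅ Y where
  hom := { f := e.hom, comm := h }
  inv :=
    { f := e.inv
      comm := fun i a b => by
        have h₁ (a) : e.inv a ≫ e.hom a = 𝟙 _ := congrFun e.inv_hom_id a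
        have h₂ (a) : e.hom a ≫ e.inv a = 𝟙 _ := congrFun e.hom_inv_id a
        calc e.inv a ≫ X.d i a b = e.inv a ≫ (X.d i a b ≫ e.hom b) ≫ e.inv b := by
              rw [assoc, h₂, comp_id]
          _ = _ := by rw [← h, assoc, ← assoc, h₁, id_comp] }
  hom_inv_id := hom_ext _ _ (congrFun e.hom_inv_id)
  inv_hom_id := hom_ext _ _ (congrFun e.inv_hom_id)

variable (k) in
/-- Forgetting the maps `d_i`. -/
def forget : TwistedComplex.{u} k ⥤ GradedObject (ℕ × ℤ) (ModuleCat.{u} k) where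
  obj X := X.X
  map f := f.f

instance : (forget k).Faithful where
  map_injective h := hom_ext _ _ (congrFun h)

lemma ιz_tensorHom {A A' B B' : GradedObject (ℕ × ℤ) (ModuleCat.{u} k)} (f : A ⟶ A')
    (g : B ⟶ B') (a b t : ℕ × ℤ) :
    ιz A B a b t ≫ GradedObject.Monoidal.tensorHom f g t =
      (f a ⊗ₘ g b) ≫ ιz A' B' a b t := by
  by_cases h : a + b = t
  · rw [ιz_eq _ _ _ _ _ h, ιz_eq _ _ _ _ _ h, ι_tensorHom]
  · rw [ιz_eq_zero _ _ _ _ _ h, ιz_eq_zero _ _ _ _ _ h, comp_zero, zero_comp]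

/-- The tensor product of morphisms. -/
noncomputable def tensorMap {X X' Y Y' : TwistedComplex.{u} k} (f : X ⟶ X') (g : Y ⟶ Y') :
    tensor X Y ⟶ tensor X' Y' where
  f := GradedObject.Monoidal.tensorHom (I := ℕ × ℤ) (C := ModuleCat.{u} k) f.f g.f
  comm i s t := by
    apply tensorObj_ext
    intro a b h
    change ιTensorObj X.X Y.X a b s h ≫ GradedObject.Monoidal.tensorHom f.f g.f s ≫
        tensorD X' Y' i s t =
      ιTensorObj X.X Y.X a b s h ≫ tensorD X Y i s t ≫ GradedObject.Monoidal.tensorHom f.f g.f t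
    rw [← assoc, ι_tensorHom, assoc, ι_tensorD, ← assoc, ι_tensorD, Preadditive.add_comp,
      units_smul_comp, assoc, assoc, ιz_tensorHom, ιz_tensorHom, Preadditive.comp_add,
      comp_units_smul]
    congr 1
    · rw [← tensorHom_id, ← tensorHom_id, ← assoc, ← assoc,
        MonoidalCategory.tensorHom_comp_tensorHom, MonoidalCategory.tensorHom_comp_tensorHom,
        f.comm, id_comp, comp_id]
    · rw [← id_tensorHom, ← id_tensorHom, ← assoc, ← assoc,
        MonoidalCategory.tensorHom_comp_tensorHom, MonoidalCategory.tensorHom_comp_tensorHom,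
        g.comm, id_comp, comp_id]

variable (k) in
/-- The tensor unit: `k` concentrated in bidegree `(0, 0)`. -/
noncomputable abbrev unit : TwistedComplex.{u} k where
  X := GradedObject.Monoidal.tensorUnit
  d _ _ _ := 0
  shape _ _ _ _ := rfl
  d_comp_d _ _ _ := Finset.sum_eq_zero (fun _ _ => comp_zero)

section
variable (A B C : GradedObject (ℕ × ℤ) (ModuleCat.{u} k))

/-- The inclusion of a summand `(A a ⊗ B b) ⊗ C c` in degree `t`, zero if `t ≠ a + b + c`. -/
noncomputable def ιz₃' (a b c t : ℕ × ℤ) : (A a ⊗ B b) ⊗ C c ⟶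
    GradedObject.Monoidal.tensorObj (GradedObject.Monoidal.tensorObj A B) C t :=
  if h : a + b + c = t then ιTensorObj₃' A B C a b c t h else 0

/-- The inclusion of a summand `A a ⊗ (B b ⊗ C c)` in degree `t`, zero if `t ≠ a + b + c`. -/
noncomputable def ιz₃ (a b c t : ℕ × ℤ) : A a ⊗ B b ⊗ C c ⟶
    GradedObject.Monoidal.tensorObj A (GradedObject.Monoidal.tensorObj B C) t :=
  if h : a + b + c = t then ιTensorObj₃ A B C a b c t h else 0

lemma ιz₃'_associator (a b c t : ℕ × ℤ) :
    ιz₃' A B C a b c t ≫ (GradedObject.Monoidal.associator A B C).hom t =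
      (α_ _ _ _).hom ≫ ιz₃ A B C a b c t := by
  by_cases h : a + b + c = t
  · rw [ιz₃', dif_pos h, ιz₃, dif_pos h, ιTensorObj₃'_associator_hom]
  · rw [ιz₃', dif_neg h, ιz₃, dif_neg h, zero_comp, comp_zero]

lemma ι_whiskerRight_ιz (a b c ab t : ℕ × ℤ) (h : a + b = ab) :
    (ιTensorObj A B a b ab h ▷ C c) ≫ ιz (GradedObject.Monoidal.tensorObj A B) C ab c t =
      ιz₃' A B C a b c t := by
  subst h
  by_cases h : a + b + c = t
  · rw [ιz_eq _ _ _ _ _ h, ιz₃', dif_pos h, ιTensorObj₃'_eq _ _ _ _ _ _ _ h _ rfl]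
  · rw [ιz_eq_zero _ _ _ _ _ h, ιz₃', dif_neg h, comp_zero]

lemma whiskerLeft_ι_ιz (a b c bc t : ℕ × ℤ) (h : b + c = bc) :
    (A a ◁ ιTensorObj B C b c bc h) ≫ ιz A (GradedObject.Monoidal.tensorObj B C) a bc t =
      ιz₃ A B C a b c t := by
  subst h
  by_cases h : a + b + c = t
  · rw [ιz_eq _ _ _ _ _ (by rw [← add_assoc, h]), ιz₃, dif_pos h,
      ιTensorObj₃_eq _ _ _ _ _ _ _ h _ rfl]
  · rw [ιz_eq_zero _ _ _ _ _ (by rwa [← add_assoc]), ιz₃, dif_neg h, comp_zero]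

end

section
variable (X Y Z : TwistedComplex.{u} k)

lemma ι₃'_tensorD (i : ℕ) (a b c s t : ℕ × ℤ) (h : a + b + c = s) :
    ιTensorObj₃' X.X Y.X Z.X a b c s h ≫ tensorD (tensor X Y) Z i s t =
      ((X.d i a (nxt i a) ▷ Y.X b) ▷ Z.X c) ≫ ιz₃' X.X Y.X Z.X (nxt i a) b c t +
      (totDeg a).negOnePow • (((X.X a ◁ Y.d i b (nxt i b)) ▷ Z.X c) ≫
        ιz₃' X.X Y.X Z.X a (nxt i b) c t) +
      (totDeg a + totDeg b).negOnePow • (((X.X a ⊗ Y.X b) ◁ Z.d i c (nxt i c)) ≫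
        ιz₃' X.X Y.X Z.X a b (nxt i c) t) := by
  have e₁ : ((X.d i a (nxt i a) ▷ Y.X b) ≫ ιz X.X Y.X (nxt i a) b (nxt i (a + b))) ▷ Z.X c ≫
      ιz (tensor X Y).X Z.X (nxt i (a + b)) c t =
      ((X.d i a (nxt i a) ▷ Y.X b) ▷ Z.X c) ≫ ιz₃' X.X Y.X Z.X (nxt i a) b c t := by
    by_cases hi : i ≤ a.1
    · rw [ιz_eq _ _ _ _ _ (nxt_add i a b hi), MonoidalCategory.comp_whiskerRight, assoc]
      congr 1
      exact ι_whiskerRight_ιz _ _ _ _ _ _ _ _ _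
    · rw [X.d_eq_zero_of_lt i a _ hi]
      simp
  have e₂ : ((X.X a ◁ Y.d i b (nxt i b)) ≫ ιz X.X Y.X a (nxt i b) (nxt i (a + b))) ▷ Z.X c ≫
      ιz (tensor X Y).X Z.X (nxt i (a + b)) c t =
      ((X.X a ◁ Y.d i b (nxt i b)) ▷ Z.X c) ≫ ιz₃' X.X Y.X Z.X a (nxt i b) c t := by
    by_cases hi : i ≤ b.1
    · rw [ιz_eq _ _ _ _ _ (add_nxt i a b hi), MonoidalCategory.comp_whiskerRight, assoc]
      congr 1
      exact ι_whiskerRight_ιz _ _ _ _ _ _ _ _ _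
    · rw [Y.d_eq_zero_of_lt i b _ hi]
      simp
  have e₃ : ιTensorObj X.X Y.X a b (a + b) rfl ▷ Z.X c ≫
      ((tensor X Y).X (a + b) ◁ Z.d i c (nxt i c)) ≫
      ιz (tensor X Y).X Z.X (a + b) (nxt i c) t =
      ((X.X a ⊗ Y.X b) ◁ Z.d i c (nxt i c)) ≫ ιz₃' X.X Y.X Z.X a b (nxt i c) t := by
    refine (whisker_exchange_assoc _ _ _).symm.trans ?_
    congr 1
    exact ι_whiskerRight_ιz _ _ _ _ _ _ _ _ _
  rw [← e₁, ← e₂, ← e₃, ← units_smul_comp, ← units_smul_whiskerRight, ← Preadditive.add_comp,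
    ← MonoidalPreadditive.add_whiskerRight, ← ι_tensorD X Y i a b (a + b) _ rfl,
    MonoidalCategory.comp_whiskerRight, assoc, ← comp_units_smul, ← map_add,
    ← Preadditive.comp_add, ιTensorObj₃'_eq X.X Y.X Z.X a b c s h _ rfl, assoc]
  congr 1
  exact ι_tensorD (tensor X Y) Z i (a + b) c s t h

lemma ι₃_tensorD (i : ℕ) (a b c s t : ℕ × ℤ) (h : a + b + c = s) :
    ιTensorObj₃ X.X Y.X Z.X a b c s h ≫ tensorD X (tensor Y Z) i s t =
      (X.d i a (nxt i a) ▷ (Y.X b ⊗ Z.X c)) ≫ ιz₃ X.X Y.X Z.X (nxt i a) b c t +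
      (totDeg a).negOnePow • ((X.X a ◁ (Y.d i b (nxt i b) ▷ Z.X c)) ≫
        ιz₃ X.X Y.X Z.X a (nxt i b) c t) +
      (totDeg a + totDeg b).negOnePow • ((X.X a ◁ (Y.X b ◁ Z.d i c (nxt i c))) ≫
        ιz₃ X.X Y.X Z.X a b (nxt i c) t) := by
  have e₁ : (X.X a ◁ ιTensorObj Y.X Z.X b c (b + c) rfl) ≫
      (X.d i a (nxt i a) ▷ (tensor Y Z).X (b + c)) ≫
      ιz X.X (tensor Y Z).X (nxt i a) (b + c) t =
      (X.d i a (nxt i a) ▷ (Y.X b ⊗ Z.X c)) ≫ ιz₃ X.X Y.X Z.X (nxt i a) b c t := by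
    refine (whisker_exchange_assoc _ _ _).trans ?_
    congr 1
    exact whiskerLeft_ι_ιz _ _ _ _ _ _ _ _ _
  have e₂ : (X.X a ◁ ((Y.d i b (nxt i b) ▷ Z.X c) ≫
      ιz Y.X Z.X (nxt i b) c (nxt i (b + c)))) ≫ ιz X.X (tensor Y Z).X a (nxt i (b + c)) t =
      (X.X a ◁ (Y.d i b (nxt i b) ▷ Z.X c)) ≫ ιz₃ X.X Y.X Z.X a (nxt i b) c t := by
    by_cases hi : i ≤ b.1
    · rw [ιz_eq _ _ _ _ _ (nxt_add i b c hi), MonoidalCategory.whiskerLeft_comp, assoc]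
      congr 1
      exact whiskerLeft_ι_ιz _ _ _ _ _ _ _ _ _
    · rw [Y.d_eq_zero_of_lt i b _ hi]
      simp
  have e₃ : (X.X a ◁ ((Y.X b ◁ Z.d i c (nxt i c)) ≫
      ιz Y.X Z.X b (nxt i c) (nxt i (b + c)))) ≫ ιz X.X (tensor Y Z).X a (nxt i (b + c)) t =
      (X.X a ◁ (Y.X b ◁ Z.d i c (nxt i c))) ≫ ιz₃ X.X Y.X Z.X a b (nxt i c) t := by
    by_cases hi : i ≤ c.1
    · rw [ιz_eq _ _ _ _ _ (add_nxt i b c hi), MonoidalCategory.whiskerLeft_comp, assoc]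
      congr 1
      exact whiskerLeft_ι_ιz _ _ _ _ _ _ _ _ _
    · rw [Z.d_eq_zero_of_lt i c _ hi]
      simp
  rw [← e₁, ← e₂, ← e₃, Int.negOnePow_add, mul_smul, add_assoc, ← smul_add,
    ← units_smul_comp (Int.negOnePow (totDeg b)), ← whiskerLeft_units_smul,
    ← Preadditive.add_comp, ← MonoidalPreadditive.whiskerLeft_add,
    ← ι_tensorD Y Z i b c (b + c) _ rfl, MonoidalCategory.whiskerLeft_comp, assoc,
    ← comp_units_smul, ← Preadditive.comp_add, ιTensorObj₃_eq X.X Y.X Z.X a b c s h _ rfl, assoc]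
  congr 1
  exact ι_tensorD X (tensor Y Z) i a (b + c) s t (by rw [← add_assoc, h])

/-- The associativity constraint is the one of bigraded modules. -/
noncomputable def assocIso : tensor (tensor X Y) Z ≅ tensor X (tensor Y Z) :=
  isoMk (GradedObject.Monoidal.associator X.X Y.X Z.X) (fun i s t => by
    apply tensorObj₃'_ext
    intro a b c h
    refine (ιTensorObj₃'_associator_hom_assoc X.X Y.X Z.X a b c s h _).trans ?_
    refine (congrArg _ (ι₃_tensorD X Y Z i a b c s t h)).trans ?_
    refine Eq.trans ?_ (Eq.trans (congrArg (· ≫ _) (ι₃'_tensorD X Y Z i a b c s t h).symm)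
      (assoc _ _ _))
    simp only [Preadditive.add_comp, Preadditive.comp_add, units_smul_comp, comp_units_smul,
      assoc, ιz₃'_associator]
    congr 1
    · congr 1
      · simp
      · simp
    · simp)

/-- The left unit constraint is the one of bigraded modules. -/
noncomputable def leftUnitorIso : tensor (unit k) X ≅ X :=
  (isoMk (GradedObject.Monoidal.leftUnitor X.X).symm (fun i s t => by
    change (GradedObject.Monoidal.leftUnitor X.X).inv s ≫ tensorD (unit k) X i s t =
      X.d i s t ≫ (GradedObject.Monoidal.leftUnitor X.X).inv t
    by_cases h : t = nxt i s
    · subst h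
      rw [GradedObject.Monoidal.leftUnitor_inv_apply, GradedObject.Monoidal.leftUnitor_inv_apply,
        assoc, assoc]
      refine (congrArg (fun f => _ ≫ _ ≫ f)
        (ι_tensorD (unit k) X i 0 s s _ (zero_add s))).trans ?_
      rw [map_zero, Int.negOnePow_zero, one_smul, ιz_eq _ _ _ _ _ (zero_add _)]
      simp only [MonoidalPreadditive.zero_whiskerRight, zero_comp, zero_add,
        ← whisker_exchange_assoc, id_whiskerLeft, assoc, Iso.inv_hom_id_assoc]
    · rw [tensorD_shape (unit k) X i s t (fun h' => h (Prod.ext (by simp; lia) (by simp; lia))),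
        X.shape' i s t h, comp_zero, zero_comp])).symm

/-- The right unit constraint is the one of bigraded modules. -/
noncomputable def rightUnitorIso : tensor X (unit k) ≅ X :=
  (isoMk (GradedObject.Monoidal.rightUnitor X.X).symm (fun i s t => by
    change (GradedObject.Monoidal.rightUnitor X.X).inv s ≫ tensorD X (unit k) i s t =
      X.d i s t ≫ (GradedObject.Monoidal.rightUnitor X.X).inv t
    by_cases h : t = nxt i s
    · subst h
      rw [GradedObject.Monoidal.rightUnitor_inv_apply,
        GradedObject.Monoidal.rightUnitor_inv_apply, assoc, assoc]
      refine (congrArg (fun f => _ ≫ _ ≫ f)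
        (ι_tensorD X (unit k) i s 0 s _ (add_zero s))).trans ?_
      rw [ιz_eq _ _ _ _ _ (add_zero _)]
      simp only [MonoidalPreadditive.whiskerLeft_zero, zero_comp, add_zero, smul_zero,
        whisker_exchange_assoc, whiskerRight_id, assoc, Iso.inv_hom_id_assoc]
    · rw [tensorD_shape X (unit k) i s t (fun h' => h (Prod.ext (by simp; lia) (by simp; lia))),
        X.shape' i s t h, comp_zero, zero_comp])).symm

end

/-- The tensor product and unit of twisted complexes, with the associativity and unit constraints
of bigraded modules. -/
noncomputable instance : MonoidalCategoryStruct (TwistedComplex.{u} k) where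
  tensorObj X Y := tensor X Y
  whiskerLeft X _ _ g := tensorMap (𝟙 X) g
  whiskerRight f Y := tensorMap f (𝟙 Y)
  tensorHom f g := tensorMap f g
  tensorUnit := unit k
  associator X Y Z := assocIso X Y Z
  leftUnitor X := leftUnitorIso X
  rightUnitor X := rightUnitorIso X

lemma refl_trans_tensorIso_trans {C : Type*} [Category* C] [MonoidalCategory C] {A B P : C}
    (e : A ⊗ B ≅ P) :
    e = (Iso.refl (A ⊗ B) ≪≫ (Iso.refl A ⊗ᵢ Iso.refl B)) ≪≫ e := by
  ext
  simp

lemma eq_refl_trans_associator {C : Type*} [Category* C] [MonoidalCategory C] (A B D : C) :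
    α_ A B D = (Iso.refl _ ≪≫ (Iso.refl (A ⊗ B) ⊗ᵢ Iso.refl D)) ≪≫ α_ A B D ≪≫
      (Iso.refl A ⊗ᵢ Iso.refl (B ⊗ D)) ≪≫ Iso.refl _ := by
  ext
  simp

/-- The data needed to deduce the axioms of a monoidal category from those for bigraded
modules. -/
noncomputable def inducingFunctorData : Monoidal.InducingFunctorData (forget k) where
  μIso _ _ := Iso.refl _
  εIso := Iso.refl _
  whiskerLeft_eq _ _ _ _ := ((id_comp _).trans (comp_id _)).symm
  whiskerRight_eq _ _ := ((id_comp _).trans (comp_id _)).symm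
  tensorHom_eq _ _ := ((id_comp _).trans (comp_id _)).symm
  associator_eq X Y Z := by
    exact congrArg Iso.hom (eq_refl_trans_associator X.X Y.X Z.X)
  leftUnitor_eq X := congrArg Iso.hom
    (refl_trans_tensorIso_trans (λ_ X.X))
  rightUnitor_eq X := congrArg Iso.hom
    (refl_trans_tensorIso_trans (ρ_ X.X))

noncomputable instance : MonoidalCategory (TwistedComplex.{u} k) :=
  Monoidal.induced (forget k) inducingFunctorData

noncomputable instance : (forget k).Monoidal :=
  Monoidal.fromInducedMonoidal _ inducingFunctorData

section
variable (X Y : TwistedComplex.{u} k)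

lemma braiding_comm (i : ℕ) (s t : ℕ × ℤ) :
    braidingHom totDeg X.X Y.X s ≫ tensorD Y X i s t =
      tensorD X Y i s t ≫ braidingHom totDeg X.X Y.X t := by
  have hz (a b t) : ιz X.X Y.X a b t ≫ braidingHom totDeg X.X Y.X t =
      sgn totDeg a b • ((β_ (X.X a) (Y.X b)).hom ≫ ιz Y.X X.X b a t) := by
    by_cases h : a + b = t
    · rw [ιz_eq _ _ _ _ _ h, ιz_eq _ _ _ _ _ (by rw [add_comm, h]), ι_braidingHom]
    · rw [ιz_eq_zero _ _ _ _ _ h, ιz_eq_zero _ _ _ _ _ (by rwa [add_comm]), zero_comp,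
        comp_zero, smul_zero]
  refine tensorObj_ext _ _ (fun a b h => ?_)
  rw [ι_braidingHom_assoc, ι_tensorD Y X i b a s t (by rw [add_comm, h]), ← assoc,
    ι_tensorD X Y i a b s t h, Preadditive.add_comp, assoc, units_smul_comp, assoc, hz, hz,
    Preadditive.comp_add, comp_units_smul, comp_units_smul, comp_units_smul,
    ← BraidedCategory.braiding_naturality_left_assoc,
    ← BraidedCategory.braiding_naturality_right_assoc, smul_add, smul_smul, smul_smul, add_comm]
  congr 1
  · by_cases hi : i ≤ a.1
    · congr 1
      rw [sgn, sgn, totDeg_nxt i a hi, ← Int.negOnePow_add, Int.negOnePow_eq_iff]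
      exact ⟨totDeg b, by ring⟩
    · rw [X.d_eq_zero_of_lt i a _ hi]
      simp
  · by_cases hi : i ≤ b.1
    · congr 1
      rw [sgn, sgn, totDeg_nxt i b hi, ← Int.negOnePow_add, Int.negOnePow_eq_iff]
      exact ⟨0, by ring⟩
    · rw [Y.d_eq_zero_of_lt i b _ hi]
      simp

/-- The symmetry constraint `x ⊗ y ↦ (-1) ^ (|x| |y|) y ⊗ x`, where `|x|` is the total degree. -/
noncomputable def braiding : tensor X Y ≅ tensor Y X :=
  isoMk (KoszulGraded.braiding totDeg X.X Y.X) (fun i s t => braiding_comm X Y i s t)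

end

noncomputable instance : BraidedCategory (TwistedComplex.{u} k) :=
  letI := KoszulGraded.braidedCategory (k := k) totDeg
  BraidedCategory.ofFaithful (forget k) (fun X Y => braiding X Y)
    (fun _ _ => (id_comp _).trans (comp_id _).symm)

noncomputable instance : SymmetricCategory (TwistedComplex.{u} k) where
  symmetry X Y := (braiding X Y).hom_inv_id

end TwistedComplex

/-! ### Model categories -/

section
open HomotopicalAlgebra

/-- An adjunction between model categories is a Quillen adjunction if the left adjoint preserves
cofibrations and trivial cofibrations. -/
structure IsQuillenAdjunction {C D : Type*} [Category* C] [Category* D] [ModelCategory C]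
    [ModelCategory D] {F : C ⥤ D} {G : D ⥤ C} (_adj : F ⊣ G) : Prop where
  cofibration_map {X Y : C} (f : X ⟶ Y) : Cofibration f → Cofibration (F.map f)
  trivial_cofibration_map {X Y : C} (f : X ⟶ Y) : Cofibration f → WeakEquivalence f →
    Cofibration (F.map f) ∧ WeakEquivalence (F.map f)

/-- A Quillen adjunction is a Quillen equivalence if for all cofibrant `X` and fibrant `Y`, a map
`F X ⟶ Y` is a weak equivalence if and only if the adjoint map `X ⟶ G Y` is. -/
structure IsQuillenEquivalence {C D : Type*} [Category* C] [Category* D] [ModelCategory C]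
    [ModelCategory D] {F : C ⥤ D} {G : D ⥤ C} (adj : F ⊣ G) : Prop
    extends IsQuillenAdjunction adj where
  weakEquivalence_iff (X : C) (Y : D) (g : F.obj X ⟶ Y) : IsCofibrant X → IsFibrant Y →
    (WeakEquivalence g ↔ WeakEquivalence (adj.homEquiv X Y g))

/-- A strong symmetric monoidal Quillen equivalence: a Quillen equivalence whose left adjoint is
a strong symmetric monoidal functor, and sends any cofibrant replacement of the tensor unit to a
weak equivalence. -/
structure IsStrongSymmetricMonoidalQuillenEquivalence {C D : Type*} [Category* C] [Category* D]
    [ModelCategory C] [ModelCategory D] [MonoidalCategory C] [SymmetricCategory C]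
    [MonoidalCategory D] [SymmetricCategory D] {F : C ⥤ D} {G : D ⥤ C} (adj : F ⊣ G) : Prop
    extends IsQuillenEquivalence adj where
  nonempty_braided : Nonempty F.Braided
  weakEquivalence_map_unit (Q : C) (q : Q ⟶ 𝟙_ C) : IsCofibrant Q → WeakEquivalence q →
    WeakEquivalence (F.map q)

/-- The projective model structure on chain complexes: the weak equivalences are the
quasi-isomorphisms, and the fibrations are the degreewise surjections. (The cofibrations are
then determined by the left lifting property.) -/
structure IsProjectiveModelStructure {k : Type u} [CommRing k] (M : ModelCategory (Ch k)) :
    Prop where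
  weakEquivalence_iff {K L : Ch k} (f : K ⟶ L) : WeakEquivalence f ↔ QuasiIso f
  fibration_iff {K L : Ch k} (f : K ⟶ L) :
    Fibration f ↔ ∀ n : ℤ, Function.Surjective (f.f n)

/-- The total model structure on twisted complexes: the weak equivalences are the maps that
induce an isomorphism on the homology of the total complex, and the fibrations are the pointwise
surjections that induce an isomorphism on vertical homology in all horizontal degrees `p > 0`.
(The cofibrations are then determined by the left lifting property.) -/
structure IsTotalModelStructure {k : Type u} [CommRing k]
    (N : ModelCategory (TwistedComplex.{u} k)) : Prop where
  weakEquivalence_iff {X Y : TwistedComplex.{u} k} (f : X ⟶ Y) :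
    WeakEquivalence f ↔ QuasiIso ((TwistedComplex.tot k).map f)
  fibration_iff {X Y : TwistedComplex.{u} k} (f : X ⟶ Y) :
    Fibration f ↔ (∀ a : ℕ × ℤ, Function.Surjective (f.f a)) ∧
      ∀ p : ℕ, 0 < p → QuasiIso ((TwistedComplex.column k p).map f)

end

/-! Both model structures come from the recognition theorem `exists_modelCategory`, and most
arguments are phrased through one condition on elements, `LiftsBoundaries`: whenever x is a cycle
and f x = dy, some x' satisfies dx' = x and f x' = y. This is lifting against the inclusions of
spheres into disks, and it characterizes the surjective quasi-isomorphisms (`liftsBoundaries_iff`).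

Columns and total complex are compared by a filtration argument. Since d_i lowers the horizontal
degree by i, the total differential acts on the top nonzero column of an element as d_0, and every
element of the direct sum has a top column. If the columns of f from P on are trivial fibrations, a
lifting problem in the total complex can therefore be pushed down into the columns below P
(`exists_reduction`). Consequently a total fibration is a total equivalence exactly if its column 0
is a trivial fibration (`liftsBoundaries_tot_iff`), and column 0 includes quasi-isomorphically into
the total complex if the positive columns are acyclic (`quasiIso_totIncl_app`).

The hard point is that a map with the left lifting property against total fibrations is a total
equivalence. For this Tot is paired with a functor `cofree` in the role of a right adjoint. An
element of `cofree K` in horizontal degree p is a family of values in K indexed by words p > r_1 >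
... > r_s. If the element comes from x and a chain map φ : Tot X → K, the value is φ applied to the
composite of the d_i, i > 0, that takes x through the horizontal degrees r_1, ..., r_s. No letter
for d_0 is needed, since the relations and the chain map condition express it by the others. The
positive columns of `cofree K` are naturally contractible, so `cofree` sends surjections to total
fibrations. Hence Tot j lifts against all surjections if j lifts against total fibrations, and such
a chain map is a quasi-isomorphism (`quasiIso_of_llp`).

For the Quillen equivalence, the positive columns of iK vanish and those of a fibrant Y are acyclic,
so naturality of the inclusion of column 0 into Tot identifies the two conditions. For the monoidal
part, column 0 is lax monoidal, which makes i oplax; the structure maps are invertible because two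
horizontal degrees p ≥ 0 add up to 0 only if both are 0. -/

/-! ### Recognition theorem and cells described by elements. -/

namespace ModelConstruction
open HomotopicalAlgebra MorphismProperty

attribute [local instance] Cardinal.fact_isRegular_aleph0 Cardinal.orderBotAleph0OrdToType

variable {C : Type (u + 1)} [Category.{u} C]

/-- Maps out of a finitely presentable object commute with sequential colimits, so the small object
argument may stop at stage ω. -/
lemma isCardinalForSmallObjectArgument_aleph0 [HasColimitsOfSize.{u, u} C] (I : MorphismProperty C)
    [IsSmall.{u} I] (hI : ∀ ⦃A B : C⦄ (i : A ⟶ B), I i →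
      IsFinitelyPresentable.{u} A) :
    HasSmallObjectArgument.{u} I := by
  refine ⟨Cardinal.aleph0.{u}, inferInstance, inferInstance, ?_⟩
  exact
    { hasIterationOfShape :=
        { hasColimitsOfShape_of_isSuccLimit := fun _ _ => inferInstance
          hasColimitsOfShape := inferInstance }
      preservesColimit := fun {A B X Y} i hi f hf => by
        have := hI i hi
        infer_instance }

lemma isCardinalPresentable_of_corepresentableBy {G : C ⥤ Type u} {F : C}
    (e : G.CorepresentableBy F) (hG : Functor.IsFinitelyAccessible.{u} G) :
    IsFinitelyPresentable.{u} F :=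
  have := hG
  Functor.isCardinalAccessible_of_natIso e.toIso.symm _

variable [HasColimitsOfSize.{u, u} C]

/-- The recognition theorem for cofibrantly generated model categories, for generating sets whose
maps have finitely presentable domains. -/
theorem exists_modelCategory [HasFiniteLimits C] (W I J : MorphismProperty C)
    [W.HasTwoOutOfThreeProperty]
    [IsSmall.{u} I] [IsSmall.{u} J]
    (hI : ∀ ⦃A B : C⦄ (i : A ⟶ B), I i → IsFinitelyPresentable.{u} A)
    (hJ : ∀ ⦃A B : C⦄ (i : A ⟶ B), J i → IsFinitelyPresentable.{u} A)
    (h₁ : I.rlp = J.rlp ⊓ W) (h₂ : J.rlp.llp ≤ W) :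
    ∃ _ : ModelCategory C,
      (∀ ⦃X Y : C⦄ (f : X ⟶ Y), WeakEquivalence f ↔ W f) ∧
      (∀ ⦃X Y : C⦄ (f : X ⟶ Y), Fibration f ↔ J.rlp f) := by
  have := isCardinalForSmallObjectArgument_aleph0 I hI
  have := isCardinalForSmallObjectArgument_aleph0 J hJ
  have hle : J.rlp.llp ≤ I.rlp.llp := antitone_llp (h₁.le.trans inf_le_left)
  have hJW : J.rlp.llp = I.rlp.llp ⊓ W := by
    refine le_antisymm (le_inf hle h₂) (fun A B i hi => ?_)
    -- Retract argument: the second factor lies in `W` by two out of three, so `h₁` puts it in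
    -- `I.rlp`. Then `i` lifts against it and is a retract of the first factor.
    have h := factorizationData J.rlp.llp J.rlp i
    have hp : I.rlp h.p := by
      rw [h₁]
      exact ⟨h.hp, W.of_precomp h.i h.p (h₂ _ h.hi) (by rw [h.fac]; exact hi.2)⟩
    have := hi.1 _ hp
    exact of_retract (RetractArrow.ofLeftLiftingProperty h.fac) h.hi
  let c₁ : CategoryWithFibrations C := ⟨J.rlp⟩
  let c₂ : CategoryWithCofibrations C := ⟨I.rlp.llp⟩
  let c₃ : CategoryWithWeakEquivalences C := ⟨W⟩
  have e₁ : trivialFibrations C = I.rlp := h₁.symm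
  have e₂ : trivialCofibrations C = J.rlp.llp := hJW.symm
  have : (weakEquivalences C).HasTwoOutOfThreeProperty :=
    inferInstanceAs W.HasTwoOutOfThreeProperty
  have : HasFiniteColimits C := hasFiniteColimits_of_hasColimitsOfSize C
  have : IsWeakFactorizationSystem (cofibrations C) (trivialFibrations C) := by
    rw [e₁]
    exact { rlp := rlp_llp_rlp I, llp := rfl,
            hasFactorization := inferInstanceAs (HasFactorization I.rlp.llp I.rlp) }
  have : IsWeakFactorizationSystem (trivialCofibrations C) (fibrations C) := by
    rw [e₂]
    exact { rlp := rlp_llp_rlp J, llp := rfl,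
            hasFactorization := inferInstanceAs (HasFactorization J.rlp.llp J.rlp) }
  exact ⟨ModelCategory.mk' C, fun X Y f => weakEquivalence_iff f, fun X Y f => fibration_iff f⟩

/-- A map into a finitely corepresentable object along which lifting is a condition on
elements: given maps `∂ : G₀ ⟶ G₁` and `∂', z : G₁ ⟶ G₂` which become equal after precomposition
with `∂`, it is about elements of `G₁` on which `∂'` and `z` agree. -/
lemma exists_cell {G₀ G₁ G₂ : C ⥤ Type u} {F₀ F₁ F₂ : C} (e₀ : G₀.CorepresentableBy F₀)
    (e₁ : G₁.CorepresentableBy F₁) (e₂ : G₂.CorepresentableBy F₂)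
    (h₁ : Functor.IsFinitelyAccessible.{u} G₁)
    (h₂ : Functor.IsFinitelyAccessible.{u} G₂)
    (D : G₀ ⟶ G₁) (D' z : G₁ ⟶ G₂) (hD : D ≫ D' = D ≫ z) :
    ∃ (S : C) (i : S ⟶ F₀), IsFinitelyPresentable.{u} S ∧
      ∀ ⦃X Y : C⦄ (f : X ⟶ Y), HasLiftingProperty i f ↔
        ∀ (x : G₁.obj X) (y : G₀.obj Y), D'.app X x = z.app X x →
          G₁.map f x = D.app Y y → ∃ x' : G₀.obj X, D.app X x' = x ∧ G₀.map f x' = y := by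
  have : IsFinitelyPresentable.{u} F₁ :=
    isCardinalPresentable_of_corepresentableBy e₁ h₁
  have : IsFinitelyPresentable.{u} F₂ :=
    isCardinalPresentable_of_corepresentableBy e₂ h₂
  -- By Yoneda, `a` and `b` are the values of `D'` and `z` on the universal element. Their
  -- coequalizer corepresents the elements of `G₁` on which `D'` and `z` agree; with `z = 0` and
  -- differentials this is a sphere.
  let a : F₂ ⟶ F₁ := e₂.homEquiv.symm (D'.app F₁ (e₁.homEquiv (𝟙 F₁)))
  let b : F₂ ⟶ F₁ := e₂.homEquiv.symm (z.app F₁ (e₁.homEquiv (𝟙 F₁)))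
  let c : F₁ ⟶ F₀ := e₁.homEquiv.symm (D.app F₀ (e₀.homEquiv (𝟙 F₀)))
  have ha {X : C} (g : F₁ ⟶ X) : e₂.homEquiv (a ≫ g) = D'.app X (e₁.homEquiv g) := by
    rw [e₂.homEquiv_comp, Equiv.apply_symm_apply, e₁.homEquiv_eq g]
    exact (NatTrans.naturality_apply D' g _).symm
  have hb {X : C} (g : F₁ ⟶ X) : e₂.homEquiv (b ≫ g) = z.app X (e₁.homEquiv g) := by
    rw [e₂.homEquiv_comp, Equiv.apply_symm_apply, e₁.homEquiv_eq g]
    exact (NatTrans.naturality_apply z g _).symm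
  have hc {X : C} (g : F₀ ⟶ X) : e₁.homEquiv (c ≫ g) = D.app X (e₀.homEquiv g) := by
    rw [e₁.homEquiv_comp, Equiv.apply_symm_apply, e₀.homEquiv_eq g]
    exact (NatTrans.naturality_apply D g _).symm
  have hab : a ≫ c = b ≫ c := by
    apply e₂.homEquiv.injective
    rw [ha, hb, Equiv.apply_symm_apply]
    exact ConcreteCategory.congr_hom (congr_app hD F₀) _
  have hi {X : C} (g : coequalizer a b ⟶ X) : D'.app X (e₁.homEquiv (coequalizer.π a b ≫ g)) =
      z.app X (e₁.homEquiv (coequalizer.π a b ≫ g)) := by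
    rw [← ha, ← hb, coequalizer.condition_assoc]
  refine ⟨coequalizer a b, coequalizer.desc c hab, ?_, fun X Y f => ?_⟩
  · have (j : WalkingParallelPair) : IsFinitelyPresentable.{u} ((parallelPair a b).obj j) := by
      cases j <;> dsimp <;> assumption
    refine isCardinalPresentable_of_isColimit _ (coequalizerIsCoequalizer a b)
      Cardinal.aleph0.{u} ?_
    rw [hasCardinalLT_aleph0_iff]
    infer_instance
  · refine ⟨fun h x y hx hxy => ?_, fun h => ⟨fun {g g'} sq => ?_⟩⟩
    · let g : coequalizer a b ⟶ X := coequalizer.desc (e₁.homEquiv.symm x) (by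
        apply e₂.homEquiv.injective
        rw [ha, hb, Equiv.apply_symm_apply, hx])
      have sq : CommSq g (coequalizer.desc c hab) f (e₀.homEquiv.symm y) := ⟨by
        apply coequalizer.hom_ext
        apply e₁.homEquiv.injective
        rw [coequalizer.π_desc_assoc, coequalizer.π_desc_assoc, hc, Equiv.apply_symm_apply, ← hxy,
          e₁.homEquiv_comp, Equiv.apply_symm_apply]⟩
      refine ⟨e₀.homEquiv sq.lift, ?_, ?_⟩
      · rw [← hc, ← coequalizer.π_desc_assoc c hab, sq.fac_left, coequalizer.π_desc,
          Equiv.apply_symm_apply]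
      · rw [← e₀.homEquiv_comp, sq.fac_right, Equiv.apply_symm_apply]
    · obtain ⟨x', h₁, h₂⟩ := h (e₁.homEquiv (coequalizer.π a b ≫ g)) (e₀.homEquiv g') (hi g) (by
        rw [← e₁.homEquiv_comp, Category.assoc, sq.w, coequalizer.π_desc_assoc, hc])
      refine ⟨⟨⟨e₀.homEquiv.symm x', ?_, ?_⟩⟩⟩
      · apply coequalizer.hom_ext
        apply e₁.homEquiv.injective
        rw [coequalizer.π_desc_assoc, hc, Equiv.apply_symm_apply, h₁]
      · apply e₀.homEquiv.injective
        rw [e₀.homEquiv_comp, Equiv.apply_symm_apply, h₂]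

/-- Lifting against a map from an initial object is a surjectivity condition. -/
lemma exists_initial_cell {G : C ⥤ Type u} {F : C} (e : G.CorepresentableBy F) :
    ∃ (S : C) (i : S ⟶ F), IsFinitelyPresentable.{u} S ∧
      ∀ ⦃X Y : C⦄ (f : X ⟶ Y), HasLiftingProperty i f ↔ Function.Surjective (G.map f) := by
  refine ⟨⊥_ C, initial.to F, ?_, fun X Y f => ?_⟩
  · have (j : Discrete PEmpty.{1}) : IsFinitelyPresentable.{u} ((Functor.empty.{0} C).obj j) :=
      j.as.elim
    refine isCardinalPresentable_of_isColimit _ (initialIsInitial (C := C))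
      Cardinal.aleph0.{u} ?_
    rw [hasCardinalLT_aleph0_iff]
    exact Finite.of_injective (fun a => a.left.as) (fun a => a.left.as.elim)
  · refine ⟨fun h y => ?_, fun h => ⟨fun {g g'} sq => ?_⟩⟩
    · have sq : CommSq (initial.to X) (initial.to F) f (e.homEquiv.symm y) := ⟨by simp⟩
      exact ⟨e.homEquiv sq.lift, by
        rw [← e.homEquiv_comp, sq.fac_right, Equiv.apply_symm_apply]⟩
    · obtain ⟨x, hx⟩ := h (e.homEquiv g')
      refine ⟨⟨⟨e.homEquiv.symm x, initialIsInitial.hom_ext _ _, ?_⟩⟩⟩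
      apply e.homEquiv.injective
      rw [e.homEquiv_comp, Equiv.apply_symm_apply, hx]

end ModelConstruction

/-! ### Pointwise limits and colimits of twisted complexes. -/

namespace TwistedComplex
open Category

variable {k : Type u} [CommRing k]

variable (k) in
/-- The functor `X ↦ X_{p,q}`, where `a = (p, q)`. -/
def eval (a : ℕ × ℤ) : TwistedComplex.{u} k ⥤ ModuleCat.{u} k where
  obj X := X.X a
  map f := f.f a

variable (k) in
/-- The maps `d_i` as natural transformations. -/
def evalD (i : ℕ) (a b : ℕ × ℤ) : eval k a ⟶ eval k b where
  app X := X.d i a b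
  naturality _ _ f := f.comm i a b

section Limits
variable {J : Type*} [Category* J] (G : J ⥤ TwistedComplex.{u} k)

/-- The pointwise colimit of a diagram of twisted complexes. -/
noncomputable def colimitObj [HasColimitsOfShape J (ModuleCat.{u} k)] : TwistedComplex.{u} k where
  X a := colimit (G ⋙ eval k a)
  d i a b := colimMap (Functor.whiskerLeft G (evalD k i a b))
  shape i a b h := by
    refine colimit.hom_ext fun j => ?_
    rw [ι_colimMap, comp_zero]
    exact (congrArg (· ≫ _) ((G.obj j).shape i a b h)).trans zero_comp
  d_comp_d n a c := by
    refine colimit.hom_ext fun j => ?_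
    rw [Preadditive.comp_sum, comp_zero]
    refine Eq.trans (Finset.sum_congr rfl (fun ij _ => ?_)) (Eq.trans (Preadditive.sum_comp _ _
      (colimit.ι (G ⋙ eval k c) j)).symm
      ((congrArg (· ≫ _) ((G.obj j).d_comp_d n a c)).trans zero_comp))
    rw [ι_colimMap_assoc, ι_colimMap]
    exact (assoc _ _ _).symm

/-- The pointwise colimit cocone of a diagram of twisted complexes. -/
noncomputable def colimitCocone [HasColimitsOfShape J (ModuleCat.{u} k)] : Cocone G where
  pt := colimitObj G
  ι :=
    { app j :=
        { f a := colimit.ι (G ⋙ eval k a) j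
          comm i a b := ι_colimMap _ _ }
      naturality _ _ φ := by
        ext a : 1
        exact (colimit.w (G ⋙ eval k a) φ).trans (comp_id _).symm }

noncomputable def isColimitColimitCocone [HasColimitsOfShape J (ModuleCat.{u} k)] :
    IsColimit (colimitCocone G) where
  desc s :=
    { f a := colimit.desc (G ⋙ eval k a) ((eval k a).mapCocone s)
      comm i a b := by
        apply colimit.hom_ext
        intro j
        refine (colimit.ι_desc_assoc _ _ _).trans ?_
        refine Eq.trans ?_ (ι_colimMap_assoc _ _ _).symm
        refine Eq.trans ?_ (congrArg _ (colimit.ι_desc _ _)).symm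
        exact (s.ι.app j).comm i a b }
  fac s j := by
    ext a : 1
    exact colimit.ι_desc ((eval k a).mapCocone s) j
  uniq s m h := by
    ext a : 1
    apply colimit.hom_ext
    intro j
    refine Eq.trans ?_ (colimit.ι_desc ((eval k a).mapCocone s) j).symm
    exact congrArg (fun f => f.f a) (h j)

/-- The pointwise limit of a diagram of twisted complexes. -/
noncomputable def limitObj [HasLimitsOfShape J (ModuleCat.{u} k)] : TwistedComplex.{u} k where
  X a := limit (G ⋙ eval k a)
  d i a b := limMap (Functor.whiskerLeft G (evalD k i a b))
  shape i a b h := by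
    refine limit.hom_ext fun j => ?_
    rw [limMap_π, zero_comp]
    exact (congrArg (_ ≫ ·) ((G.obj j).shape i a b h)).trans comp_zero
  d_comp_d n a c := by
    refine limit.hom_ext fun j => ?_
    rw [Preadditive.sum_comp, zero_comp]
    refine Eq.trans (Finset.sum_congr rfl (fun ij _ => ?_)) (Eq.trans (Preadditive.comp_sum _ 
      (limit.π (G ⋙ eval k a) j) _).symm
      ((congrArg (_ ≫ ·) ((G.obj j).d_comp_d n a c)).trans comp_zero))
    rw [assoc, limMap_π, limMap_π_assoc]
    rfl

/-- The pointwise limit cone of a diagram of twisted complexes. -/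
noncomputable def limitCone [HasLimitsOfShape J (ModuleCat.{u} k)] : Cone G where
  pt := limitObj G
  π :=
    { app j :=
        { f a := limit.π (G ⋙ eval k a) j
          comm i a b := (limMap_π (Functor.whiskerLeft G (evalD k i a b)) j).symm }
      naturality _ _ φ := by
        ext a : 1
        exact (id_comp _).trans (limit.w (G ⋙ eval k a) φ).symm }

noncomputable def isLimitLimitCone [HasLimitsOfShape J (ModuleCat.{u} k)] :
    IsLimit (limitCone G) where
  lift s :=
    { f a := limit.lift (G ⋙ eval k a) ((eval k a).mapCone s)
      comm i a b := by
        apply limit.hom_ext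
        intro j
        refine (assoc _ _ _).trans ?_
        refine (congrArg _ (limMap_π _ _)).trans ?_
        refine (limit.lift_π_assoc _ _ _).trans ?_
        refine Eq.trans ?_ (assoc _ _ _).symm
        refine Eq.trans ?_ (congrArg _ (limit.lift_π _ _)).symm
        exact (s.π.app j).comm i a b }
  fac s j := by
    ext a : 1
    exact limit.lift_π ((eval k a).mapCone s) _
  uniq s m h := by
    ext a : 1
    apply limit.hom_ext
    intro j
    refine Eq.trans ?_ (limit.lift_π ((eval k a).mapCone s) j).symm
    exact congrArg (fun f => f.f a) (h j)

instance [HasColimitsOfShape J (ModuleCat.{u} k)] :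
    HasColimitsOfShape J (TwistedComplex.{u} k) where
  has_colimit G := ⟨⟨⟨_, isColimitColimitCocone G⟩⟩⟩

instance [HasLimitsOfShape J (ModuleCat.{u} k)] :
    HasLimitsOfShape J (TwistedComplex.{u} k) where
  has_limit G := ⟨⟨⟨_, isLimitLimitCone G⟩⟩⟩

instance [HasColimitsOfShape J (ModuleCat.{u} k)] (a : ℕ × ℤ) :
    PreservesColimitsOfShape J (eval k a) where
  preservesColimit {G} := preservesColimit_of_preserves_colimit_cocone (isColimitColimitCocone G)
    ((colimit.isColimit (G ⋙ eval k a)).ofIsoColimit (Cocone.ext (Iso.refl _)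
      (fun _ => comp_id _)))

end Limits

instance : HasColimitsOfSize.{u, u} (TwistedComplex.{u} k) where
instance : HasFiniteLimits (TwistedComplex.{u} k) where
  out _ _ _ := inferInstance

instance (a : ℕ × ℤ) : Functor.IsFinitelyAccessible.{u} (eval k a ⋙ CategoryTheory.forget _) := by
  rw [Functor.isFinitelyAccessible_iff_preservesFilteredColimits]
  have : PreservesColimitsOfSize.{u, u} (eval k a) := ⟨inferInstance⟩
  exact ⟨fun J _ _ => inferInstance⟩

end TwistedComplex

/-! ### Free twisted complexes on one generator. -/

namespace TwistedComplex
open Category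

variable {k : Type u} [CommRing k]

lemma comm_apply {X Y : TwistedComplex.{u} k} (f : X ⟶ Y) (i : ℕ) (a b : ℕ × ℤ) (x : X.X a) :
    (Y.d i a b).hom ((f.f a).hom x) = (f.f b).hom ((X.d i a b).hom x) :=
  LinearMap.congr_fun (congrArg ModuleCat.Hom.hom (f.comm i a b)) x

/-- The bidegree on which `d_i` takes values in bidegree `b`. -/
abbrev prv (i : ℕ) (b : ℕ × ℤ) : ℕ × ℤ := (b.1 + i, b.2 + 1 - i)

/-- Words are evaluated backwards from the target bidegree: in contrast to `nxt`, the source `prv i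
b` involves no truncated subtraction, so it is correct for every i. -/
lemma shape_prv (X : TwistedComplex.{u} k) (i : ℕ) (a b : ℕ × ℤ) (h : a ≠ prv i b) :
    X.d i a b = 0 :=
  X.shape i a b (fun h' => h (Prod.ext (by simp; lia) (by simp; lia)))

/-- The component in bidegree `b` of `d_{i₁} ⋯ d_{iᵣ} x`, where `x` has bidegree `a`. -/
def evalWord (X : TwistedComplex.{u} k) {a : ℕ × ℤ} (x : X.X a) :
    List ℕ → ∀ b : ℕ × ℤ, X.X b
  | [], b => if h : a = b then (eqToHom (congrArg X.X h)).hom x else 0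
  | i :: w, b => (X.d i (prv i b) b).hom (X.evalWord x w (prv i b))

lemma evalWord_map {X Y : TwistedComplex.{u} k} (f : X ⟶ Y) {a : ℕ × ℤ} (x : X.X a)
    (w : List ℕ) (b : ℕ × ℤ) : (f.f b).hom (X.evalWord x w b) =
      Y.evalWord ((f.f a).hom x) w b := by
  induction w generalizing b with
  | nil =>
    by_cases h : a = b
    · subst h
      simp [evalWord]
    · simp [evalWord, h]
  | cons i w ih =>
    rw [evalWord, evalWord, ← ih]
    exact (comm_apply f i (prv i b) b _).symm

/-- Evaluation of linear combinations of words at an element. -/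
noncomputable def evalWords (X : TwistedComplex.{u} k) {a : ℕ × ℤ} (x : X.X a) (b : ℕ × ℤ) :
    (List ℕ →₀ k) →ₗ[k] X.X b :=
  Finsupp.linearCombination k (fun w => X.evalWord x w b)

variable (k) in
/-- The linear combinations of words whose evaluation in bidegree `b` at every element of
bidegree `a` of every twisted complex vanishes. -/
noncomputable def relations (a b : ℕ × ℤ) : Submodule k (List ℕ →₀ k) :=
  ⨅ (X : TwistedComplex.{u} k) (x : X.X a), LinearMap.ker (X.evalWords x b)

lemma mem_relations {a b : ℕ × ℤ} (v : List ℕ →₀ k) :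
    v ∈ relations k a b ↔
      ∀ (X : TwistedComplex.{u} k) (x : X.X a), X.evalWords x b v = 0 := by
  simp [relations]

lemma evalWords_cons (X : TwistedComplex.{u} k) {a : ℕ × ℤ} (x : X.X a) (i : ℕ) (b : ℕ × ℤ)
    (v : List ℕ →₀ k) :
    X.evalWords x b (Finsupp.lmapDomain k k (List.cons i) v) =
      (X.d i (prv i b) b).hom (X.evalWords x (prv i b) v) := by
  induction v using Finsupp.induction_linear with
  | zero => simp
  | add v w hv hw => rw [map_add, map_add, hv, hw, map_add, map_add]
  | single w r =>
    simp [evalWords, Finsupp.mapDomain_single, evalWord]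

variable (k) in
open scoped Classical in
/-- The map `d_i` of the free twisted complex. -/
noncomputable def freeD (a : ℕ × ℤ) (i : ℕ) (b c : ℕ × ℤ) :
    ((List ℕ →₀ k) ⧸ relations k a b) →ₗ[k] ((List ℕ →₀ k) ⧸ relations k a c) :=
  if h : b = prv i c then
    Submodule.mapQ _ _ (Finsupp.lmapDomain k k (List.cons i)) (by
      intro v hv
      rw [h, mem_relations] at hv
      rw [Submodule.mem_comap, mem_relations]
      intro X x
      rw [evalWords_cons, hv, map_zero])
  else 0

/-- The value of a class of words at an element. -/
noncomputable def freeEval (X : TwistedComplex.{u} k) {a : ℕ × ℤ} (x : X.X a) (b : ℕ × ℤ) :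
    ((List ℕ →₀ k) ⧸ relations k a b) →ₗ[k] X.X b :=
  Submodule.liftQ _ (X.evalWords x b) (fun v hv => (mem_relations v).1 hv X x)

lemma freeEval_freeD (X : TwistedComplex.{u} k) {a : ℕ × ℤ} (x : X.X a) (i : ℕ) (b c : ℕ × ℤ)
    (v : (List ℕ →₀ k) ⧸ relations k a b) :
    X.freeEval x c (freeD k a i b c v) = (X.d i b c).hom (X.freeEval x b v) := by
  by_cases h : b = prv i c
  · subst h
    obtain ⟨v, rfl⟩ := Submodule.Quotient.mk_surjective _ v
    rw [freeD, dif_pos rfl]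
    exact evalWords_cons X x i c v
  · rw [freeD, dif_neg h, X.shape_prv i b c h]
    simp

/-- The relations imposed are all those that hold universally, so identities in the free object may
be tested in every X. In particular ∑ d_i d_j = 0 is inherited, and no basis of the free object has
to be found. -/
lemma eq_zero_of_freeEval {a b : ℕ × ℤ} (v : (List ℕ →₀ k) ⧸ relations k a b)
    (hv : ∀ (X : TwistedComplex.{u} k) (x : X.X a), X.freeEval x b v = 0) : v = 0 := by
  obtain ⟨v, rfl⟩ := Submodule.Quotient.mk_surjective _ v
  rw [Submodule.Quotient.mk_eq_zero, mem_relations]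
  exact hv

variable (k) in
/-- The free twisted complex on a generator of bidegree `a`. -/
noncomputable def free (a : ℕ × ℤ) : TwistedComplex.{u} k where
  X b := ModuleCat.of k ((List ℕ →₀ k) ⧸ relations k a b)
  d i b c := ModuleCat.ofHom (freeD k a i b c)
  shape i b c h := by
    rw [freeD, dif_neg (by rintro rfl; exact h (by simp))]
    rfl
  d_comp_d n b c := by
    refine ModuleCat.hom_ext (LinearMap.ext fun v => eq_zero_of_freeEval _ fun X x => ?_)
    have := congrArg (fun g => g.hom (X.freeEval x b v)) (X.d_comp_d n b c)
    simp only [ModuleCat.hom_sum, LinearMap.sum_apply, ModuleCat.hom_comp,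
      LinearMap.comp_apply, ModuleCat.hom_ofHom, map_sum, freeEval_freeD] at this ⊢
    exact this

/-- The map from the free twisted complex given by an element. -/
noncomputable def freeDesc (X : TwistedComplex.{u} k) {a : ℕ × ℤ} (x : X.X a) : free k a ⟶ X where
  f b := ModuleCat.ofHom (X.freeEval x b)
  comm i b c := ModuleCat.hom_ext (LinearMap.ext fun v => (X.freeEval_freeD x i b c v).symm)

variable (k) in
/-- The generator of the free twisted complex. -/
noncomputable def freeGen (a : ℕ × ℤ) : (free k a).X a :=
  Submodule.Quotient.mk (p := relations k a a) (Finsupp.single [] 1)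

lemma freeEval_mk_single (X : TwistedComplex.{u} k) {a : ℕ × ℤ} (x : X.X a) (b : ℕ × ℤ)
    (w : List ℕ) : X.freeEval x b
      (Submodule.Quotient.mk (p := relations k a b) (Finsupp.single w 1)) = X.evalWord x w b := by
  refine (Submodule.liftQ_apply _ _ _).trans ?_
  simp [evalWords]

lemma freeDesc_freeGen (X : TwistedComplex.{u} k) {a : ℕ × ℤ} (x : X.X a) :
    ((X.freeDesc x).f a).hom (freeGen k a) = x := by
  refine (X.freeEval_mk_single x a []).trans ?_
  simp [evalWord]

/-- Both sides have the same value under every `freeEval`. It follows that the generator generates,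
which is the uniqueness half of the universal property. -/
lemma mk_single_eq_evalWord (a b : ℕ × ℤ) (w : List ℕ) :
    Submodule.Quotient.mk (p := relations k a b) (Finsupp.single w 1) =
      (free k a).evalWord (freeGen k a) w b := by
  refine sub_eq_zero.1 (eq_zero_of_freeEval _ fun X x => ?_)
  refine (map_sub _ _ _).trans (sub_eq_zero.2 ?_)
  rw [freeEval_mk_single]
  refine Eq.trans ?_ (evalWord_map (X.freeDesc x) (freeGen k a) w b).symm
  rw [freeDesc_freeGen]

lemma free_hom_ext {X : TwistedComplex.{u} k} {a : ℕ × ℤ} (f g : free k a ⟶ X)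
    (h : (f.f a).hom (freeGen k a) = (g.f a).hom (freeGen k a)) : f = g := by
  ext b : 1
  refine ModuleCat.hom_ext (Submodule.linearMap_qext _ (Finsupp.lhom_ext' fun w =>
    LinearMap.ext_ring ?_))
  change (f.f b).hom (Submodule.Quotient.mk (Finsupp.single w 1)) =
    (g.f b).hom (Submodule.Quotient.mk (Finsupp.single w 1))
  rw [mk_single_eq_evalWord, evalWord_map, evalWord_map, h]

variable (k) in
/-- The free twisted complex corepresents the functor `X ↦ X_{p,q}`. -/
noncomputable def freeCorepresentableBy (a : ℕ × ℤ) :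
    (eval k a ⋙ CategoryTheory.forget _).CorepresentableBy (free k a) where
  homEquiv {X} :=
    { toFun f := (f.f a).hom (freeGen k a)
      invFun x := X.freeDesc x
      left_inv _ := free_hom_ext _ _ (freeDesc_freeGen _ _)
      right_inv _ := freeDesc_freeGen _ _ }
  homEquiv_comp _ _ := rfl

end TwistedComplex

/-! ### Quasi-isomorphisms and trivial fibrations of chain complexes in terms of elements. -/

namespace ChainComplexModel
open HomologicalComplex

variable {k : Type u} [CommRing k] {K L : Ch.{u} k}

lemma comm_apply (f : K ⟶ L) (i j : ℤ) (x : K.X i) :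
    (L.d i j).hom ((f.f i).hom x) = (f.f j).hom ((K.d i j).hom x) :=
  LinearMap.congr_fun (congrArg ModuleCat.Hom.hom (f.comm i j)) x

lemma d_d_apply (K : Ch.{u} k) (i j l : ℤ) (x : K.X i) :
    (K.d j l).hom ((K.d i j).hom x) = 0 :=
  LinearMap.congr_fun (congrArg ModuleCat.Hom.hom (K.d_comp_d i j l)) x

/-- A map from a free module. -/
noncomputable def freeCover (A : ModuleCat.{u} k) : ModuleCat.of k (A →₀ k) ⟶ A :=
  ModuleCat.ofHom (Finsupp.linearCombination k id)

instance (A : ModuleCat.{u} k) : Epi (freeCover A) := by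
  rw [ModuleCat.epi_iff_surjective]
  exact fun a => ⟨Finsupp.single a 1, by simp [freeCover]⟩

/-- The abelian-category criterion allows passing to an epimorphism onto the test object. The test
object k recovers elements; conversely, elementwise choices extend linearly to the free cover of any
test object. -/
lemma mono_homologyMap_iff (f : K ⟶ L) (i j l : ℤ) (hij : j + 1 = i) (hjl : l + 1 = j) :
    Mono (homologyMap f j) ↔ ∀ (x : K.X j) (y : L.X i), (K.d j l).hom x = 0 →
      (f.f j).hom x = (L.d i j).hom y → ∃ x' : K.X i, (K.d i j).hom x' = x := by
  rw [mono_homologyMap_iff_up_to_refinements f i j l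
    (ComplexShape.prev_eq' _ (by simpa using hij)) (ComplexShape.next_eq' _ (by simpa using hjl))]
  refine ⟨fun h x y hx hxy => ?_, fun h A x hx y hxy => ?_⟩
  · obtain ⟨A', p, hp, x₁, h₁⟩ := h (A := ModuleCat.of k k)
      (ModuleCat.ofHom (LinearMap.toSpanSingleton k _ x)) (by
        refine ModuleCat.hom_ext (LinearMap.ext_ring ?_)
        simpa using hx) (ModuleCat.ofHom (LinearMap.toSpanSingleton k _ y)) (by
        refine ModuleCat.hom_ext (LinearMap.ext_ring ?_)
        simpa using hxy)
    obtain ⟨a, ha⟩ := (ModuleCat.epi_iff_surjective p).1 hp 1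
    refine ⟨x₁.hom a, ?_⟩
    have := LinearMap.congr_fun (congrArg ModuleCat.Hom.hom h₁) a
    simp only [ModuleCat.hom_comp, LinearMap.comp_apply] at this
    rw [← this, ha]
    simp
  · have h' (a : A) : ∃ x' : K.X i, (K.d i j).hom x' = x.hom a :=
      h (x.hom a) (y.hom a) (LinearMap.congr_fun (congrArg ModuleCat.Hom.hom hx) a)
        (LinearMap.congr_fun (congrArg ModuleCat.Hom.hom hxy) a)
    choose g hg using h'
    refine ⟨_, freeCover A, inferInstance, ModuleCat.ofHom (Finsupp.linearCombination k g), ?_⟩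
    refine ModuleCat.hom_ext (Finsupp.lhom_ext' fun a => LinearMap.ext_ring ?_)
    simp [freeCover, hg]

lemma epi_homologyMap_iff (f : K ⟶ L) (i j l : ℤ) (hij : j + 1 = i) (hjl : l + 1 = j) :
    Epi (homologyMap f j) ↔ ∀ (y : L.X j), (L.d j l).hom y = 0 →
      ∃ (x : K.X j) (y' : L.X i), (K.d j l).hom x = 0 ∧
        y = (f.f j).hom x + (L.d i j).hom y' := by
  rw [epi_homologyMap_iff_up_to_refinements f i j l
    (ComplexShape.prev_eq' _ (by simpa using hij)) (ComplexShape.next_eq' _ (by simpa using hjl))]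
  refine ⟨fun h y hy => ?_, fun h A y hy => ?_⟩
  · obtain ⟨A', p, hp, x, hx, y', h₁⟩ := h (A := ModuleCat.of k k)
      (ModuleCat.ofHom (LinearMap.toSpanSingleton k _ y)) (by
        refine ModuleCat.hom_ext (LinearMap.ext_ring ?_)
        simpa using hy)
    obtain ⟨a, ha⟩ := (ModuleCat.epi_iff_surjective p).1 hp 1
    refine ⟨x.hom a, y'.hom a, LinearMap.congr_fun (congrArg ModuleCat.Hom.hom hx) a, ?_⟩
    have := LinearMap.congr_fun (congrArg ModuleCat.Hom.hom h₁) a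
    simp only [ModuleCat.hom_comp, ModuleCat.hom_add, LinearMap.add_apply,
      LinearMap.comp_apply] at this
    rw [← this, ha]
    simp
  · have h' (a : A) := h (y.hom a) (LinearMap.congr_fun (congrArg ModuleCat.Hom.hom hy) a)
    choose g g' hg hg' using h'
    refine ⟨_, freeCover A, inferInstance, ModuleCat.ofHom (Finsupp.linearCombination k g), ?_,
      ModuleCat.ofHom (Finsupp.linearCombination k g'), ?_⟩
    · refine ModuleCat.hom_ext (Finsupp.lhom_ext' fun a => LinearMap.ext_ring ?_)
      simp [hg]
    · refine ModuleCat.hom_ext (Finsupp.lhom_ext' fun a => LinearMap.ext_ring ?_)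
      simp [freeCover, ← hg']

/-- A map of complexes is a quasi-isomorphism if and only if its cone is acyclic. -/
lemma quasiIso_iff_cone (f : K ⟶ L) :
    QuasiIso f ↔ ∀ (h i j l : ℤ), i + 1 = h → j + 1 = i → l + 1 = j → ∀ (x : K.X j) (y : L.X i),
      (K.d j l).hom x = 0 → (f.f j).hom x = (L.d i j).hom y →
        ∃ (x' : K.X i) (y' : L.X h), (K.d i j).hom x' = x ∧
          y = (f.f i).hom x' + (L.d h i).hom y' := by
  refine ⟨fun hf h i j l hhi hij hjl x y hx hxy => ?_, fun H => ⟨fun i => ?_⟩⟩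
  · have := (quasiIso_iff f).1 hf
    have m := (quasiIsoAt_iff_isIso_homologyMap f j).1 (this j)
    have e := (quasiIsoAt_iff_isIso_homologyMap f i).1 (this i)
    obtain ⟨x₁, hx₁⟩ := (mono_homologyMap_iff f i j l hij hjl).1 inferInstance x y hx hxy
    -- The error y - f x₁ is a cycle because both terms have differential f x. Surjectivity on
    -- homology writes it as the image of a cycle `x₂` plus a boundary.
    obtain ⟨x₂, y', h₂, h₃⟩ := (epi_homologyMap_iff f h i j hhi hij).1 inferInstance
      (y - (f.f i).hom x₁) (by rw [map_sub, comm_apply, hx₁, hxy, sub_self])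
    refine ⟨x₁ + x₂, y', by rw [map_add, hx₁, h₂, add_zero], ?_⟩
    rw [map_add, add_assoc, ← h₃]
    abel
  · rw [quasiIsoAt_iff_isIso_homologyMap]
    have : Mono (homologyMap f i) := by
      rw [mono_homologyMap_iff f (i + 1) i (i - 1) rfl (by lia)]
      intro x y hx hxy
      obtain ⟨x', _, h, _⟩ := H (i + 1 + 1) (i + 1) i (i - 1) rfl rfl (by lia) x y hx hxy
      exact ⟨x', h⟩
    have : Epi (homologyMap f i) := by
      rw [epi_homologyMap_iff f (i + 1) i (i - 1) rfl (by lia)]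
      intro y hy
      -- A cycle y of L is the cone cycle (0, y), which is why the indices are shifted by one here.
      obtain ⟨x', y', h, h'⟩ := H (i + 1) i (i - 1) (i - 1 - 1) rfl (by lia) (by lia) 0 y (by simp)
        (by rw [hy, map_zero])
      exact ⟨x', y', h, h'⟩
    exact isIso_of_mono_of_epi _

/-- The lifting condition that characterizes trivial fibrations of chain complexes. -/
def LiftsBoundaries (f : K ⟶ L) : Prop :=
  ∀ (i j l : ℤ), j + 1 = i → l + 1 = j → ∀ (x : K.X j) (y : L.X i), (K.d j l).hom x = 0 →
    (f.f j).hom x = (L.d i j).hom y →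
      ∃ x' : K.X i, (K.d i j).hom x' = x ∧ (f.f i).hom x' = y

/-- The condition is used twice: for the pair (0, dy) it gives a cycle x over dy, and for (x, y) it
gives a preimage of y. -/
lemma LiftsBoundaries.surjective {f : K ⟶ L} (hf : LiftsBoundaries f) (n : ℤ) :
    Function.Surjective (f.f n) := by
  intro y
  obtain ⟨x, hx, hx'⟩ := hf (n - 1) (n - 1 - 1) (n - 1 - 1 - 1) (by lia) (by lia) 0
    ((L.d n (n - 1)).hom y) (by simp) (by rw [d_d_apply, map_zero])
  obtain ⟨x', _, h⟩ := hf n (n - 1) (n - 1 - 1) (by lia) (by lia) x y hx hx'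
  exact ⟨x', h⟩

lemma LiftsBoundaries.quasiIso {f : K ⟶ L} (hf : LiftsBoundaries f) : QuasiIso f := by
  rw [quasiIso_iff_cone]
  intro h i j l hhi hij hjl x y hx hxy
  obtain ⟨x', h₁, h₂⟩ := hf i j l hij hjl x y hx hxy
  exact ⟨x', 0, h₁, by rw [h₂, map_zero, add_zero]⟩

/-- A quasi-isomorphism solves the lifting problem up to an error dy' in the target. Surjectivity
lifts y' to some z, and adding dz removes the error without changing the differential. -/
lemma liftsBoundaries_iff (f : K ⟶ L) :
    LiftsBoundaries f ↔ (∀ n, Function.Surjective (f.f n)) ∧ QuasiIso f := by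
  refine ⟨fun hf => ⟨hf.surjective, hf.quasiIso⟩, fun ⟨h₁, h₂⟩ i j l hij hjl x y hx hxy => ?_⟩
  obtain ⟨x', y', h₃, rfl⟩ := (quasiIso_iff_cone f).1 h₂ (i + 1) i j l rfl hij hjl x y hx hxy
  obtain ⟨z, rfl⟩ := h₁ _ y'
  refine ⟨x' + (K.d (i + 1) i).hom z, by rw [map_add, h₃, d_d_apply, add_zero], ?_⟩
  rw [map_add]
  exact congrArg _ (comm_apply f _ _ _).symm

/-- The functor `K ↦ K_n` from chain complexes to sets. -/
noncomputable abbrev evalSet (k : Type u) [CommRing k] (n : ℤ) : Ch.{u} k ⥤ Type u :=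
  HomologicalComplex.eval _ _ n ⋙ forget _

instance (n : ℤ) : Functor.IsFinitelyAccessible.{u} (evalSet k n) := by
  rw [Functor.isFinitelyAccessible_iff_preservesFilteredColimits]
  exact ⟨fun J _ _ => inferInstance⟩

/-- The disk complex corepresents `K ↦ K_n`. -/
noncomputable def diskCorepresentableBy (n : ℤ) :
    (evalSet k n).CorepresentableBy (double (𝟙 (ModuleCat.of k k))
      (show (ComplexShape.down ℤ).Rel n (n - 1) by simp)) where
  homEquiv {K} := ((evalCompCoyonedaCorepresentableByDoubleId _ (by lia) _).homEquiv.trans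
    ModuleCat.homEquiv).trans (LinearMap.ringLmapEquivSelf k k (K.X n)).toEquiv
  homEquiv_comp _ _ := rfl

section Acyclic
variable {A B : Ch.{u} k} (f : A ⟶ B)

/-- The identification `B_n = B_{m+1}` if `n = m + 1`, and `0` otherwise. -/
noncomputable def castX (B : Ch.{u} k) (n m : ℤ) : B.X n ⟶ B.X m :=
  if h : n = m then eqToHom (congrArg B.X h) else 0

lemma castX_self (B : Ch.{u} k) (n : ℤ) : castX B n n = 𝟙 _ := dif_pos rfl

variable (A B) in
/-- The sum of `A` and a contractible complex that surjects onto `B`. -/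
noncomputable def addCone : Ch.{u} k where
  X n := ModuleCat.of k (A.X n × B.X n × B.X (n + 1))
  d n m := ModuleCat.ofHom
    (((A.d n m).hom ∘ₗ LinearMap.fst _ _ _).prod (LinearMap.prod 0
      ((castX B n (m + 1)).hom ∘ₗ LinearMap.fst _ _ _ ∘ₗ LinearMap.snd _ _ _)))
  shape n m h := by
    have h' : n ≠ m + 1 := fun h' => h (by simp [h'])
    rw [A.shape n m h, castX, dif_neg h']
    rfl
  d_comp_d' n m l _ _ := by
    refine ModuleCat.hom_ext (LinearMap.ext fun x => ?_)
    simp [d_d_apply]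

noncomputable def addConeMap : (addCone A B) ⟶ B where
  f n := ModuleCat.ofHom (((f.f n).hom ∘ₗ LinearMap.fst _ _ _) +
    ((LinearMap.fst _ _ _ + (B.d (n + 1) n).hom ∘ₗ LinearMap.snd _ _ _) ∘ₗ LinearMap.snd _ _ _))
  comm' n m h := by
    obtain rfl : m + 1 = n := by simpa using h
    refine ModuleCat.hom_ext (LinearMap.ext fun ⟨a, b, c⟩ => ?_)
    change (B.d (m + 1) m).hom ((f.f (m + 1)).hom a + (b + (B.d (m + 1 + 1) (m + 1)).hom c)) =
      (f.f m).hom ((A.d (m + 1) m).hom a) +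
        (0 + (B.d (m + 1) m).hom ((castX B (m + 1) (m + 1)).hom b))
    rw [map_add, map_add, comm_apply, d_d_apply, castX_self]
    simp

lemma addConeMap_apply (n : ℤ) (a : A.X n) (b : B.X n) (c : B.X (n + 1)) :
    ((addConeMap f).f n).hom (a, b, c) = (f.f n).hom a + (b + (B.d (n + 1) n).hom c) := rfl

variable (A B) in
noncomputable def addConeIncl : A ⟶ (addCone A B) where
  f n := ModuleCat.ofHom (LinearMap.inl _ _ _)
  comm' n m h := by
    refine ModuleCat.hom_ext (LinearMap.ext fun a => ?_)
    change ((A.d n m).hom a, 0, (castX B n (m + 1)).hom 0) = ((A.d n m).hom a, 0, 0)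
    rw [map_zero]

lemma addConeIncl_addConeMap : addConeIncl A B ≫ addConeMap f = f := by
  ext n x
  exact (addConeMap_apply f n x 0 0).trans (by simp)

lemma addConeMap_surjective (n : ℤ) : Function.Surjective ((addConeMap f).f n) := by
  intro y
  exact ⟨(0, y, 0), (addConeMap_apply f n 0 y 0).trans (by simp)⟩

/-- A map with the left lifting property against degreewise surjections is a
quasi-isomorphism. -/
lemma quasiIso_of_llp (hf : ∀ ⦃K L : Ch.{u} k⦄ (g : K ⟶ L), (∀ n, Function.Surjective (g.f n)) →
    HasLiftingProperty f g) : QuasiIso f := by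
  have := hf (addConeMap f) (addConeMap_surjective f)
  -- The lift is a section of `addConeMap f` that restricts along f to the inclusion of A.
  have sq : CommSq (addConeIncl A B) f (addConeMap f) (𝟙 B) :=
    ⟨by rw [addConeIncl_addConeMap, Category.comp_id]⟩
  have e₁ (n : ℤ) (x : A.X n) : (sq.lift.f n).hom ((f.f n).hom x) = (x, 0, 0) :=
    LinearMap.congr_fun (congrArg (fun g => (g.f n).hom) sq.fac_left) x
  have e₂ (n : ℤ) (x : B.X n) : ((addConeMap f).f n).hom ((sq.lift.f n).hom x) = x :=
    LinearMap.congr_fun (congrArg (fun g => (g.f n).hom) sq.fac_right) x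
  rw [quasiIso_iff_cone]
  intro h i j l hhi hij hjl x y hx hxy
  have h₁ := comm_apply sq.lift i j y
  rw [← hxy, e₁] at h₁
  have h₂ := e₂ i y
  subst hij hhi
  generalize (sq.lift.f (j + 1)).hom y = z at h₁ h₂
  -- The section sends y to (a, b, c), whose differential (da, 0, b) equals the image (x, 0, 0) of
  -- dy = f x. So da = x and b = 0, and projecting back gives y = f a + dc.
  obtain ⟨a, b, c⟩ := z
  have h₃ : (A.d (j + 1) j).hom a = x := congrArg Prod.fst h₁
  have h₄ : b = 0 := by
    have h₄ : (castX B (j + 1) (j + 1)).hom b = 0 := congrArg (fun z => z.2.2) h₁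
    rwa [castX_self] at h₄
  refine ⟨a, c, h₃, ?_⟩
  rw [← h₂, h₄, addConeMap_apply, zero_add]

end Acyclic

end ChainComplexModel

/-! ### Model categories from countable families of cells. -/

namespace ModelConstruction
open HomotopicalAlgebra MorphismProperty

variable {C : Type (u + 1)} [Category.{u} C] [HasColimitsOfSize.{u, u} C]
  {k : Type u} [CommRing k]

/-- The case of `exists_cell` for functors to modules. -/
lemma exists_module_cell {E₀ E₁ E₂ : C ⥤ ModuleCat.{u} k} {F₀ F₁ F₂ : C}
    (e₀ : (E₀ ⋙ forget _).CorepresentableBy F₀)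
    (e₁ : (E₁ ⋙ forget _).CorepresentableBy F₁) (e₂ : (E₂ ⋙ forget _).CorepresentableBy F₂)
    (h₁ : Functor.IsFinitelyAccessible.{u} (E₁ ⋙ forget _))
    (h₂ : Functor.IsFinitelyAccessible.{u} (E₂ ⋙ forget _))
    (D : E₀ ⟶ E₁) (D' : E₁ ⟶ E₂) (hD : D ≫ D' = 0) :
    ∃ (S : C) (i : S ⟶ F₀), IsFinitelyPresentable.{u} S ∧
      ∀ ⦃X Y : C⦄ (f : X ⟶ Y), HasLiftingProperty i f ↔
        ∀ (x : E₁.obj X) (y : E₀.obj Y), (D'.app X).hom x = 0 →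
          (E₁.map f).hom x = (D.app Y).hom y →
            ∃ x' : E₀.obj X, (D.app X).hom x' = x ∧ (E₀.map f).hom x' = y :=
  exists_cell e₀ e₁ e₂ h₁ h₂ (Functor.whiskerRight D (forget _))
    (Functor.whiskerRight D' (forget _)) (Functor.whiskerRight 0 (forget _)) (by
      rw [← Functor.whiskerRight_comp, hD, ← Functor.whiskerRight_comp, comp_zero])

/-- The recognition theorem for model categories, when the generating sets are given as
families. -/
theorem exists_modelCategory_of_families [HasFiniteLimits C] (W : MorphismProperty C)
    [W.HasTwoOutOfThreeProperty] {A B : Type} [Countable A] [Countable B]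
    {S T : A → C} {S' T' : B → C}
    (i : ∀ a, S a ⟶ T a) (j : ∀ b, S' b ⟶ T' b)
    (hi : ∀ a, IsFinitelyPresentable.{u} (S a)) (hj : ∀ b, IsFinitelyPresentable.{u} (S' b))
    (h₁ : ∀ ⦃X Y : C⦄ (f : X ⟶ Y), (∀ a, HasLiftingProperty (i a) f) ↔
      (∀ b, HasLiftingProperty (j b) f) ∧ W f)
    (h₂ : ∀ ⦃X Y : C⦄ (f : X ⟶ Y), (∀ ⦃X' Y' : C⦄ (g : X' ⟶ Y'),
      (∀ b, HasLiftingProperty (j b) g) → HasLiftingProperty f g) → W f) :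
    ∃ _ : ModelCategory C,
      (∀ ⦃X Y : C⦄ (f : X ⟶ Y), WeakEquivalence f ↔ W f) ∧
      (∀ ⦃X Y : C⦄ (f : X ⟶ Y), Fibration f ↔ ∀ b, HasLiftingProperty (j b) f) := by
  have hrlp {A : Type} {S T : A → C} (i : ∀ a, S a ⟶ T a) ⦃X Y : C⦄ (f : X ⟶ Y) :
      (ofHoms i).rlp f ↔ ∀ a, HasLiftingProperty (i a) f := by
    refine ⟨fun h a => h _ ⟨a⟩, fun h _ _ _ ⟨a⟩ => h a⟩
  have := isSmall_ofHoms.{u} i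
  have := isSmall_ofHoms.{u} j
  obtain ⟨M, hW, hF⟩ := exists_modelCategory W (ofHoms i) (ofHoms j)
    (fun _ _ _ ⟨a⟩ => hi a) (fun _ _ _ ⟨b⟩ => hj b)
    (by
      ext X Y f
      rw [hrlp, h₁, ← hrlp]
      rfl)
    (fun X Y f hf => h₂ f (fun X' Y' g hg => hf g ((hrlp j g).2 hg)))
  exact ⟨M, hW, fun X Y f => (hF f).trans (hrlp j f)⟩

end ModelConstruction

/-! ### The projective model structure. -/

namespace ChainComplexModel
open HomologicalComplex ModelConstruction HomotopicalAlgebra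

variable {k : Type u} [CommRing k]

variable (k) in
/-- The differential as a natural transformation. -/
def dNat (i j : ℤ) : HomologicalComplex.eval (ModuleCat.{u} k) (ComplexShape.down ℤ) i ⟶
    HomologicalComplex.eval _ _ j where
  app K := K.d i j
  naturality _ _ f := f.comm i j

-- The generating maps are spheres into disks and 0 into disks, described only by what it means to
-- lift against them: `LiftsBoundaries` and degreewise surjectivity. The recognition theorem then
-- asks exactly for `liftsBoundaries_iff` and `quasiIso_of_llp`.
variable (k) in
theorem exists_projectiveModelStructure :
    ∃ M : ModelCategory (Ch.{u} k), IsProjectiveModelStructure M := by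
  choose S i hS hi using fun n : ℤ => exists_module_cell (diskCorepresentableBy (k := k) n)
    (diskCorepresentableBy (n - 1)) (diskCorepresentableBy (n - 1 - 1)) inferInstance
    inferInstance (dNat k _ _) (dNat k _ _) (by ext K : 2; exact K.d_comp_d _ _ _)
  choose S' j hS' hj using fun n : ℤ => exists_initial_cell (diskCorepresentableBy (k := k) n)
  have hi' ⦃K L : Ch.{u} k⦄ (f : K ⟶ L) :
      (∀ n, HasLiftingProperty (i n) f) ↔ LiftsBoundaries f := by
    simp only [hi]
    refine ⟨fun h n m l hnm hml => ?_, fun h n => h n (n - 1) (n - 1 - 1) (by lia) (by lia)⟩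
    obtain rfl : m = n - 1 := by lia
    obtain rfl : l = n - 1 - 1 := by lia
    exact h n
  have hj' ⦃K L : Ch.{u} k⦄ (f : K ⟶ L) :
      (∀ n, HasLiftingProperty (j n) f) ↔ ∀ n, Function.Surjective (f.f n) := by
    simp only [hj]
    rfl
  obtain ⟨M, hW, hF⟩ := exists_modelCategory_of_families
    (quasiIso (ModuleCat.{u} k) (ComplexShape.down ℤ)) i j hS hS'
    (fun K L f => by rw [hi', hj', liftsBoundaries_iff, mem_quasiIso_iff])
    (fun K L f hf => quasiIso_of_llp f (fun K' L' g hg => hf g ((hj' g).2 hg)))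
  exact ⟨M, { weakEquivalence_iff := fun f => hW f
              fibration_iff := fun f => (hF f).trans (hj' f) }⟩

end ChainComplexModel

/-! ### The filtration of the total complex by columns. -/

namespace TwistedComplex
open Category ChainComplexModel DirectSum

variable {k : Type u} [CommRing k] {X Y : TwistedComplex.{u} k}

lemma lof_apply_ne {M : ℕ → Type u} [∀ i, AddCommGroup (M i)] [∀ i, Module k (M i)]
    {p r : ℕ} (h : p ≠ r) (x : M p) : lof k ℕ M p x r = 0 := by
  rw [lof_eq_of, of_eq_of_ne _ _ _ h.symm]

/-- The map induced on total complexes. -/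
noncomputable def totMap (f : X ⟶ Y) (n : ℤ) :
    (⨁ p : ℕ, X.X (p, n - p)) →ₗ[k] (⨁ p : ℕ, Y.X (p, n - p)) :=
  DirectSum.lmap fun p => (f.f (p, n - p)).hom

lemma totMap_apply (f : X ⟶ Y) (n : ℤ) (x : ⨁ p : ℕ, X.X (p, n - p)) (p : ℕ) :
    totMap f n x p = (f.f (p, n - p)).hom (x p) :=
  DirectSum.lmap_apply _ _ _

lemma totMap_lof (f : X ⟶ Y) (n : ℤ) (p : ℕ) (x : X.X (p, n - p)) :
    totMap f n (lof k ℕ (fun p : ℕ => X.X (p, n - p)) p x) =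
      lof k ℕ (fun p : ℕ => Y.X (p, n - p)) p ((f.f _).hom x) :=
  DirectSum.lmap_lof _ _ _

lemma totD_totMap (f : X ⟶ Y) (n m : ℤ) (x : ⨁ p : ℕ, X.X (p, n - p)) :
    totD Y n m (totMap f n x) = totMap f m (totD X n m x) :=
  ChainComplexModel.comm_apply ((tot k).map f) n m x

lemma totD_totD (n m l : ℤ) (x : ⨁ p : ℕ, X.X (p, n - p)) :
    totD X m l (totD X n m x) = 0 :=
  d_d_apply ((tot k).obj X) n m l x

lemma totD_lof_apply_self (n m : ℤ) (p : ℕ) (x : X.X (p, n - p)) :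
    totD X n m (lof k ℕ (fun p : ℕ => X.X (p, n - p)) p x) p =
      (X.d 0 (p, n - p) (p, m - p)).hom x := by
  rw [totD_lof, DirectSum.sum_apply, Finset.sum_eq_single (0, p), lof_apply]
  · rintro ⟨i, r⟩ h h'
    rw [Finset.HasAntidiagonal.mem_antidiagonal] at h
    exact lof_apply_ne (by rintro rfl; exact h' (Prod.ext (by simp at h ⊢; lia) rfl)) _
  · simp

lemma totD_lof_apply_of_lt (n m : ℤ) (p r : ℕ) (h : p < r) (x : X.X (p, n - p)) :
    totD X n m (lof k ℕ (fun p : ℕ => X.X (p, n - p)) p x) r = 0 := by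
  rw [totD_lof, DirectSum.sum_apply]
  refine Finset.sum_eq_zero ?_
  rintro ⟨i, s⟩ hi
  rw [Finset.HasAntidiagonal.mem_antidiagonal] at hi
  exact lof_apply_ne (by dsimp at hi ⊢; lia) _

/-- The elements of a direct sum that are supported in degrees `< N`. -/
def VanishesFrom {M : ℕ → Type u} [∀ i, AddCommGroup (M i)] (N : ℕ) (x : ⨁ p, M p) : Prop :=
  ∀ p, N ≤ p → x p = 0

section
variable {M : ℕ → Type u} [∀ i, AddCommGroup (M i)] [∀ i, Module k (M i)] {N : ℕ}

lemma VanishesFrom.sub {x y : ⨁ p, M p} (hx : VanishesFrom N x) (hy : VanishesFrom N y) :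
    VanishesFrom N (x - y) := fun p hp => by
  rw [DirectSum.sub_apply, hx p hp, hy p hp, sub_zero]

lemma VanishesFrom.mono {N' : ℕ} (h : N ≤ N') {x : ⨁ p, M p} (hx : VanishesFrom N x) :
    VanishesFrom N' x := fun p hp => hx p (h.trans hp)

lemma VanishesFrom.of_succ {x : ⨁ p, M p} (hx : VanishesFrom (N + 1) x) (h : x N = 0) :
    VanishesFrom N x := fun p hp => by
  obtain rfl | hp := hp.eq_or_lt
  · exact h
  · exact hx p hp

lemma VanishesFrom.sub_lof {x : ⨁ p, M p} (hx : VanishesFrom (N + 1) x) :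
    VanishesFrom N (x - lof k ℕ M N (x N)) := by
  refine VanishesFrom.of_succ (fun p hp => ?_) ?_
  · rw [DirectSum.sub_apply, hx p hp, lof_apply_ne (by lia), sub_zero]
  · rw [DirectSum.sub_apply, lof_apply, sub_self]

lemma vanishesFrom_lof (x : M N) : VanishesFrom (N + 1) (lof k ℕ M N x) :=
  fun _ _ => lof_apply_ne (by lia) _

lemma VanishesFrom.eq_zero {x : ⨁ p, M p} (hx : VanishesFrom 0 x) : x = 0 :=
  DFinsupp.ext fun p => hx p (Nat.zero_le p)

lemma VanishesFrom.eq_lof {x : ⨁ p, M p} (hx : VanishesFrom 1 x) : x = lof k ℕ M 0 (x 0) :=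
  sub_eq_zero.1 (VanishesFrom.eq_zero (VanishesFrom.sub_lof hx))

lemma exists_vanishesFrom (x : ⨁ p, M p) : ∃ N, VanishesFrom N x := by
  classical
  refine ⟨(DFinsupp.support x).sup id + 1, fun p hp => ?_⟩
  by_contra h
  have := Finset.le_sup (f := id) (DFinsupp.mem_support_iff.2 h)
  simp only [id] at this
  lia

end

lemma VanishesFrom.totMap {N : ℕ} (f : X ⟶ Y) {n : ℤ} {x : ⨁ p : ℕ, X.X (p, n - p)}
    (hx : VanishesFrom N x) : VanishesFrom N (totMap f n x) := fun p hp => by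
  rw [totMap_apply, hx p hp, map_zero]

/-- No d_i raises the horizontal degree, so the first N columns form a subcomplex. -/
lemma VanishesFrom.totD {N : ℕ} {n : ℤ} (m : ℤ) {x : ⨁ p : ℕ, X.X (p, n - p)}
    (hx : VanishesFrom N x) : VanishesFrom N (totD X n m x) := by
  induction N generalizing x with
  | zero =>
    rw [hx.eq_zero, map_zero]
    exact fun _ _ => rfl
  | succ N ih =>
    rw [← sub_add_cancel x (lof k ℕ (fun p : ℕ => X.X (p, n - p)) N (x N)), map_add]
    intro p hp
    rw [DirectSum.add_apply, ih hx.sub_lof p (by lia), totD_lof_apply_of_lt _ _ _ _ hp, add_zero]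

/-- The maps d_i with i > 0 leave the top column and nothing comes in from above, so only d_0 is
seen there. -/
lemma VanishesFrom.totD_apply {N : ℕ} {n : ℤ} (m : ℤ) {x : ⨁ p : ℕ, X.X (p, n - p)}
    (hx : VanishesFrom (N + 1) x) :
    TwistedComplex.totD X n m x N = (X.d 0 (N, n - N) (N, m - N)).hom (x N) := by
  conv_lhs => rw [← sub_add_cancel x (lof k ℕ (fun p : ℕ => X.X (p, n - p)) N (x N)), map_add]
  rw [DirectSum.add_apply, (VanishesFrom.totD m hx.sub_lof) N le_rfl, totD_lof_apply_self, zero_add]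

/-- If the columns of `f` in degrees `≥ P` are trivial fibrations, then elements of the total
complexes can be reduced to the first `P` columns. -/
lemma exists_reduction (f : X ⟶ Y) (P : ℕ)
    (hf : ∀ p, P ≤ p → LiftsBoundaries ((column k p).map f)) (i j l : ℤ) (hij : j + 1 = i)
    (hjl : l + 1 = j) (x : ⨁ p : ℕ, X.X (p, j - p)) (y : ⨁ p : ℕ, Y.X (p, i - p))
    (hx : VanishesFrom P (totD X j l x))
    (hxy : VanishesFrom P (totMap f j x - totD Y i j y)) :
    ∃ x' : ⨁ p : ℕ, X.X (p, i - p), VanishesFrom P (x - totD X i j x') ∧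
      VanishesFrom P (y - totMap f i x') := by
  obtain ⟨N₁, h₁⟩ := exists_vanishesFrom x
  obtain ⟨N₂, h₂⟩ := exists_vanishesFrom y
  -- A common bound of the form P + N permits induction on the number N of columns still to be
  -- cleared.
  have hx' : VanishesFrom (P + (N₁ + N₂)) x := h₁.mono (by lia)
  have hy' : VanishesFrom (P + (N₁ + N₂)) y := h₂.mono (by lia)
  generalize N₁ + N₂ = N at hx' hy'
  clear h₁ h₂
  induction N generalizing x y with
  | zero =>
    refine ⟨0, ?_, ?_⟩
    · simpa using hx'
    · simpa using hy'
  | succ N ih =>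
    replace hx' : VanishesFrom (P + N + 1) x := hx'
    replace hy' : VanishesFrom (P + N + 1) y := hy'
    have e₁ := hx (P + N) (by lia)
    rw [VanishesFrom.totD_apply l hx'] at e₁
    have e₂ := hxy (P + N) (by lia)
    rw [DirectSum.sub_apply, totMap_apply, VanishesFrom.totD_apply j hy', sub_eq_zero] at e₂
    -- By `e₁` and `e₂` the top components form a lifting problem in column P + N alone. Subtracting
    -- its solution `a` clears that column from both `x` and `y` and keeps the hypotheses on the
    -- remaining pair.
    obtain ⟨a, ha, ha'⟩ := hf (P + N) (by lia) (i - (P + N : ℕ)) (j - (P + N : ℕ))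
      (l - (P + N : ℕ)) (by lia) (by lia) (x (P + N)) (y (P + N)) e₁ e₂
    let z := lof k ℕ (fun p : ℕ => X.X (p, i - p)) (P + N) a
    have hz : VanishesFrom (P + N + 1) z :=
      vanishesFrom_lof (M := fun p : ℕ => X.X (p, i - p)) a
    have hz' : z (P + N) = a := lof_apply _ _ _
    obtain ⟨x', h₁, h₂⟩ := ih (x - totD X i j z) (y - totMap f i z)
      (by rwa [map_sub, totD_totD, sub_zero])
      (by
        rw [map_sub, map_sub, totD_totMap]
        convert hxy using 1
        abel)
      ((hx'.sub (hz.totD j)).of_succ (by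
        rw [DirectSum.sub_apply, VanishesFrom.totD_apply j hz, hz', sub_eq_zero]
        exact ha.symm))
      ((hy'.sub (hz.totMap f)).of_succ (by
        rw [DirectSum.sub_apply, totMap_apply, hz', sub_eq_zero]
        exact ha'.symm))
    refine ⟨z + x', ?_, ?_⟩
    · rwa [map_add, ← sub_sub]
    · rwa [map_add, ← sub_sub]

lemma totMap_surjective (f : X ⟶ Y) (hf : ∀ a, Function.Surjective (f.f a)) (n : ℤ) :
    Function.Surjective (totMap f n) :=
  (DirectSum.lmap_surjective _).2 fun p => hf (p, n - p)

lemma vanishesFrom_lof_zero (n : ℤ) (a : X.X (0, n - (0 : ℕ))) :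
    VanishesFrom 1 (lof k ℕ (fun p : ℕ => X.X (p, n - p)) 0 a) :=
  vanishesFrom_lof (M := fun p : ℕ => X.X (p, n - p)) (N := 0) a

lemma totD_lof_zero (n m : ℤ) (a : X.X (0, n - (0 : ℕ))) :
    totD X n m (lof k ℕ (fun p : ℕ => X.X (p, n - p)) 0 a) =
      lof k ℕ (fun p : ℕ => X.X (p, m - p)) 0 ((X.d 0 _ _).hom a) := by
  rw [((vanishesFrom_lof_zero n a).totD m).eq_lof (k := k), totD_lof_apply_self]

/-- If the columns in positive degrees are trivial fibrations, the total complex and the zeroth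
column carry the same information. -/
theorem liftsBoundaries_tot_iff (f : X ⟶ Y) (hs : ∀ a, Function.Surjective (f.f a))
    (hf : ∀ p, 0 < p → LiftsBoundaries ((column k p).map f)) :
    LiftsBoundaries ((tot k).map f) ↔ LiftsBoundaries ((column k 0).map f) := by
  refine ⟨fun h => ?_, fun h => ?_⟩
  · intro i j l hij hjl (x : X.X (0, j)) (y : Y.X (0, i)) hx hxy
    -- Degree n of the total complex has (0, n - 0) as its summand of index 0; writing the degrees
    -- in this form avoids transports.
    obtain ⟨i, rfl⟩ : ∃ i', i = i' - (0 : ℕ) := ⟨i, by simp⟩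
    obtain ⟨j, rfl⟩ : ∃ i', j = i' - (0 : ℕ) := ⟨j, by simp⟩
    obtain ⟨l, rfl⟩ : ∃ i', l = i' - (0 : ℕ) := ⟨l, by simp⟩
    replace hij : j + 1 = i := by lia
    replace hjl : l + 1 = j := by lia
    obtain ⟨x', h₁, h₂⟩ : ∃ x' : ⨁ p : ℕ, X.X (p, i - p),
        totD X i j x' = lof k ℕ (fun p : ℕ => X.X (p, j - p)) 0 x ∧
        totMap f i x' = lof k ℕ (fun p : ℕ => Y.X (p, i - p)) 0 y :=
      h i j l hij hjl (lof k ℕ (fun p : ℕ => X.X (p, j - p)) 0 x)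
      (lof k ℕ (fun p : ℕ => Y.X (p, i - p)) 0 y)
      ((totD_lof_zero j l x).trans ((congrArg _ hx).trans (map_zero _)))
      ((totMap_lof f j 0 x).trans ((congrArg _ hxy).trans (totD_lof_zero i j y).symm))
    -- The solution `x'` may have components in positive columns, but its differential and its image
    -- lie in column 0. Reduction of the pair (x', 0) gives `z` such that x' minus the differential
    -- of `z` lies in column 0, and so does the image of `z`.
    obtain ⟨z, h₃, h₄⟩ := exists_reduction f 1 (fun p hp => hf p hp) (i + 1) i j rfl hij x' 0
      (by rw [h₁]; exact vanishesFrom_lof_zero _ _) (by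
      rw [h₂, map_zero, sub_zero]; exact vanishesFrom_lof_zero _ _)
    obtain ⟨c, hc⟩ := hs _ ((totMap f (i + 1) z) 0)
    replace h₃ := h₃.eq_lof (k := k)
    replace h₄ : totMap f (i + 1) z = lof k ℕ (fun p : ℕ => Y.X (p, i + 1 - p)) 0 
        ((f.f _).hom c) := by
      have h₅ : VanishesFrom 1 (totMap f (i + 1) z) := fun p hp => by
        have h₆ := h₄ p hp
        rwa [DirectSum.sub_apply, DirectSum.zero_apply, zero_sub, neg_eq_zero] at h₆
      exact (h₅.eq_lof (k := k)).trans (congrArg _ hc.symm)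
    set a := (x' - totD X (i + 1) i z) 0 with ha
    -- Passing from `x'` to `a` changed the image by d_0 of f c; since `c` itself lives in column 0,
    -- adding d_0 c restores the image and leaves d_0 a = x intact.
    refine ⟨a + (X.d 0 _ _).hom c, ?_, ?_⟩
    · have : totD X i j (x' - totD X (i + 1) i z) =
          lof k ℕ (fun p : ℕ => X.X (p, j - p)) 0 x := by
        rw [map_sub, totD_totD, h₁, sub_zero]
      rw [h₃, totD_lof_zero] at this
      have := congrArg (fun z => z 0) this
      simp only [lof_apply] at this
      have h₅ : (X.d 0 (0, i - (0 : ℕ)) (0, j - (0 : ℕ))).hom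
          ((X.d 0 (0, i + 1 - (0 : ℕ)) _).hom c) = 0 :=
        LinearMap.congr_fun (congrArg ModuleCat.Hom.hom (X.d_zero_comp_d_zero _ _ _)) c
      change (X.d 0 (0, i - (0 : ℕ)) (0, j - (0 : ℕ))).hom (a + _) = x
      rw [map_add, this, h₅, add_zero]
    · have : totMap f i (x' - totD X (i + 1) i z) =
          lof k ℕ (fun p : ℕ => Y.X (p, i - p)) 0 (y - (Y.d 0 _ _).hom ((f.f _).hom c)) := by
        rw [map_sub, ← totD_totMap, h₂, h₄, totD_lof_zero, map_sub]
      rw [h₃, totMap_lof] at this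
      have := congrArg (fun z => z 0) this
      simp only [lof_apply] at this
      change (f.f (0, i - (0 : ℕ))).hom (a + (X.d 0 _ _).hom c) = y
      rw [map_add, this, TwistedComplex.comm_apply, sub_add_cancel]
  · intro i j l hij hjl x y hx hxy
    obtain ⟨x', h₁, h₂⟩ := exists_reduction f 0 (fun p _ => by
      obtain rfl | hp := Nat.eq_zero_or_pos p
      · exact h
      · exact hf p hp) i j l hij hjl x y (by
        rw [show totD X j l x = 0 from hx]; exact fun _ _ => rfl) (by
        rw [show totMap f j x = totD Y i j y from hxy, sub_self]; exact fun _ _ => rfl)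
    exact ⟨x', (sub_eq_zero.1 h₁.eq_zero).symm, (sub_eq_zero.1 h₂.eq_zero).symm⟩

end TwistedComplex

/-! ### Column 0 inside the total complex. -/

namespace TwistedComplex
open Category ChainComplexModel DirectSum

variable {k : Type u} [CommRing k] {X Y : TwistedComplex.{u} k}

/-- The identification of `X_{0,n}` with the summand of degree `0` of the total complex. -/
def zeroCast (X : TwistedComplex.{u} k) (n : ℤ) : X.X (0, n) ≅ X.X (0, n - (0 : ℕ)) :=
  eqToIso (by simp)

lemma d_eqToHom (X : TwistedComplex.{u} k) (i : ℕ) {a a' b b' : ℕ × ℤ} (ha : a = a')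
    (hb : b = b') : eqToHom (congrArg X.X ha) ≫ X.d i a' b' =
      X.d i a b ≫ eqToHom (congrArg X.X hb) := by
  subst ha hb
  simp

lemma f_eqToHom (f : X ⟶ Y) {a a' : ℕ × ℤ} (ha : a = a') :
    eqToHom (congrArg X.X ha) ≫ f.f a' = f.f a ≫ eqToHom (congrArg Y.X ha) := by
  subst ha
  simp

lemma d_zeroCast (X : TwistedComplex.{u} k) (n m : ℤ) (x : X.X (0, n)) :
    (X.d 0 (0, n - (0 : ℕ)) (0, m - (0 : ℕ))).hom ((X.zeroCast n).hom.hom x) =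
      (X.zeroCast m).hom.hom ((X.d 0 (0, n) (0, m)).hom x) :=
  LinearMap.congr_fun (congrArg ModuleCat.Hom.hom
    (X.d_eqToHom 0 (a := (0, n)) (b := (0, m)) (by simp) (by simp))) x

lemma f_zeroCast (f : X ⟶ Y) (n : ℤ) (x : X.X (0, n)) :
    (f.f (0, n - (0 : ℕ))).hom ((X.zeroCast n).hom.hom x) =
      (Y.zeroCast n).hom.hom ((f.f (0, n)).hom x) :=
  LinearMap.congr_fun (congrArg ModuleCat.Hom.hom (f_eqToHom f (a := (0, n)) (by simp))) x

variable (k) in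
/-- The inclusion of the zeroth column into the total complex. -/
noncomputable def totIncl : column k 0 ⟶ tot k where
  app X :=
    { f n := (X.zeroCast n).hom ≫
        ModuleCat.ofHom (lof k ℕ (fun p : ℕ => X.X (p, n - p)) 0)
      comm' n m _ := by
        refine ModuleCat.hom_ext (LinearMap.ext fun x => ?_)
        exact (totD_lof_zero n m _).trans
          (congrArg (lof k ℕ (fun p : ℕ => X.X (p, m - p)) 0) (d_zeroCast X n m x)) }
  naturality X Y f := by
    ext n : 1
    refine ModuleCat.hom_ext (LinearMap.ext fun x => ?_)
    exact ((totMap_lof f n 0 _).trans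
      (congrArg (lof k ℕ (fun p : ℕ => Y.X (p, n - p)) 0) (f_zeroCast f n x))).symm

/-- If the columns in positive degrees are acyclic, the inclusion of the zeroth column into the
total complex is a quasi-isomorphism. -/
theorem quasiIso_totIncl_app (f : X ⟶ Y) (hY : ∀ a, Subsingleton (Y.X a))
    (hf : ∀ p, 0 < p → LiftsBoundaries ((column k p).map f)) :
    QuasiIso ((totIncl k).app X) := by
  rw [quasiIso_iff_cone]
  intro h i j l hhi hij hjl (x : X.X (0, j)) (y : ⨁ p : ℕ, X.X (p, i - p)) hx hxy
  replace hxy : lof k ℕ (fun p : ℕ => X.X (p, j - p)) 0 ((X.zeroCast j).hom.hom x) =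
    totD X i j y := hxy
  -- The differential of `y` lies in column 0 by `hxy`, and conditions in the zero object Y are
  -- void, so `y` can be moved into column 0 by subtracting a boundary.
  obtain ⟨z, hz, -⟩ := exists_reduction f 1 (fun p hp => hf p hp) h i j hhi hij y 0
    (by rw [← hxy]; exact vanishesFrom_lof_zero _ _) (fun p _ => (hY _).elim _ _)
  replace hz := hz.eq_lof (k := k)
  obtain ⟨a, ha⟩ : ∃ a, (X.zeroCast i).hom.hom a = (y - totD X h i z) 0 :=
    ⟨(X.zeroCast i).inv.hom _,
      LinearMap.congr_fun (congrArg ModuleCat.Hom.hom (X.zeroCast i).inv_hom_id) _⟩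
  rw [← ha] at hz
  refine ⟨a, z, ?_, sub_eq_iff_eq_add.1 hz⟩
  have : totD X i j (y - totD X h i z) =
      lof k ℕ (fun p : ℕ => X.X (p, j - p)) 0 ((X.zeroCast j).hom.hom x) := by
    rw [map_sub, totD_totD, sub_zero, hxy]
  rw [hz, totD_lof_zero, d_zeroCast] at this
  have := congrArg (fun z => (X.zeroCast j).inv.hom (z 0)) this
  simp only [lof_apply] at this
  exact (LinearMap.congr_fun (congrArg ModuleCat.Hom.hom (X.zeroCast j).hom_inv_id) _).symm.trans
    (this.trans (LinearMap.congr_fun (congrArg ModuleCat.Hom.hom (X.zeroCast j).hom_inv_id) _))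

end TwistedComplex

/-! ### Calculus of word-indexed families and the contraction of the positive columns. -/

namespace CofreeTwisted
open ChainComplexModel

variable {k : Type u} [CommRing k]

/-- Families of elements of a chain complex indexed by words. The cofree twisted complexes are
given by submodules of this module. -/
abbrev Words (K : Ch.{u} k) : Type u := List ℕ → ∀ m : ℤ, K.X m

variable (K : Ch.{u} k)

/-- The differential of `K` on families. -/
noncomputable def diff : (∀ m : ℤ, K.X m) →ₗ[k] (∀ m : ℤ, K.X m) :=
  LinearMap.pi fun m => (K.d (m + 1) m).hom ∘ₗ LinearMap.proj (m + 1)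

lemma diff_apply (v : ∀ m : ℤ, K.X m) (m : ℤ) : diff K v m = (K.d (m + 1) m).hom (v (m + 1)) := rfl

lemma diff_diff (v : ∀ m : ℤ, K.X m) : diff K (diff K v) = 0 := by
  funext m
  rw [diff_apply, diff_apply, d_d_apply]
  rfl

/-- The map that prepends a letter. -/
def prep (r : ℕ) : Words K →ₗ[k] Words K where
  toFun c w := c (r :: w)
  map_add' _ _ := rfl
  map_smul' _ _ := rfl

variable {K} in
lemma prep_apply (r : ℕ) (c : Words K) (w : List ℕ) : prep K r c w = c (r :: w) := rfl

/-- The components of the vertical differential in horizontal degree `p`. -/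
noncomputable def vertComp : List ℕ → ℕ → Words K →ₗ[k] (∀ m : ℤ, K.X m)
  | [], p => diff K ∘ₗ LinearMap.proj [] -
      ∑ r ∈ Finset.Ico 0 p, LinearMap.proj [r]
  | r :: w, p => -(vertComp w r ∘ₗ prep K r) -
      ∑ s ∈ Finset.Ico (r + 1) p, LinearMap.proj (s :: r :: w)

/-- The vertical differential in horizontal degree `p`. -/
noncomputable def vert (p : ℕ) : Words K →ₗ[k] Words K := LinearMap.pi fun w => vertComp K w p

variable {K}

/-- For a family that comes from x and a chain map φ on the total complex, the value at [] is φ(x)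
and the value at [r] is φ(d_{p-r} x). The chain map condition gives φ(d_0 x) = dφ(x) - ∑_{r<p}
φ(d_{p-r} x), which dictates this formula. -/
lemma vert_nil (p : ℕ) (c : Words K) :
    vert K p c [] = diff K (c []) - ∑ r ∈ Finset.Ico 0 p, c [r] := by
  simp [vert, vertComp]

/-- Letters are the horizontal degrees passed through, so `prep K r` plays the role of d_{p-r}. The
formula moves d_0 past the leading letter by d_{p-r} d_0 = -d_0 d_{p-r} - ∑_{r<s<p} d_{s-r} d_{p-s}.
-/
lemma vert_cons (p r : ℕ) (w : List ℕ) (c : Words K) :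
    vert K p c (r :: w) = -(vert K r (prep K r c) w) -
      ∑ s ∈ Finset.Ico (r + 1) p, c (s :: r :: w) := by
  simp [vert, vertComp]

lemma prep_vert (p r : ℕ) (c : Words K) :
    prep K r (vert K p c) = -(vert K r (prep K r c)) -
      ∑ s ∈ Finset.Ico (r + 1) p, prep K r (prep K s c) := by
  funext w
  rw [prep_apply, vert_cons]
  simp [prep_apply]

lemma sum_Ico_comm {M : Type*} [AddCommMonoid M] (r p : ℕ) (F : ℕ → ℕ → M) :
    ∑ s ∈ Finset.Ico r p, ∑ t ∈ Finset.Ico (s + 1) p, F t s =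
      ∑ t ∈ Finset.Ico r p, ∑ s ∈ Finset.Ico r t, F t s :=
  Finset.sum_comm' (fun s t => by simp only [Finset.mem_Ico]; lia)

/-- The double sums over pairs of inserted letters cancel after exchanging the order of summation.
What remains is d² = 0 at the empty word, and the shorter word otherwise. Validity of words plays no
role. -/
lemma vert_vert (p : ℕ) (c : Words K) : vert K p (vert K p c) = 0 := by
  funext w
  induction w generalizing p c with
  | nil =>
    rw [vert_nil, vert_nil, map_sub, diff_diff, map_sum, zero_sub,
      Finset.sum_congr rfl fun r _ => vert_cons p r [] c]
    simp only [vert_nil, prep_apply, Finset.sum_sub_distrib, Finset.sum_neg_distrib]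
    rw [sum_Ico_comm 0 p (fun t s => c [t, s])]
    simp
  | cons r w ih =>
    rw [vert_cons, prep_vert, Finset.sum_congr rfl fun s _ => vert_cons p s (r :: w) c]
    simp only [vert_cons, prep_apply, map_sub, map_neg, map_sum, Finset.sum_sub_distrib,
      Finset.sum_neg_distrib, Pi.sub_apply, Pi.neg_apply, Finset.sum_apply, ih]
    rw [sum_Ico_comm (r + 1) p (fun t s => c (t :: s :: r :: w))]
    simp

/-- Strictly decreasing words of letters less than `p`. -/
def Valid : ℕ → List ℕ → Prop
  | _, [] => True
  | p, r :: w => r < p ∧ Valid r w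

variable (K) in
/-- The families of total degree `N` in horizontal degree `p`. -/
def sub (p : ℕ) (N : ℤ) : Submodule k (Words K) where
  carrier := {c | ∀ w m, ¬ (Valid p w ∧ m + w.length = N) → c w m = 0}
  add_mem' {a b} ha hb w m h := by rw [Pi.add_apply, Pi.add_apply, ha w m h, hb w m h, add_zero]
  zero_mem' _ _ _ := rfl
  smul_mem' r a ha w m h := by rw [Pi.smul_apply, Pi.smul_apply, ha w m h, smul_zero]

lemma prep_mem {p r : ℕ} {N : ℤ} {c : Words K} (hc : c ∈ sub K p N) :
    prep K r c ∈ sub K r (N - 1) := by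
  intro w m hw
  refine hc _ _ (fun ⟨h₁, h₂⟩ => hw ⟨h₁.2, ?_⟩)
  simp at h₂
  lia

lemma prep_eq_zero {p r : ℕ} {N : ℤ} {c : Words K} (hc : c ∈ sub K p N) (h : p ≤ r) :
    prep K r c = 0 := by
  funext w m
  exact hc _ _ (fun ⟨h₁, _⟩ => absurd h₁.1 (by lia))

lemma vert_mem {p : ℕ} {N : ℤ} {c : Words K} (hc : c ∈ sub K p N) :
    vert K p c ∈ sub K p (N - 1) := by
  intro w m hw
  induction w generalizing p N c with
  | nil =>
    have hm : m ≠ N - 1 := fun h => hw ⟨trivial, by simpa using h⟩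
    rw [vert_nil, Pi.sub_apply, diff_apply, hc [] (m + 1) (by simp; lia), map_zero, zero_sub,
      Finset.sum_apply, neg_eq_zero]
    exact Finset.sum_eq_zero fun r _ => hc _ _ (by simp; lia)
  | cons r w ih =>
    have h₁ : vert K r (prep K r c) w m = 0 := by
      by_cases hr : r < p
      · refine ih (prep_mem hc) (fun ⟨h₁, h₂⟩ => hw ⟨⟨hr, h₁⟩, ?_⟩)
        simp
        lia
      · rw [prep_eq_zero hc (not_lt.1 hr), map_zero]
        rfl
    rw [vert_cons, Pi.sub_apply, Pi.neg_apply, h₁, neg_zero, zero_sub, Finset.sum_apply,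
      neg_eq_zero]
    refine Finset.sum_eq_zero fun s hs => hc _ _ (fun ⟨h₂, h₃⟩ => hw ⟨⟨?_, h₂.2.2⟩, ?_⟩)
    · rw [Finset.mem_Ico] at hs
      lia
    · simp at h₃ ⊢
      lia

/-- The components of the contraction. -/
noncomputable def contrComp (K : Ch.{u} k) : List ℕ → Words K →ₗ[k] (∀ m : ℤ, K.X m)
  | [] => 0
  | 0 :: [] => -LinearMap.proj []
  | 0 :: _ :: _ => 0
  | (r + 1) :: w => -(contrComp K w ∘ₗ prep K (r + 1))

variable (K) in
/-- A contraction of the columns in positive degrees. -/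
noncomputable def contr : Words K →ₗ[k] Words K := LinearMap.pi fun w => contrComp K w

lemma contr_nil (c : Words K) : contr K c [] = 0 := rfl

lemma contr_zero (c : Words K) : contr K c [0] = -c [] := rfl

lemma contr_zero_cons (c : Words K) (u : ℕ) (w : List ℕ) : contr K c (0 :: u :: w) = 0 := rfl

lemma contr_succ (c : Words K) (r : ℕ) (w : List ℕ) :
    contr K c ((r + 1) :: w) = -(contr K (prep K (r + 1) c) w) := rfl

lemma prep_contr_succ (c : Words K) (r : ℕ) :
    prep K (r + 1) (contr K c) = -contr K (prep K (r + 1) c) := rfl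

lemma contr_mem {p : ℕ} {N : ℤ} {c : Words K} (hc : c ∈ sub K p N) (hp : 0 < p) :
    contr K c ∈ sub K p (N + 1) := by
  intro w m hw
  induction w generalizing p N c with
  | nil => rfl
  | cons r w ih =>
    obtain _ | r := r
    · obtain _ | ⟨u, w⟩ := w
      · rw [contr_zero, Pi.neg_apply, hc, neg_zero]
        exact fun ⟨h₁, h₂⟩ => hw ⟨⟨hp, trivial⟩, by simp at h₂ ⊢; lia⟩
      · rfl
    · rw [contr_succ, Pi.neg_apply, neg_eq_zero]
      by_cases hr : r + 1 < p
      · refine ih (prep_mem hc) (by lia) (fun ⟨h₁, h₂⟩ => hw ⟨⟨hr, h₁⟩, ?_⟩)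
        simp
        lia
      · rw [prep_eq_zero hc (not_lt.1 hr), map_zero]
        rfl

/-- For p > 0 the valid words come in pairs: w without the letter 0, and w followed by 0. Up to sign
`contr` copies the value at w to w0, which inverts the summand of `vert` that appends a final 0; the
other terms cancel. -/
lemma vert_contr {p : ℕ} {N : ℤ} {c : Words K} (hc : c ∈ sub K p N) (hp : 0 < p) :
    vert K p (contr K c) + contr K (vert K p c) = c := by
  funext w
  rw [Pi.add_apply]
  induction w generalizing p N c with
  | nil =>
    rw [vert_nil, contr_nil, contr_nil, map_zero, zero_sub, add_zero,
      Finset.sum_eq_single_of_mem 0 (by simpa using hp), contr_zero, neg_neg]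
    rintro (_ | r) _ h
    · exact absurd rfl h
    · rw [contr_succ, contr_nil, neg_zero]
  | cons r w ih =>
    obtain _ | r := r
    · have hs (s : ℕ) (hs : s ∈ Finset.Ico (0 + 1) p) :
          contr K c (s :: 0 :: w) = -contr K (prep K s c) (0 :: w) := by
        obtain ⟨s, rfl⟩ : ∃ s', s = s' + 1 := ⟨s - 1, by rw [Finset.mem_Ico] at hs; lia⟩
        rfl
      rw [vert_cons, Finset.sum_congr rfl hs]
      obtain _ | ⟨u, w⟩ := w
      · simp only [vert_nil, contr_zero, prep_apply, map_neg, neg_neg]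
        rw [Finset.sum_eq_sum_Ico_succ_bot hp]
        simp
      · rw [vert_cons, show prep K u (prep K 0 (contr K c)) = 0 from rfl, map_zero]
        simp only [contr_zero_cons]
        -- Nothing can follow the letter 0 in a strictly decreasing word.
        have hz : c (0 :: u :: w) = 0 :=
          funext fun m => hc _ _ (fun ⟨h₁, _⟩ => absurd h₁.2.1 (by lia))
        rw [hz]
        simp
    · have hs (s : ℕ) (hs : s ∈ Finset.Ico (r + 1 + 1) p) :
          contr K c (s :: (r + 1) :: w) = contr K (prep K (r + 1) (prep K s c)) w := by
        obtain ⟨s, rfl⟩ : ∃ s', s = s' + 1 := ⟨s - 1, by rw [Finset.mem_Ico] at hs; lia⟩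
        rw [contr_succ, contr_succ, neg_neg]
      have key : vert K (r + 1) (contr K (prep K (r + 1) c)) w +
          contr K (vert K (r + 1) (prep K (r + 1) c)) w = prep K (r + 1) c w :=
        ih (prep_mem hc) (by lia)
      rw [vert_cons, Finset.sum_congr rfl hs, contr_succ, prep_vert, prep_contr_succ,
        ← prep_apply (r + 1) c w, ← key]
      simp only [map_neg, map_sub, map_sum, Pi.neg_apply, Pi.sub_apply, Finset.sum_apply]
      abel

end CofreeTwisted

/-! ### The cofree twisted complex of a chain complex. -/

namespace CofreeTwisted
open ChainComplexModel

variable {k : Type u} [CommRing k]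

/-- The summands d_i d_j from horizontal degree p to r are indexed by the degree s in between, with
i = s - r and j = p - s. -/
lemma sum_antidiagonal_eq_sum_Ico {M : Type*} [AddCommMonoid M] (r p n : ℕ) (h : r + n = p)
    (F : ℕ × ℕ → M) : ∑ ij ∈ Finset.HasAntidiagonal.antidiagonal n, F ij =
      ∑ s ∈ Finset.Ico r (p + 1), F (s - r, p - s) := by
  refine Finset.sum_nbij' (fun ij => r + ij.1) (fun s => (s - r, p - s)) ?_ ?_ ?_ ?_ ?_
  · rintro ⟨i, j⟩ hij
    simp at hij ⊢
    lia
  · intro s hs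
    simp at hs ⊢
    lia
  · rintro ⟨i, j⟩ hij
    simp at hij ⊢
    lia
  · intro s hs
    simp at hs ⊢
    lia
  · rintro ⟨i, j⟩ hij
    simp at hij
    congr 2
    · simp
    · lia

lemma sum_Ico_ends {M : Type*} [AddCommMonoid M] {r p : ℕ} (h : r < p) (F : ℕ → M) :
    ∑ s ∈ Finset.Ico r (p + 1), F s = F r + ∑ s ∈ Finset.Ico (r + 1) p, F s + F p := by
  rw [Finset.sum_Ico_succ_top h.le, Finset.sum_eq_sum_Ico_succ_bot h]

/-- The map between the families in horizontal degrees `p` and `r ≤ p`. -/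
noncomputable def op (K : Ch.{u} k) (p r : ℕ) : Words K →ₗ[k] Words K :=
  if p = r then vert K p else prep K r

lemma op_self (K : Ch.{u} k) (p : ℕ) : op K p p = vert K p := if_pos rfl

lemma op_of_lt (K : Ch.{u} k) {p r : ℕ} (h : r < p) : op K p r = prep K r := if_neg h.ne'

lemma op_mem {K : Ch.{u} k} {p r : ℕ} {N M : ℤ} {c : Words K} (hc : c ∈ sub K p N) (h : r ≤ p)
    (hM : M + 1 = N) : op K p r c ∈ sub K r M := by
  obtain rfl : M = N - 1 := by lia
  obtain rfl | h := h.eq_or_lt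
  · rw [op_self]
    exact vert_mem hc
  · rw [op_of_lt K h]
    exact prep_mem hc

/-- For r < p this is `prep_vert` rearranged: `vert` was defined by solving this very relation. Only
r = p has content, namely `vert_vert`. -/
lemma sum_op_op (K : Ch.{u} k) {p r : ℕ} (h : r ≤ p) (c : Words K) :
    ∑ s ∈ Finset.Ico r (p + 1), op K s r (op K p s c) = 0 := by
  obtain rfl | h := h.eq_or_lt
  · simp [op_self, vert_vert]
  · have hs (s : ℕ) (hs : s ∈ Finset.Ico (r + 1) p) :
        op K s r (op K p s c) = prep K r (prep K s c) := by
      rw [Finset.mem_Ico] at hs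
      rw [op_of_lt K (show r < s by lia), op_of_lt K (show s < p by lia)]
    rw [sum_Ico_ends h, op_self, op_of_lt K h, op_self, prep_vert, Finset.sum_congr rfl hs]
    abel

/-- The maps `d_i` of the cofree twisted complex on a chain complex. -/
noncomputable def cofreeD (K : Ch.{u} k) (i : ℕ) (a b : ℕ × ℤ) :
    ModuleCat.of k (sub K a.1 (a.1 + a.2)) ⟶ ModuleCat.of k (sub K b.1 (b.1 + b.2)) :=
  if h : b.1 + i = a.1 ∧ b.2 + 1 = a.2 + i then
    ModuleCat.ofHom ((op K a.1 b.1).restrict fun _ hc => op_mem hc (by lia) (by lia)) else 0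

lemma cofreeD_apply {K : Ch.{u} k} {i : ℕ} {a b : ℕ × ℤ} (h₁ : b.1 + i = a.1)
    (h₂ : b.2 + 1 = a.2 + i) (x : sub K a.1 (a.1 + a.2)) :
    ((cofreeD K i a b).hom x).1 = op K a.1 b.1 x.1 := by
  rw [cofreeD, dif_pos ⟨h₁, h₂⟩]
  rfl

lemma cofreeD_eq_zero {K : Ch.{u} k} {i : ℕ} {a b : ℕ × ℤ}
    (h : ¬ (b.1 + i = a.1 ∧ b.2 + 1 = a.2 + i)) : cofreeD K i a b = 0 := dif_neg h

/-- The cofree twisted complex on a chain complex. -/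
noncomputable def cofree (K : Ch.{u} k) : TwistedComplex.{u} k where
  X a := ModuleCat.of k (sub K a.1 (a.1 + a.2))
  d := cofreeD K
  shape _ _ _ h := cofreeD_eq_zero h
  d_comp_d n a c := by
    by_cases h : c.1 + n = a.1 ∧ c.2 + 2 = a.2 + n
    · refine ModuleCat.hom_ext (LinearMap.ext fun x => Subtype.ext ?_)
      rw [ModuleCat.hom_sum, LinearMap.sum_apply]
      refine (AddSubmonoidClass.coe_finsetSum _ _).trans ?_
      refine Eq.trans ?_ (sum_op_op K (show c.1 ≤ a.1 by lia) x.1)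
      refine Eq.trans (Finset.sum_congr rfl fun ij hij => ?_) ((sum_antidiagonal_eq_sum_Ico _ _ _
        h.1 (fun ij => op K (a.1 - ij.2) c.1 (op K a.1 (a.1 - ij.2) x.1))).trans
          (Finset.sum_congr rfl fun s hs => ?_))
      · rw [Finset.HasAntidiagonal.mem_antidiagonal] at hij
        refine (cofreeD_apply ?_ ?_ _).trans (congrArg _ (cofreeD_apply ?_ ?_ x))
        all_goals
          dsimp
          lia
      · rw [Finset.mem_Ico] at hs
        dsimp
        rw [Nat.sub_sub_self (by lia)]
    · refine Finset.sum_eq_zero fun ij hij => ?_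
      rw [Finset.HasAntidiagonal.mem_antidiagonal] at hij
      -- If the subtraction truncates, the first factor vanishes; if not, the target bidegree is
      -- wrong for the second one.
      by_cases h₁ : (a.1 - ij.2) + ij.2 = a.1
      · rw [cofreeD_eq_zero (i := ij.1), comp_zero]
        rintro ⟨h₂, h₃⟩
        dsimp at h₂ h₃
        exact h (by lia)
      · rw [cofreeD_eq_zero (i := ij.2), zero_comp]
        exact fun h₂ => h₁ h₂.1

variable {K L : Ch.{u} k}

/-- The action of a chain map on families. -/
def wordsMap (f : K ⟶ L) : Words K →ₗ[k] Words L where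
  toFun c w m := (f.f m).hom (c w m)
  map_add' _ _ := by
    funext w m
    exact map_add _ _ _
  map_smul' _ _ := by
    funext w m
    exact map_smul _ _ _

lemma wordsMap_apply (f : K ⟶ L) (c : Words K) (w : List ℕ) (m : ℤ) :
    wordsMap f c w m = (f.f m).hom (c w m) := rfl

lemma wordsMap_prep (f : K ⟶ L) (r : ℕ) (c : Words K) :
    wordsMap f (prep K r c) = prep L r (wordsMap f c) := rfl

lemma wordsMap_vert (f : K ⟶ L) (p : ℕ) (c : Words K) :
    wordsMap f (vert K p c) = vert L p (wordsMap f c) := by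
  funext w
  induction w generalizing p c with
  | nil =>
    funext m
    simp only [wordsMap_apply, vert_nil, Pi.sub_apply, diff_apply, Finset.sum_apply, map_sub,
      map_sum, ChainComplexModel.comm_apply]
  | cons r w ih =>
    funext m
    have := congrFun (ih r (prep K r c)) m
    simp only [wordsMap_apply, vert_cons, Pi.sub_apply, Pi.neg_apply, Finset.sum_apply, map_sub,
      map_sum, map_neg, wordsMap_prep] at this ⊢
    rw [this]

lemma wordsMap_contr (f : K ⟶ L) (c : Words K) :
    wordsMap f (contr K c) = contr L (wordsMap f c) := by
  funext w
  induction w generalizing c with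
  | nil =>
    funext m
    exact map_zero (f.f m).hom
  | cons r w ih =>
    obtain _ | r := r
    · obtain _ | ⟨u, w⟩ := w <;> funext m
      · exact map_neg (f.f m).hom _
      · exact map_zero (f.f m).hom
    · funext m
      have := congrFun (ih (prep K (r + 1) c)) m
      rw [wordsMap_apply] at this ⊢
      rw [contr_succ, contr_succ, Pi.neg_apply, Pi.neg_apply, map_neg, this]
      rfl

lemma wordsMap_op (f : K ⟶ L) (p r : ℕ) (c : Words K) :
    wordsMap f (op K p r c) = op L p r (wordsMap f c) := by
  by_cases h : p = r
  · rw [op, op, if_pos h, if_pos h, wordsMap_vert]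
  · rw [op, op, if_neg h, if_neg h, wordsMap_prep]

lemma wordsMap_mem (f : K ⟶ L) {p : ℕ} {N : ℤ} {c : Words K} (hc : c ∈ sub K p N) :
    wordsMap f c ∈ sub L p N :=
  fun w m h => (congrArg (f.f m).hom (hc w m h)).trans (map_zero (f.f m).hom)

lemma exists_wordsMap_eq (f : K ⟶ L) (hf : ∀ n, Function.Surjective (f.f n)) {p : ℕ} {N : ℤ}
    {c : Words L} (hc : c ∈ sub L p N) : ∃ b ∈ sub K p N, wordsMap f b = c := by
  classical
  choose s hs using fun m => hf m
  -- The set-theoretic sections `s` need not preserve 0, so zero values are lifted to 0 to keep the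
  -- support conditions.
  refine ⟨fun w m => if c w m = 0 then 0 else s m (c w m), fun w m h => if_pos (hc w m h), ?_⟩
  funext w m
  rw [wordsMap_apply]
  split_ifs with h
  · rw [map_zero, h]
  · exact hs m _

/-- The cofree twisted complex is functorial. -/
noncomputable def cofreeMap (f : K ⟶ L) : cofree K ⟶ cofree L where
  f a := ModuleCat.ofHom ((wordsMap f).restrict fun _ hc => wordsMap_mem f hc)
  comm i a b := by
    by_cases h : b.1 + i = a.1 ∧ b.2 + 1 = a.2 + i
    · refine ModuleCat.hom_ext (LinearMap.ext fun x => Subtype.ext ?_)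
      refine (cofreeD_apply h.1 h.2 _).trans ?_
      exact ((congrArg (wordsMap f) (cofreeD_apply h.1 h.2 x)).trans (wordsMap_op f _ _ _)).symm
    · exact (congrArg _ (cofreeD_eq_zero h)).trans (comp_zero.trans
        (zero_comp.symm.trans (congrArg (· ≫ _) (cofreeD_eq_zero h).symm)))

lemma cofreeMap_surjective (f : K ⟶ L) (hf : ∀ n, Function.Surjective (f.f n)) (a : ℕ × ℤ) :
    Function.Surjective ((cofreeMap f).f a) := fun y => by
  obtain ⟨b, hb, h⟩ := exists_wordsMap_eq f hf y.2
  exact ⟨⟨b, hb⟩, Subtype.ext h⟩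

/-- Let h be the contraction, which is natural, and let z be a lift of hy. Then x' = hx + d_0 z
works: d_0 x' = x because x is a cycle, and its image is h d_0 y + d_0 h y = y. -/
lemma liftsBoundaries_cofreeMap (f : K ⟶ L) (hf : ∀ n, Function.Surjective (f.f n)) (p : ℕ)
    (hp : 0 < p) : LiftsBoundaries ((TwistedComplex.column k p).map (cofreeMap f)) := by
  intro i j l hji hlj (x : sub K p (p + j)) (y : sub L p (p + i)) hx hxy
  replace hx : vert K p x.1 = 0 := by
    rw [← op_self]
    exact (cofreeD_apply (a := (p, j)) (b := (p, l)) rfl (by dsimp; lia) x).symm.trans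
      (congrArg Subtype.val hx)
  replace hxy : wordsMap f x.1 = vert L p y.1 := by
    rw [← op_self]
    exact (congrArg Subtype.val hxy).trans
      (cofreeD_apply (a := (p, i)) (b := (p, j)) rfl (by dsimp; lia) y)
  obtain ⟨z, hz, hzy⟩ := exists_wordsMap_eq f hf (contr_mem y.2 hp)
  have hm : contr K x.1 + vert K p z ∈ sub K p (p + i) := by
    refine add_mem ?_ ?_
    · convert contr_mem x.2 hp using 2
      lia
    · convert vert_mem hz using 2
      lia
  refine ⟨⟨_, hm⟩, Subtype.ext ?_, Subtype.ext ?_⟩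
  · refine (cofreeD_apply (a := (p, i)) (b := (p, j)) rfl (by dsimp; lia) _).trans ?_
    have := vert_contr x.2 hp
    rw [hx, map_zero, add_zero] at this
    dsimp only
    rw [op_self, map_add, vert_vert, add_zero, this]
  · have := vert_contr y.2 hp
    refine (map_add (wordsMap f) _ _).trans ?_
    rw [wordsMap_contr, hxy, wordsMap_vert, hzy, add_comm, this]

end CofreeTwisted

/-! ### Transposing lifting problems between Tot and the cofree functor. -/

namespace CofreeTwisted
open ChainComplexModel DirectSum TwistedComplex

variable {k : Type u} [CommRing k] {K L : Ch.{u} k} {X Y : TwistedComplex.{u} k}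

lemma sum_Ico_d_d (X : TwistedComplex.{u} k) {p r : ℕ} (h : r ≤ p) {n m l : ℤ} (hm : m + 1 = n)
    (x : X.X (p, n - p)) :
    ∑ s ∈ Finset.Ico r (p + 1), (X.d (s - r) (s, m - s) (r, l - r)).hom
      ((X.d (p - s) (p, n - p) (s, m - s)).hom x) = 0 := by
  have := X.sum_d_comp_d (p - r) (p, n - p) (r, l - r)
    (fun ij => (p - ij.2, m - (p - ij.2 : ℕ))) (fun ij hij => by
      rw [Finset.HasAntidiagonal.mem_antidiagonal] at hij
      refine Prod.ext rfl ?_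
      dsimp
      lia)
  have := congrArg (fun f => f.hom x) this
  simp only [ModuleCat.hom_sum, LinearMap.sum_apply, ModuleCat.hom_comp,
    LinearMap.comp_apply] at this
  rw [sum_antidiagonal_eq_sum_Ico r p _ (by lia)] at this
  refine Eq.trans (Finset.sum_congr rfl fun s hs => ?_) this
  rw [Finset.mem_Ico] at hs
  dsimp
  rw [Nat.sub_sub_self (by lia)]

lemma totD_lof_eq_sum_Ico (X : TwistedComplex.{u} k) (n m : ℤ) (p : ℕ) (x : X.X (p, n - p)) :
    totD X n m (lof k ℕ (fun p : ℕ => X.X (p, n - p)) p x) = ∑ r ∈ Finset.Ico 0 (p + 1),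
      lof k ℕ (fun p : ℕ => X.X (p, m - p)) r
        ((X.d (p - r) (p, n - p) (r, m - r)).hom x) := by
  rw [totD_lof, ← Finset.Nat.sum_antidiagonal_swap,
    sum_antidiagonal_eq_sum_Ico 0 p p (zero_add p)]
  rfl

/-- The components of a chain map on the total complex. -/
noncomputable def totComp (φ : (tot k).obj X ⟶ K) (n : ℤ) : (⨁ p : ℕ, X.X (p, n - p)) →ₗ[k] K.X n :=
  (φ.f n).hom

lemma d_totComp (φ : (tot k).obj X ⟶ K) (n m : ℤ) (x : ⨁ p : ℕ, X.X (p, n - p)) :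
    (K.d n m).hom (totComp φ n x) = totComp φ m (totD X n m x) :=
  ChainComplexModel.comm_apply φ n m x

/-- The components of the map of twisted complexes that is adjoint to a chain map. -/
noncomputable def adjComp (φ : (tot k).obj X ⟶ K) :
    ∀ (_ : List ℕ) (p : ℕ) (n : ℤ), X.X (p, n - p) →ₗ[k] (∀ m : ℤ, K.X m)
  | [], p, n => LinearMap.single k (fun m => K.X m) n ∘ₗ totComp φ n ∘ₗ
      lof k ℕ (fun p : ℕ => X.X (p, n - p)) p
  | r :: w, p, n => if r < p then
      adjComp φ w r (n - 1) ∘ₗ (X.d (p - r) (p, n - p) (r, n - 1 - r)).hom else 0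

/-- The map of twisted complexes that is adjoint to a chain map, with values in families. -/
noncomputable def adjWords (φ : (tot k).obj X ⟶ K) (p : ℕ) (n : ℤ) :
    X.X (p, n - p) →ₗ[k] Words K := LinearMap.pi fun w => adjComp φ w p n

variable (φ : (tot k).obj X ⟶ K)

lemma adjWords_nil (p : ℕ) (n : ℤ) (x : X.X (p, n - p)) :
    adjWords φ p n x [] =
      Pi.single n (totComp φ n (lof k ℕ (fun p : ℕ => X.X (p, n - p)) p x)) := rfl

lemma adjWords_cons {p r : ℕ} {n m : ℤ} (h : r < p) (hm : m + 1 = n) (w : List ℕ)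
    (x : X.X (p, n - p)) :
    adjWords φ p n x (r :: w) =
      adjWords φ r m ((X.d (p - r) (p, n - p) (r, m - r)).hom x) w := by
  obtain rfl : m = n - 1 := by lia
  simp [adjWords, adjComp, h]

lemma prep_adjWords {p r : ℕ} {n m : ℤ} (h : r < p) (hm : m + 1 = n) (x : X.X (p, n - p)) :
    prep K r (adjWords φ p n x) =
      adjWords φ r m ((X.d (p - r) (p, n - p) (r, m - r)).hom x) :=
  funext fun w => adjWords_cons φ h hm w x

lemma adjWords_cons_of_le {p r : ℕ} {n : ℤ} (h : p ≤ r) (w : List ℕ) (x : X.X (p, n - p)) :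
    adjWords φ p n x (r :: w) = 0 := by
  simp [adjWords, adjComp, not_lt.2 h]

lemma adjWords_mem (p : ℕ) (n : ℤ) (x : X.X (p, n - p)) : adjWords φ p n x ∈ sub K p n := by
  intro w m h
  induction w generalizing p n with
  | nil => exact Pi.single_eq_of_ne (fun h' => h ⟨trivial, by simpa using h'⟩) _
  | cons r w ih =>
    by_cases hr : r < p
    · rw [adjWords_cons φ hr (sub_add_cancel n 1)]
      exact ih _ _ _ (fun ⟨h₁, h₂⟩ => h ⟨⟨hr, h₁⟩, by simp; lia⟩)
    · rw [adjWords_cons_of_le φ (not_lt.1 hr)]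
      rfl

lemma diff_single {n m : ℤ} (hm : m + 1 = n) (y : K.X n) :
    diff K (Pi.single n y) = Pi.single m ((K.d n m).hom y) := by
  subst hm
  funext i
  rw [diff_apply]
  by_cases h : i = m
  · subst h
    rw [Pi.single_eq_same, Pi.single_eq_same]
  · rw [Pi.single_eq_of_ne h, Pi.single_eq_of_ne (by lia), map_zero]

/-- At the empty word this is the chain map condition on φ, and at longer words the relation ∑ d_i
d_j = 0 in X: the two identities from which `vert` was designed. -/
lemma vert_adjWords (p : ℕ) {n m : ℤ} (hm : m + 1 = n) (x : X.X (p, n - p)) :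
    vert K p (adjWords φ p n x) = adjWords φ p m ((X.d 0 (p, n - p) (p, m - p)).hom x) := by
  funext w
  induction w generalizing p n m with
  | nil =>
    have hs (r : ℕ) (hr : r ∈ Finset.Ico 0 p) : adjWords φ p n x [r] =
        Pi.single m (totComp φ m (lof k ℕ (fun p : ℕ => X.X (p, m - p)) r
          ((X.d (p - r) (p, n - p) (r, m - r)).hom x))) := by
      rw [Finset.mem_Ico] at hr
      rw [adjWords_cons φ hr.2 hm, adjWords_nil]
    have h := d_totComp φ n m (lof k ℕ (fun p : ℕ => X.X (p, n - p)) p x)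
    rw [totD_lof_eq_sum_Ico, Finset.sum_Ico_succ_top p.zero_le,
      map_add, map_sum] at h
    rw [vert_nil, Finset.sum_congr rfl hs, adjWords_nil, adjWords_nil, diff_single hm, h,
      Pi.single_add, sub_eq_iff_eq_add, add_comm]
    rw [Nat.sub_self, add_right_inj]
    exact map_sum (LinearMap.single k (fun m => K.X m) m) _ _
  | cons r w ih =>
    rw [vert_cons]
    by_cases hr : r < p
    · have hs (s : ℕ) (hs : s ∈ Finset.Ico (r + 1) p) : adjWords φ p n x (s :: r :: w) =
          adjWords φ r (m - 1) ((X.d (s - r) (s, m - s) (r, m - 1 - r)).hom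
            ((X.d (p - s) (p, n - p) (s, m - s)).hom x)) w := by
        rw [Finset.mem_Ico] at hs
        rw [adjWords_cons φ hs.2 hm, adjWords_cons φ hs.1 (sub_add_cancel m 1)]
      have h := congrArg (fun y => adjWords φ r (m - 1) y w) (sum_Ico_d_d X hr.le hm (l := m - 1) x)
      rw [sum_Ico_ends hr] at h
      simp only [map_add, map_sum, map_zero, Pi.add_apply, Pi.zero_apply, Finset.sum_apply,
        Nat.sub_self] at h
      rw [prep_adjWords φ hr hm, ih r (sub_add_cancel m 1), Finset.sum_congr rfl hs,
        adjWords_cons φ hr (sub_add_cancel m 1)]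
      rw [← neg_add', neg_eq_iff_add_eq_zero]
      exact h
    · rw [adjWords_cons_of_le φ (not_lt.1 hr), Finset.Ico_eq_empty (by lia)]
      have : prep K r (adjWords φ p n x) = 0 :=
        funext fun w => adjWords_cons_of_le φ (not_lt.1 hr) w x
      rw [this]
      simp

lemma op_adjWords {p r i : ℕ} {n m : ℤ} (h : r + i = p) (hm : m + 1 = n) (x : X.X (p, n - p)) :
    op K p r (adjWords φ p n x) =
      adjWords φ r m ((X.d i (p, n - p) (r, m - r)).hom x) := by
  obtain _ | i := i
  · obtain rfl : r = p := h
    rw [op_self, vert_adjWords φ r hm]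
  · have hi : i + 1 = p - r := by lia
    rw [hi, op_of_lt K (show r < p by lia), prep_adjWords φ (by lia) hm]

/-- The identification of bidegrees `(p, q)` and `(p, n - p)` for `n = p + q`. -/
lemma bidegree_eq (a : ℕ × ℤ) : a = (a.1, a.1 + a.2 - a.1) := Prod.ext rfl (by simp)

/-- The map of twisted complexes that is adjoint to a chain map. -/
noncomputable def adjMap : X ⟶ cofree K where
  f a := eqToHom (congrArg X.X (bidegree_eq a)) ≫
    ModuleCat.ofHom ((adjWords φ a.1 (a.1 + a.2)).codRestrict (sub K a.1 (a.1 + a.2))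
      (adjWords_mem φ _ _))
  comm i a b := by
    by_cases h : b.1 + i = a.1 ∧ b.2 + 1 = a.2 + i
    · refine ModuleCat.hom_ext (LinearMap.ext fun x => Subtype.ext ?_)
      refine (cofreeD_apply h.1 h.2 _).trans ?_
      refine (op_adjWords φ h.1 (m := b.1 + b.2) (by lia) _).trans ?_
      exact congrArg (adjWords φ b.1 (b.1 + b.2)) (LinearMap.congr_fun (congrArg ModuleCat.Hom.hom
        (X.d_eqToHom i (bidegree_eq a) (bidegree_eq b))) x)
    · exact (congrArg _ (cofreeD_eq_zero h)).trans (comp_zero.trans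
        (zero_comp.symm.trans (congrArg (· ≫ _) (X.shape _ _ _ h).symm)))

lemma adjMap_apply (p : ℕ) (n : ℤ) (x : X.X (p, n - p)) :
    (((adjMap φ).f (p, n - p)).hom x).1 = adjWords φ p n x := by
  -- With an independent vertical degree `q`, the equation p + q = n can be substituted and the
  -- transports compose to the identity.
  have key (q : ℤ) (h : p + q = n) (h' : (p, n - p) = (p, q)) (x : X.X (p, n - p)) :
      (((adjMap φ).f (p, q)).hom ((eqToHom (congrArg X.X h')).hom x)).1 = adjWords φ p n x := by
    subst h
    refine congrArg (adjWords φ p (p + q)) ?_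
    exact LinearMap.congr_fun (congrArg ModuleCat.Hom.hom ((eqToHom_trans
      (congrArg X.X h') (congrArg X.X (bidegree_eq (p, q)))).trans (eqToHom_refl _ _))) x
  exact key (n - p) (by lia) rfl x

lemma adjWords_comp (g : K ⟶ L) (p : ℕ) (n : ℤ) (x : X.X (p, n - p)) :
    adjWords (φ ≫ g) p n x = wordsMap g (adjWords φ p n x) := by
  funext w
  induction w generalizing p n with
  | nil =>
    funext m
    rw [wordsMap_apply, adjWords_nil, adjWords_nil]
    by_cases h : m = n
    · subst h
      rw [Pi.single_eq_same, Pi.single_eq_same]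
      rfl
    · rw [Pi.single_eq_of_ne h, Pi.single_eq_of_ne h, map_zero]
  | cons r w ih =>
    funext m
    rw [wordsMap_apply]
    by_cases h : r < p
    · rw [adjWords_cons _ h (sub_add_cancel n 1), adjWords_cons _ h (sub_add_cancel n 1), ih]
      rfl
    · rw [adjWords_cons_of_le _ (not_lt.1 h), adjWords_cons_of_le _ (not_lt.1 h)]
      exact (map_zero (g.f m).hom).symm

lemma adjWords_tot_map_comp (j : Y ⟶ X) (p : ℕ) (n : ℤ) (y : Y.X (p, n - p)) :
    adjWords ((tot k).map j ≫ φ) p n y = adjWords φ p n ((j.f (p, n - p)).hom y) := by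
  funext w
  induction w generalizing p n with
  | nil =>
    rw [adjWords_nil, adjWords_nil, ← totMap_lof]
    rfl
  | cons r w ih =>
    by_cases h : r < p
    · rw [adjWords_cons _ h (sub_add_cancel n 1), adjWords_cons _ h (sub_add_cancel n 1), ih,
        TwistedComplex.comm_apply]
    · rw [adjWords_cons_of_le _ (not_lt.1 h), adjWords_cons_of_le _ (not_lt.1 h)]

lemma adjMap_comp (g : K ⟶ L) : adjMap (φ ≫ g) = adjMap φ ≫ cofreeMap g := by
  ext a : 1
  exact ModuleCat.hom_ext (LinearMap.ext fun x => Subtype.ext (adjWords_comp φ g _ _ _))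

lemma adjMap_tot_map_comp (j : Y ⟶ X) : adjMap ((tot k).map j ≫ φ) = j ≫ adjMap φ := by
  ext a : 1
  refine ModuleCat.hom_ext (LinearMap.ext fun x => Subtype.ext ?_)
  exact (adjWords_tot_map_comp φ j _ _ _).trans (congrArg (adjWords φ a.1 (a.1 + a.2))
    (LinearMap.congr_fun (congrArg ModuleCat.Hom.hom (f_eqToHom j (bidegree_eq a))) x))

/-- The evaluation on the empty word. -/
noncomputable def evalNil (K : Ch.{u} k) (n : ℤ) :
    (⨁ p : ℕ, (cofree K).X (p, n - p)) →ₗ[k] K.X n :=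
  DirectSum.toModule k ℕ _ fun p => LinearMap.proj n ∘ₗ LinearMap.proj [] ∘ₗ
    (sub K p (p + (n - p))).subtype

lemma evalNil_lof (K : Ch.{u} k) (n : ℤ) (p : ℕ) (c : (cofree K).X (p, n - p)) :
    evalNil K n (lof k ℕ (fun p : ℕ => (cofree K).X (p, n - p)) p c) = c.1 [] n :=
  DirectSum.toModule_lof _ _ _

/-- The chain map from the total complex of the cofree twisted complex. -/
noncomputable def counit (K : Ch.{u} k) : (tot k).obj (cofree K) ⟶ K where
  f n := ModuleCat.ofHom (evalNil K n)
  comm' n m h := by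
    obtain rfl : m + 1 = n := h
    refine ModuleCat.hom_ext (DirectSum.linearMap_ext k fun p => LinearMap.ext fun c => ?_)
    change (K.d (m + 1) m).hom (evalNil K (m + 1) (lof k ℕ _ p c)) =
      evalNil K m (totD (cofree K) (m + 1) m (lof k ℕ _ p c))
    rw [evalNil_lof, totD_lof_eq_sum_Ico, map_sum]
    have hs (r : ℕ) (hr : r ∈ Finset.Ico 0 (p + 1)) :
        evalNil K m (lof k ℕ (fun p : ℕ => (cofree K).X (p, m - p)) r
          (((cofree K).d (p - r) (p, m + 1 - p) (r, m - r)).hom c)) = op K p r c.1 [] m := by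
      rw [Finset.mem_Ico] at hr
      rw [evalNil_lof]
      exact congrArg (fun c : Words K => c [] m) (cofreeD_apply (by dsimp; lia) (by dsimp; lia) c)
    have hs' (r : ℕ) (hr : r ∈ Finset.Ico 0 p) : op K p r c.1 [] m = c.1 [r] m := by
      rw [Finset.mem_Ico] at hr
      rw [op_of_lt K hr.2]
      rfl
    -- Evaluated at [], d_0 contributes dc[] - ∑ c[r], and the maps to lower columns contribute ∑
    -- c[r], so only dc[] survives.
    rw [Finset.sum_congr rfl hs, Finset.sum_Ico_succ_top p.zero_le, op_self, vert_nil,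
      Finset.sum_congr rfl hs', Pi.sub_apply, Finset.sum_apply, diff_apply]
    abel

lemma counit_naturality (g : K ⟶ L) :
    (tot k).map (cofreeMap g) ≫ counit L = counit K ≫ g := by
  ext n : 1
  refine ModuleCat.hom_ext (DirectSum.linearMap_ext k fun p => LinearMap.ext fun c => ?_)
  change evalNil L n (totMap (cofreeMap g) n (lof k ℕ _ p c)) =
    (g.f n).hom (evalNil K n (lof k ℕ _ p c))
  rw [totMap_lof, evalNil_lof, evalNil_lof]
  rfl

/-- This triangle identity and the naturality of `adjMap` and `counit` suffice to transpose lifting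
problems; uniqueness of the adjoint map is not needed. -/
lemma tot_map_adjMap_comp_counit : (tot k).map (adjMap φ) ≫ counit K = φ := by
  ext n : 1
  refine ModuleCat.hom_ext (DirectSum.linearMap_ext k fun p => LinearMap.ext fun x => ?_)
  change evalNil K n (totMap (adjMap φ) n (lof k ℕ _ p x)) = totComp φ n (lof k ℕ _ p x)
  rw [totMap_lof, evalNil_lof, adjMap_apply, adjWords_nil, Pi.single_eq_same]

/-- The total complex sends maps with the left lifting property against total fibrations to
quasi-isomorphisms. -/
theorem quasiIso_tot_of_llp (j : X ⟶ Y) (hj : ∀ ⦃X' Y' : TwistedComplex.{u} k⦄ (g : X' ⟶ Y'),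
    (∀ a, Function.Surjective (g.f a)) →
      (∀ p : ℕ, 0 < p → LiftsBoundaries ((column k p).map g)) → HasLiftingProperty j g) :
    QuasiIso ((tot k).map j) := by
  refine quasiIso_of_llp _ (fun K L g hg => ⟨fun {φ ψ} sq => ?_⟩)
  have := hj (cofreeMap g) (cofreeMap_surjective g hg) (liftsBoundaries_cofreeMap g hg)
  -- The square under Tot j becomes a square against `cofreeMap g`, which is a total fibration. Its
  -- lift is transposed back by applying Tot and composing with `counit`.
  have sq' : CommSq (adjMap φ) j (cofreeMap g) (adjMap ψ) :=
    ⟨by rw [← adjMap_comp, sq.w, adjMap_tot_map_comp]⟩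
  refine ⟨⟨⟨(tot k).map sq'.lift ≫ counit K, ?_, ?_⟩⟩⟩
  · rw [← Category.assoc, ← Functor.map_comp, sq'.fac_left, tot_map_adjMap_comp_counit]
  · rw [Category.assoc, ← counit_naturality, ← Category.assoc, ← Functor.map_comp, sq'.fac_right,
      tot_map_adjMap_comp_counit]

end CofreeTwisted

/-! ### The total model structure and the adjunction with column 0. -/

namespace TwistedComplex
open ModelConstruction HomotopicalAlgebra ChainComplexModel

variable {k : Type u} [CommRing k] {X Y : TwistedComplex.{u} k}

-- The cell attaches a generator along its d_0 only: its source is universal for an element of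
-- bidegree (p, q - 1) killed by d_0. Lifting against all cells of one horizontal degree p is
-- therefore a condition on the single column p.
variable (k) in
lemma exists_column_cell (a : ℕ × ℤ) :
    ∃ (S : TwistedComplex.{u} k) (i : S ⟶ free k a), IsFinitelyPresentable.{u} S ∧
      ∀ ⦃X Y : TwistedComplex.{u} k⦄ (f : X ⟶ Y), HasLiftingProperty i f ↔
        ∀ (x : X.X (a.1, a.2 - 1)) (y : Y.X a), (X.d 0 _ (a.1, a.2 - 1 - 1)).hom x = 0 →
          (f.f _).hom x = (Y.d 0 a _).hom y →
            ∃ x' : X.X a, (X.d 0 a _).hom x' = x ∧ (f.f a).hom x' = y :=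
  exists_module_cell (freeCorepresentableBy k a) (freeCorepresentableBy k (a.1, a.2 - 1))
    (freeCorepresentableBy k (a.1, a.2 - 1 - 1)) inferInstance inferInstance (evalD k 0 _ _)
    (evalD k 0 _ _) (by ext X : 2; exact X.d_zero_comp_d_zero _ _ _)

lemma liftsBoundaries_column_iff (p : ℕ) (f : X ⟶ Y) : LiftsBoundaries ((column k p).map f) ↔
    ∀ q : ℤ, ∀ (x : X.X (p, q - 1)) (y : Y.X (p, q)), (X.d 0 _ (p, q - 1 - 1)).hom x = 0 →
      (f.f _).hom x = (Y.d 0 (p, q) _).hom y →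
        ∃ x' : X.X (p, q), (X.d 0 (p, q) _).hom x' = x ∧ (f.f (p, q)).hom x' = y := by
  refine ⟨fun h q => h q (q - 1) (q - 1 - 1) (by lia) (by lia), fun h i j l hij hjl => ?_⟩
  obtain rfl : j = i - 1 := by lia
  obtain rfl : l = i - 1 - 1 := by lia
  exact h i

lemma forall_liftsBoundaries_iff (f : X ⟶ Y) :
    ((∀ a, Function.Surjective (f.f a)) ∧ ∀ p, 0 < p → LiftsBoundaries ((column k p).map f)) ↔
      (∀ a, Function.Surjective (f.f a)) ∧ ∀ p, 0 < p → QuasiIso ((column k p).map f) :=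
  and_congr_right fun hs => forall₂_congr fun p _ => by
    rw [liftsBoundaries_iff, and_iff_right]
    exact fun n => hs (p, n)

variable (k) in
theorem exists_totalModelStructure :
    ∃ N : ModelCategory (TwistedComplex.{u} k), IsTotalModelStructure N := by
  choose S i hS hi using exists_column_cell k
  have h (a : ℕ × ℤ) : ∃ (S : TwistedComplex.{u} k) (j : S ⟶ free k a),
      IsFinitelyPresentable.{u} S ∧ ∀ ⦃X Y : TwistedComplex.{u} k⦄ (f : X ⟶ Y),
        HasLiftingProperty j f ↔ (a.1 = 0 → Function.Surjective (f.f a)) ∧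
          (0 < a.1 → HasLiftingProperty (i a) f) := by
    -- The second generating family uses 0 → `free k a` in column 0, and repeats the cells `i a` in
    -- positive columns, where fibrations have to be trivial.
    by_cases ha : a.1 = 0
    · obtain ⟨S, j, hS, hj⟩ := exists_initial_cell (freeCorepresentableBy k a)
      exact ⟨S, j, hS, fun X Y f => (hj f).trans (by simp [ha]; rfl)⟩
    · exact ⟨S a, i a, hS a, fun X Y f => by simp [ha, Nat.pos_of_ne_zero ha]⟩
  choose S' j hS' hj using h
  have hi' ⦃X Y : TwistedComplex.{u} k⦄ (f : X ⟶ Y) :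
      (∀ a, HasLiftingProperty (i a) f) ↔ ∀ p, LiftsBoundaries ((column k p).map f) := by
    simp only [hi, liftsBoundaries_column_iff, Prod.forall]
  have hj' ⦃X Y : TwistedComplex.{u} k⦄ (f : X ⟶ Y) :
      (∀ a, HasLiftingProperty (j a) f) ↔ (∀ a, Function.Surjective (f.f a)) ∧
        ∀ p, 0 < p → LiftsBoundaries ((column k p).map f) := by
    have (p : ℕ) : LiftsBoundaries ((column k p).map f) ↔ ∀ q, HasLiftingProperty (i (p, q)) f := by
      simp only [hi, liftsBoundaries_column_iff]
    simp only [hj]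
    refine ⟨fun h => ?_, fun h a => ⟨fun _ => h.1 a, fun ha => (this a.1).1 (h.2 a.1 ha) a.2⟩⟩
    have h' (p : ℕ) (hp : 0 < p) := (this p).2 fun q => (h (p, q)).2 hp
    refine ⟨fun ⟨p, q⟩ => ?_, h'⟩
    by_cases hp : p = 0
    · exact (h (p, q)).1 hp
    -- In positive columns surjectivity follows from lifting boundaries.
    · exact (h' p (Nat.pos_of_ne_zero hp)).surjective q
  have h₁ ⦃X Y : TwistedComplex.{u} k⦄ (f : X ⟶ Y) : (∀ a, HasLiftingProperty (i a) f) ↔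
      (∀ a, HasLiftingProperty (j a) f) ∧ (HomologicalComplex.quasiIso (ModuleCat.{u} k)
        (ComplexShape.down ℤ)).inverseImage (tot k) f := by
    rw [hi', hj', MorphismProperty.inverseImage_iff, HomologicalComplex.mem_quasiIso_iff]
    refine ⟨fun h => ?_, fun ⟨⟨hs, h⟩, h'⟩ p => ?_⟩
    · have hs : ∀ a, Function.Surjective (f.f a) := fun ⟨p, q⟩ => (h p).surjective q
      exact ⟨⟨hs, fun p _ => h p⟩,
        ((liftsBoundaries_tot_iff f hs fun p _ => h p).2 (h 0)).quasiIso⟩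
    · obtain rfl | hp := p.eq_zero_or_pos
      -- The total complex of a total fibration is surjective, so a total equivalence makes it a
      -- trivial fibration, which is then passed to column 0.
      · exact (liftsBoundaries_tot_iff f hs h).1
          ((liftsBoundaries_iff _).2 ⟨totMap_surjective f hs, h'⟩)
      · exact h p hp
  obtain ⟨N, hW, hF⟩ := exists_modelCategory_of_families _ i j hS hS' h₁
    (fun X Y f hf => CofreeTwisted.quasiIso_tot_of_llp f
      (fun X' Y' g hs hg => hf g ((hj' g).2 ⟨hs, hg⟩)))
  exact ⟨N, { weakEquivalence_iff := fun f => hW f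
              fibration_iff := fun f => ((hF f).trans (hj' f)).trans
                (forall_liftsBoundaries_iff f) }⟩

/-- The inclusion of chain complexes is left adjoint to taking the zeroth column. -/
def inclusionHomEquiv (K : Ch.{u} k) (Y : TwistedComplex.{u} k) :
    ((inclusion k).obj K ⟶ Y) ≃ (K ⟶ (column k 0).obj Y) where
  toFun g := (column k 0).map g
  invFun g :=
    { f := fun
        | (0, q) => g.f q
        | (_ + 1, _) => 0
      comm := by
        rintro i ⟨_ | p, q⟩ ⟨_ | p', q'⟩
        · obtain _ | i := i
          · exact g.comm q q'
          · exact (congrArg (_ ≫ ·) (Y.shape _ _ _ (by simp))).trans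
              (comp_zero.trans zero_comp.symm)
        · exact (congrArg (_ ≫ ·) (Y.shape _ _ _ (by simp))).trans
            (comp_zero.trans comp_zero.symm)
        all_goals
          refine zero_comp.trans (ModuleCat.hom_ext (LinearMap.ext fun x => ?_))
          exact (map_zero (((inclusion k).obj K).d i _ _ ≫ _).hom).symm }
  left_inv g := by
    ext ⟨_ | p, q⟩ : 1
    · rfl
    · exact ModuleCat.hom_ext (LinearMap.ext fun x => (map_zero (g.f (p + 1, q)).hom).symm)
  right_inv g := rfl

variable (k) in
def inclusionAdjunction : inclusion k ⊣ column k 0 :=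
  Adjunction.mkOfHomEquiv
    { homEquiv := inclusionHomEquiv
      homEquiv_naturality_left_symm := fun f g => by
        ext ⟨_ | p, q⟩ : 1
        · rfl
        · exact comp_zero.symm
      homEquiv_naturality_right := fun f g => rfl }

end TwistedComplex

/-! ### The Quillen equivalence. -/

namespace TwistedComplex
open HomotopicalAlgebra ChainComplexModel

variable {k : Type u} [CommRing k] {X Y : TwistedComplex.{u} k}

instance : HasTerminal (TwistedComplex.{u} k) := HasFiniteLimits.out (Discrete PEmpty.{1})

/-- Elements are maps out of a free twisted complex, and there is only one such map to the terminal
object. -/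
lemma subsingleton_terminal (a : ℕ × ℤ) : Subsingleton ((⊤_ (TwistedComplex.{u} k)).X a) :=
  ⟨fun x y => by
    rw [← freeDesc_freeGen _ x, ← freeDesc_freeGen _ y,
      terminalIsTerminal.hom_ext (freeDesc _ x) (freeDesc _ y)]⟩

lemma quasiIso_totIncl_inclusion (K : Ch.{u} k) :
    QuasiIso ((totIncl k).app ((inclusion k).obj K)) := by
  refine quasiIso_totIncl_app (terminal.from _) subsingleton_terminal fun p hp => ?_
  obtain ⟨p, rfl⟩ : ∃ p', p = p' + 1 := ⟨p - 1, by lia⟩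
  exact fun i j l _ _ x y _ _ => ⟨0, rfl, (subsingleton_terminal _).elim _ _⟩

/-- A map from a chain complex to a fibrant twisted complex is a total equivalence if and only if
its adjoint is a quasi-isomorphism. -/
lemma quasiIso_tot_iff {K : Ch.{u} k} (g : (inclusion k).obj K ⟶ Y)
    (hY : ∀ p, 0 < p → LiftsBoundaries ((column k p).map (terminal.from Y))) :
    QuasiIso ((tot k).map g) ↔ QuasiIso ((column k 0).map g) := by
  have := quasiIso_totIncl_inclusion K
  have := quasiIso_totIncl_app (terminal.from Y) subsingleton_terminal hY
  -- In the naturality square of `totIncl` at `g` both horizontal maps are quasi-isomorphisms, so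
  -- the two vertical maps are quasi-isomorphisms together.
  rw [← quasiIso_iff_comp_left ((totIncl k).app ((inclusion k).obj K)), ← (totIncl k).naturality,
    quasiIso_iff_comp_right]

lemma quasiIso_tot_inclusion {K L : Ch.{u} k} (f : K ⟶ L) :
    QuasiIso ((tot k).map ((inclusion k).map f)) ↔ QuasiIso f := by
  have := quasiIso_totIncl_inclusion K
  have := quasiIso_totIncl_inclusion L
  rw [← quasiIso_iff_comp_left ((totIncl k).app ((inclusion k).obj K)), ← (totIncl k).naturality,
    quasiIso_iff_comp_right]
  rfl

variable {M : ModelCategory (Ch.{u} k)} {N : ModelCategory (TwistedComplex.{u} k)}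

/-- The positive columns of an included complex vanish, so its total complex has the homology of the
complex itself. This serves both trivial cofibrations and the unit condition. -/
lemma weakEquivalence_inclusion_map (hM : IsProjectiveModelStructure M)
    (hN : IsTotalModelStructure N) {K L : Ch.{u} k} (f : K ⟶ L) (hf : WeakEquivalence f) :
    WeakEquivalence ((inclusion k).map f) := by
  rwa [hN.weakEquivalence_iff, quasiIso_tot_inclusion, ← hM.weakEquivalence_iff]

theorem isQuillenEquivalence (hM : IsProjectiveModelStructure M) (hN : IsTotalModelStructure N) :
    IsQuillenEquivalence (inclusionAdjunction k) := by
  have hC {K L : Ch.{u} k} (f : K ⟶ L) (hf : Cofibration f) :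
      Cofibration ((inclusion k).map f) := by
    rw [cofibration_iff, ← trivialFibrations_llp]
    intro X Y g hg
    rw [(inclusionAdjunction k).hasLiftingProperty_iff]
    rw [mem_trivialFibrations_iff, hN.fibration_iff, hN.weakEquivalence_iff,
      ← forall_liftsBoundaries_iff] at hg
    -- By adjunction the lifting problem for `inclusion` is one against column 0 of `g`, so that
    -- column has to be a trivial fibration.
    have h₀ := (liftsBoundaries_tot_iff g hg.1.1 hg.1.2).1
      ((liftsBoundaries_iff _).2 ⟨totMap_surjective g hg.1.1, hg.2⟩)
    have h₁ : Fibration ((column k 0).map g) := (hM.fibration_iff _).2 h₀.surjective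
    have h₂ : WeakEquivalence ((column k 0).map g) := (hM.weakEquivalence_iff _).2 h₀.quasiIso
    infer_instance
  exact
    { cofibration_map := hC
      trivial_cofibration_map := fun f hf hf' =>
        ⟨hC f hf, weakEquivalence_inclusion_map hM hN f hf'⟩
      weakEquivalence_iff := fun K Y g _ hY => by
        rw [hM.weakEquivalence_iff, hN.weakEquivalence_iff]
        refine (quasiIso_tot_iff g ?_).trans ?_
        · exact ((forall_liftsBoundaries_iff _).2 ((hN.fibration_iff _).1 hY)).2
        · rw [inclusionAdjunction, Adjunction.mkOfHomEquiv_homEquiv]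
          rfl }

end TwistedComplex

/-! ### Column 0 as a lax symmetric monoidal functor. -/

namespace TwistedComplex
open Category KoszulGraded
open GradedObject.Monoidal (ιTensorObj tensorObjDesc tensorObj_ext ι_tensorObjDesc
  ι_tensorObjDesc_assoc ιTensorObj₃ ιTensorObj₃' tensorObj₃_ext tensorObj₃'_ext ι_tensorHom
  ι_tensorHom_assoc ιTensorObj₃_eq ιTensorObj₃'_eq ιTensorObj₃_eq_assoc ιTensorObj₃'_eq_assoc
  ιTensorObj₃'_associator_hom ιTensorObj₃_associator_inv ιTensorObj₃'_associator_hom_assoc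
  ιTensorObj₃_associator_inv_assoc)

variable {k : Type u} [CommRing k]

section
variable (A B C : GradedObject (ℕ × ℤ) (ModuleCat.{u} k))

/-- The part in horizontal degree zero of a bigraded module. -/
abbrev row (A : GradedObject (ℕ × ℤ) (ModuleCat.{u} k)) : GradedObject ℤ (ModuleCat.{u} k) :=
  fun q => A (0, q)

lemma zero_bidegree_add {i j s : ℤ} (h : i + j = s) : ((0, i) : ℕ × ℤ) + (0, j) = (0, s) :=
  Prod.ext rfl h

/-- The comparison of tensor products in horizontal degree zero. -/
noncomputable def rowTensor (s : ℤ) : GradedObject.Monoidal.tensorObj (row A) (row B) s ⟶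
    GradedObject.Monoidal.tensorObj A B (0, s) :=
  tensorObjDesc fun i j h => ιTensorObj A B (0, i) (0, j) (0, s) (zero_bidegree_add h)

lemma ι_rowTensor (i j s : ℤ) (h : i + j = s) :
    ιTensorObj (row A) (row B) i j s h ≫ rowTensor A B s =
      ιTensorObj A B (0, i) (0, j) (0, s) (zero_bidegree_add h) :=
  ι_tensorObjDesc _ _ _ _

lemma ι_rowTensor_assoc (i j s : ℤ) (h : i + j = s) {W : ModuleCat.{u} k}
    (f : GradedObject.Monoidal.tensorObj A B (0, s) ⟶ W) :
    ιTensorObj (row A) (row B) i j s h ≫ rowTensor A B s ≫ f =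
      ιTensorObj A B (0, i) (0, j) (0, s) (zero_bidegree_add h) ≫ f := by
  rw [← assoc, ι_rowTensor]

end

variable (X Y Z : TwistedComplex.{u} k)

/-- The differential of the tensor product of the zeroth columns. -/
noncomputable def rowTensorD (s t : ℤ) :
    GradedObject.Monoidal.tensorObj (row X.X) (row Y.X) s ⟶
      GradedObject.Monoidal.tensorObj (row X.X) (row Y.X) t :=
  (HomologicalComplex.tensorObj ((column k 0).obj X) ((column k 0).obj Y)).d s t

lemma ι_rowTensorD (i j s t : ℤ) (h : i + j = s) (hst : t + 1 = s) :
    ιTensorObj (row X.X) (row Y.X) i j s h ≫ rowTensorD X Y s t =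
      (X.d 0 (0, i) (0, i - 1) ▷ Y.X (0, j)) ≫
          ιTensorObj (row X.X) (row Y.X) (i - 1) j t (by lia) +
        i.negOnePow • ((X.X (0, i) ◁ Y.d 0 (0, j) (0, j - 1)) ≫
          ιTensorObj (row X.X) (row Y.X) i (j - 1) t (by lia)) :=
  ChainTensor.ι_d ((column k 0).obj X) ((column k 0).obj Y) i j s t h hst

/-- On column 0 the total degree is the vertical degree, so both differentials carry the same sign.
-/
lemma rowTensor_comm (s t : ℤ) (h : t + 1 = s) :
    rowTensor X.X Y.X s ≫ tensorD X Y 0 (0, s) (0, t) =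
      rowTensorD X Y s t ≫ rowTensor X.X Y.X t := by
  apply tensorObj_ext
  intro i j hij
  have e (i : ℤ) : nxt 0 (0, i) = (0, i - 1) := by simp [nxt]
  have e' : totDeg (0, i) = i := by simp [totDeg]
  rw [ι_rowTensor_assoc, ι_tensorD, ← assoc, ι_rowTensorD X Y i j s t hij h, Preadditive.add_comp,
    assoc, units_smul_comp, assoc, ι_rowTensor, ι_rowTensor, e, e,
    ιz_eq _ _ _ _ _ (zero_bidegree_add (by lia)), ιz_eq _ _ _ _ _ (zero_bidegree_add (by lia)), e']

/-- The comparison map between the tensor product of the zeroth columns and the zeroth column of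
the tensor product. -/
noncomputable def columnMu :
    (column k 0).obj X ⊗ (column k 0).obj Y ⟶ (column k 0).obj (X ⊗ Y) where
  f s := rowTensor X.X Y.X s
  comm' s t h := rowTensor_comm X Y s t h

variable (k) in
/-- The comparison map between the tensor units. -/
noncomputable def columnEpsilon : 𝟙_ (Ch.{u} k) ⟶ (column k 0).obj (𝟙_ (TwistedComplex.{u} k)) :=
  HomologicalComplex.mkHomFromSingle
    (GradedObject.Monoidal.tensorUnit₀ (I := ℕ × ℤ) (C := ModuleCat.{u} k)).inv
    (fun _ _ => comp_zero)

section
variable (A B C : GradedObject (ℕ × ℤ) (ModuleCat.{u} k)) (i j l s : ℤ) (h : i + j + l = s)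

lemma ι₃'_rowTensor :
    ιTensorObj₃' (row A) (row B) (row C) i j l s h ≫
      GradedObject.Monoidal.tensorHom (I := ℤ) (C := ModuleCat.{u} k)
        (X₂ := row (GradedObject.Monoidal.tensorObj A B)) (rowTensor A B) (𝟙 (row C)) s ≫
        rowTensor (GradedObject.Monoidal.tensorObj A B) C s =
      ιTensorObj₃' A B C (0, i) (0, j) (0, l) (0, s)
        (by rw [zero_bidegree_add rfl, zero_bidegree_add h]) := by
  rw [ιTensorObj₃'_eq _ _ _ i j l s h _ rfl, ιTensorObj₃'_eq _ _ _ _ _ _ _ _ (0, i + j) (by simp),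
    assoc, ι_tensorHom_assoc, ι_rowTensor]
  dsimp
  rw [tensorHom_id, ← MonoidalCategory.comp_whiskerRight_assoc, ι_rowTensor]

lemma ι₃_rowTensor :
    ιTensorObj₃ (row A) (row B) (row C) i j l s h ≫
      GradedObject.Monoidal.tensorHom (I := ℤ) (C := ModuleCat.{u} k)
        (Y₂ := row (GradedObject.Monoidal.tensorObj B C)) (𝟙 (row A)) (rowTensor B C) s ≫
        rowTensor A (GradedObject.Monoidal.tensorObj B C) s =
      ιTensorObj₃ A B C (0, i) (0, j) (0, l) (0, s)
        (by rw [zero_bidegree_add rfl, zero_bidegree_add h]) := by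
  rw [ιTensorObj₃_eq _ _ _ i j l s h _ rfl, ιTensorObj₃_eq _ _ _ _ _ _ _ _ (0, j + l) (by simp),
    assoc, ι_tensorHom_assoc, ι_rowTensor]
  dsimp
  rw [id_tensorHom, ← MonoidalCategory.whiskerLeft_comp_assoc, ι_rowTensor]

end

lemma tensorHom_rowTensor {A B A' B' : GradedObject (ℕ × ℤ) (ModuleCat.{u} k)} (f : A ⟶ A')
    (g : B ⟶ B') (s : ℤ) :
    GradedObject.Monoidal.tensorHom (I := ℤ) (C := ModuleCat.{u} k) (X₁ := row A) (Y₁ := row B)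
        (X₂ := row A') (Y₂ := row B') (fun q => f (0, q)) (fun q => g (0, q)) s ≫
        rowTensor A' B' s =
      rowTensor A B s ≫ GradedObject.Monoidal.tensorHom f g (0, s) := by
  apply tensorObj_ext
  intro i j h
  rw [ι_tensorHom_assoc, ι_rowTensor, ι_rowTensor_assoc, ι_tensorHom]

lemma rowTensor_associator (A B C : GradedObject (ℕ × ℤ) (ModuleCat.{u} k)) (s : ℤ) :
    GradedObject.Monoidal.tensorHom (I := ℤ) (C := ModuleCat.{u} k)
        (X₂ := row (GradedObject.Monoidal.tensorObj A B)) (rowTensor A B) (𝟙 (row C)) s ≫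
        rowTensor (GradedObject.Monoidal.tensorObj A B) C s ≫
          (GradedObject.Monoidal.associator A B C).hom (0, s) =
      (GradedObject.Monoidal.associator (row A) (row B) (row C)).hom s ≫
        GradedObject.Monoidal.tensorHom (I := ℤ) (C := ModuleCat.{u} k)
          (Y₂ := row (GradedObject.Monoidal.tensorObj B C)) (𝟙 (row A)) (rowTensor B C) s ≫
          rowTensor A (GradedObject.Monoidal.tensorObj B C) s := by
  apply tensorObj₃'_ext
  intro i j l h
  rw [ιTensorObj₃'_associator_hom_assoc, ι₃_rowTensor,
    ← assoc (f := GradedObject.Monoidal.tensorHom _ _ _),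
    ← assoc, ι₃'_rowTensor, ιTensorObj₃'_associator_hom]

section
variable (A : GradedObject (ℕ × ℤ) (ModuleCat.{u} k)) {U : GradedObject ℤ (ModuleCat.{u} k)}
  {V : GradedObject (ℕ × ℤ) (ModuleCat.{u} k)} (e : U ⟶ row V)
  (u : 𝟙_ (ModuleCat.{u} k) ⟶ U 0) (v : 𝟙_ (ModuleCat.{u} k) ⟶ V 0)

lemma leftUnitor_inv_comp_rowTensor (h : u ≫ e 0 = v) (s : ℤ) :
    ((λ_ (A (0, s))).inv ≫ u ▷ A (0, s) ≫ ιTensorObj U (row A) 0 s s (zero_add s)) ≫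
      GradedObject.Monoidal.tensorHom e (𝟙 (row A)) s ≫ rowTensor V A s =
    (λ_ (A (0, s))).inv ≫ v ▷ A (0, s) ≫ ιTensorObj V A 0 (0, s) (0, s) (zero_add _) := by
  rw [assoc, assoc, ι_tensorHom_assoc, ι_rowTensor]
  dsimp
  rw [tensorHom_id, ← MonoidalCategory.comp_whiskerRight_assoc, h]
  rfl

lemma rightUnitor_inv_comp_rowTensor (h : u ≫ e 0 = v) (s : ℤ) :
    ((ρ_ (A (0, s))).inv ≫ A (0, s) ◁ u ≫ ιTensorObj (row A) U s 0 s (add_zero s)) ≫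
      GradedObject.Monoidal.tensorHom (𝟙 (row A)) e s ≫ rowTensor A V s =
    (ρ_ (A (0, s))).inv ≫ A (0, s) ◁ v ≫ ιTensorObj A V (0, s) 0 (0, s) (add_zero _) := by
  rw [assoc, assoc, ι_tensorHom_assoc, ι_rowTensor]
  dsimp
  rw [id_tensorHom, ← MonoidalCategory.whiskerLeft_comp_assoc, h]
  rfl

end

variable (k) in
lemma singleObjXSelf_inv_comp_columnEpsilon_f :
    (HomologicalComplex.singleObjXSelf (ComplexShape.down ℤ) 0 (𝟙_ (ModuleCat.{u} k))).inv ≫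
      (columnEpsilon k).f 0 =
    (GradedObject.Monoidal.tensorUnit₀ (I := ℕ × ℤ) (C := ModuleCat.{u} k)).inv :=
  (congrArg _ (HomologicalComplex.mkHomFromSingle_f _ _)).trans (Iso.inv_hom_id_assoc _ _)

lemma leftUnitor_inv_comp_columnMu : (λ_ ((column k 0).obj X)).inv ≫
    columnEpsilon k ▷ (column k 0).obj X ≫ columnMu (𝟙_ _) X =
      (column k 0).map (λ_ X).inv := by
  ext s : 1
  refine Eq.trans ?_ (leftUnitor_inv_comp_rowTensor X.X _ _ _
    (singleObjXSelf_inv_comp_columnEpsilon_f k) s)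
  exact congrArg (· ≫ _) (HomologicalComplex.leftUnitor'_inv ((column k 0).obj X) s)

lemma rightUnitor_inv_comp_columnMu : (ρ_ ((column k 0).obj X)).inv ≫
    (column k 0).obj X ◁ columnEpsilon k ≫ columnMu X (𝟙_ _) =
      (column k 0).map (ρ_ X).inv := by
  ext s : 1
  refine Eq.trans ?_ (rightUnitor_inv_comp_rowTensor X.X _ _ _
    (singleObjXSelf_inv_comp_columnEpsilon_f k) s)
  exact congrArg (· ≫ _) (HomologicalComplex.rightUnitor'_inv ((column k 0).obj X) s)

/-- A lax structure on the right adjoint is what makes the inclusion oplax. The unit axioms are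
deduced from the inverse unitors, whose components have explicit formulas. -/
noncomputable instance : (column k 0).LaxMonoidal where
  ε := columnEpsilon k
  μ X Y := columnMu X Y
  μ_natural_left f X' := by
    ext s : 1
    exact tensorHom_rowTensor f.f (𝟙 X'.X) s
  μ_natural_right X' f := by
    ext s : 1
    exact tensorHom_rowTensor (𝟙 X'.X) f.f s
  associativity X Y Z := by
    ext s : 1
    exact rowTensor_associator X.X Y.X Z.X s
  left_unitality X := by
    have := leftUnitor_inv_comp_columnMu X
    rw [Iso.inv_comp_eq] at this
    rw [← assoc, this, assoc, ← Functor.map_comp, Iso.inv_hom_id,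
      CategoryTheory.Functor.map_id, comp_id]
  right_unitality X := by
    have := rightUnitor_inv_comp_columnMu X
    rw [Iso.inv_comp_eq] at this
    rw [← assoc, this, assoc, ← Functor.map_comp, Iso.inv_hom_id,
      CategoryTheory.Functor.map_id, comp_id]

lemma columnMu_braiding :
    columnMu X Y ≫ (column k 0).map (β_ X Y).hom = (β_ _ _).hom ≫ columnMu Y X := by
  ext s : 1
  apply tensorObj_ext
  intro i j h
  have := ChainTensor.ι_braidingF ((column k 0).obj X) ((column k 0).obj Y) i j s h
  refine (ι_rowTensor_assoc X.X Y.X i j s h _).trans ?_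
  refine (ι_braidingHom totDeg X.X Y.X (0, i) (0, j) (0, s) _).trans ?_
  refine Eq.trans ?_ ((congrArg (· ≫ rowTensor Y.X X.X s) this).symm.trans (assoc _ _ _))
  refine Eq.trans ?_ (units_smul_comp _ _ _).symm
  refine congr_arg₂ _ (by simp [sgn, totDeg]) ?_
  refine Eq.trans ?_ (assoc _ _ _).symm
  exact (congrArg _ (ι_rowTensor Y.X X.X j i s (by rw [add_comm, h]))).symm

end TwistedComplex

/-! ### The inclusion as a strong symmetric monoidal functor. -/

namespace TwistedComplex
open Category KoszulGraded
open GradedObject.Monoidal (ιTensorObj tensorObjDesc tensorObj_ext ι_tensorObjDesc)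

variable {k : Type u} [CommRing k]

section
variable (A B : GradedObject (ℕ × ℤ) (ModuleCat.{u} k))

/-- The components of the inverse of the comparison map `rowTensor`. -/
noncomputable def rowTensorInvComp (s : ℤ) : ∀ (a b : ℕ × ℤ) (_ : a + b = (0, s)),
    A a ⊗ B b ⟶ GradedObject.Monoidal.tensorObj (row A) (row B) s
  | (0, i), (0, j), h => ιTensorObj (row A) (row B) i j s (congrArg Prod.snd h)
  | (0, _), (_ + 1, _), _ => 0
  | (_ + 1, _), _, _ => 0

instance (s : ℤ) : IsIso (rowTensor A B s) := by
  refine ⟨tensorObjDesc (rowTensorInvComp A B s), ?_, ?_⟩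
  · apply tensorObj_ext
    intro i j h
    rw [ι_rowTensor_assoc, ι_tensorObjDesc, comp_id]
    rfl
  · apply tensorObj_ext
    -- Horizontal degrees are natural numbers, so only summands with both factors in column 0
    -- contribute to (0, s).
    rintro ⟨_ | p, i⟩ ⟨_ | q, j⟩ h
    · rw [← assoc, ι_tensorObjDesc, comp_id]
      exact ι_rowTensor A B i j s (congrArg Prod.snd h)
    all_goals exact absurd (congrArg Prod.fst h) (by simp)

end

lemma isIso_of_forall {X Y : TwistedComplex.{u} k} (f : X ⟶ Y) (h : ∀ a, IsIso (f.f a)) :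
    IsIso f :=
  (isoMk (GradedObject.isoMk _ _ fun a => asIso (f.f a)) f.comm).isIso_hom

lemma isZero_inclObj (K : Ch.{u} k) (p : ℕ) (q : ℤ) : IsZero (((inclusion k).obj K).X (p + 1, q)) :=
  ModuleCat.isZero_of_subsingleton (ModuleCat.of k PUnit)

lemma isIso_of_isIso_column_map {K : Ch.{u} k} {Y : TwistedComplex.{u} k}
    (f : (inclusion k).obj K ⟶ Y) (hf : ∀ q, IsIso (f.f (0, q)))
    (hY : ∀ p q, IsZero (Y.X (p + 1, q))) : IsIso f := by
  refine isIso_of_forall f ?_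
  rintro ⟨_ | p, q⟩
  · exact hf q
  · exact (isZero_inclObj K p q).isIso (hY p q) _

variable (K L : Ch.{u} k)

lemma isZero_tensor_inclObj (p : ℕ) (q : ℤ) :
    IsZero (((inclusion k).obj K ⊗ (inclusion k).obj L).X (p + 1, q)) := by
  rw [IsZero.iff_id_eq_zero]
  apply tensorObj_ext
  rintro ⟨_ | a, i⟩ ⟨_ | b, j⟩ h
  · exact absurd (congrArg Prod.fst h) (by simp)
  · exact ((tensorLeft _).map_isZero (isZero_inclObj L b j)).eq_of_src _ _
  all_goals exact ((tensorRight _).map_isZero (isZero_inclObj K a i)).eq_of_src _ _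

lemma isZero_tensorUnit (a : ℕ × ℤ) (ha : a ≠ 0) :
    IsZero ((𝟙_ (TwistedComplex.{u} k)).X a) :=
  (GradedObject.Monoidal.isInitialTensorUnitApply (C := ModuleCat.{u} k) a ha).isZero

lemma isIso_columnEpsilon_f (q : ℤ) : IsIso ((columnEpsilon k).f q) := by
  by_cases h : q = 0
  · subst h
    have : IsIso ((HomologicalComplex.singleObjXSelf (ComplexShape.down ℤ) 0
        (𝟙_ (ModuleCat.{u} k))).inv ≫ (columnEpsilon k).f 0) := by
      rw [singleObjXSelf_inv_comp_columnEpsilon_f]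
      exact Iso.isIso_inv _
    exact IsIso.of_isIso_comp_left (HomologicalComplex.singleObjXSelf (ComplexShape.down ℤ) 0
        (𝟙_ (ModuleCat.{u} k))).inv _
  · exact (HomologicalComplex.isZero_single_obj_X (ComplexShape.down ℤ) 0 _ q h).isIso
      (isZero_tensorUnit (0, q) (fun h' => h (congrArg Prod.snd h'))) _

open Functor.OplaxMonoidal

/-- The oplax monoidal structure on the inclusion of chain complexes. -/
noncomputable abbrev inclusionOplaxMonoidal : (inclusion k).OplaxMonoidal :=
  (inclusionAdjunction k).leftAdjointOplaxMonoidal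

attribute [local instance] inclusionOplaxMonoidal

lemma inclusionAdjunction_homEquiv {K : Ch.{u} k} {Y : TwistedComplex.{u} k}
    (g : (inclusion k).obj K ⟶ Y) :
    (inclusionAdjunction k).homEquiv K Y g = (column k 0).map g := by
  rw [inclusionAdjunction, Adjunction.mkOfHomEquiv_homEquiv]
  rfl

lemma column_map_injective {K : Ch.{u} k} {Y : TwistedComplex.{u} k}
    {g g' : (inclusion k).obj K ⟶ Y} (h : (column k 0).map g = (column k 0).map g') : g = g' :=
  (inclusionHomEquiv K Y).injective h

lemma inclusionAdjunction_unit_app : (inclusionAdjunction k).unit.app K = 𝟙 K := by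
  rw [← Adjunction.homEquiv_id, inclusionAdjunction_homEquiv, CategoryTheory.Functor.map_id]
  rfl

/-- The oplax map is the mate of `columnMu`. As the unit of the adjunction is the identity,
restricting to column 0 gives `columnMu` back, which is invertible in each degree. -/
lemma column_map_delta : (column k 0).map (δ (inclusion k) K L) =
    columnMu ((inclusion k).obj K) ((inclusion k).obj L) := by
  rw [← inclusionAdjunction_homEquiv, Adjunction.leftAdjointOplaxMonoidal_δ,
    Equiv.apply_symm_apply, inclusionAdjunction_unit_app, inclusionAdjunction_unit_app]
  have h : (𝟙 K ⊗ₘ 𝟙 L) = 𝟙 (K ⊗ L) := id_tensorHom_id _ _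
  let m : K ⊗ L ⟶ (column k 0).obj ((inclusion k).obj K ⊗ (inclusion k).obj L) :=
    columnMu ((inclusion k).obj K) ((inclusion k).obj L)
  exact (congrArg (· ≫ m) h).trans (id_comp m)

variable (k) in
lemma column_map_eta : (column k 0).map (η (inclusion k)) = columnEpsilon k := by
  rw [← inclusionAdjunction_homEquiv, Adjunction.leftAdjointOplaxMonoidal_η,
    Equiv.apply_symm_apply]
  rfl

instance : IsIso (δ (inclusion k) K L) :=
  isIso_of_isIso_column_map _ (fun q =>
    (congrArg IsIso (HomologicalComplex.congr_hom (column_map_delta K L) q)).mpr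
      (inferInstanceAs (IsIso (rowTensor ((inclusion k).obj K).X ((inclusion k).obj L).X q))))
    (isZero_tensor_inclObj K L)

instance : IsIso (η (inclusion k)) :=
  isIso_of_isIso_column_map _ (fun q =>
    (congrArg IsIso (HomologicalComplex.congr_hom (column_map_eta k) q)).mpr
      (isIso_columnEpsilon_f q)) (fun p q => isZero_tensorUnit _ (fun h =>
      absurd (congrArg Prod.fst h) (by simp)))

/-- Maps out of an included complex are determined by column 0, where the claim is
`columnMu_braiding`. -/
lemma map_braiding_comp_delta : (inclusion k).map (β_ K L).hom ≫ δ (inclusion k) L K =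
    δ (inclusion k) K L ≫ (β_ _ _).hom := by
  apply column_map_injective
  rw [Functor.map_comp, Functor.map_comp, column_map_delta, column_map_delta]
  have h := columnMu_braiding ((inclusion k).obj K) ((inclusion k).obj L)
  exact h.symm

variable (k) in
/-- The inclusion of chain complexes is a strong symmetric monoidal functor. -/
theorem nonempty_inclusion_braided : Nonempty (inclusion k).Braided := by
  let m : (inclusion k).Monoidal := Functor.Monoidal.ofOplaxMonoidal (inclusion k)
  refine ⟨{ toMonoidal := m, braided := fun K L => ?_ }⟩
  change inv (δ (inclusion k) K L) ≫ _ = _ ≫ inv (δ (inclusion k) L K)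
  rw [IsIso.inv_comp_eq, ← assoc, ← map_braiding_comp_delta, assoc, IsIso.hom_inv_id, comp_id]

end TwistedComplex

theorem mainTheorem8 (k : Type u) [CommRing k] :
    ∃ (M : HomotopicalAlgebra.ModelCategory (Ch k))
      (N : HomotopicalAlgebra.ModelCategory (TwistedComplex.{u} k)),
      IsProjectiveModelStructure M ∧ IsTotalModelStructure N ∧
        ∃ adj : TwistedComplex.inclusion k ⊣ TwistedComplex.column k 0,
          IsStrongSymmetricMonoidalQuillenEquivalence adj := by
  obtain ⟨M, hM⟩ := ChainComplexModel.exists_projectiveModelStructure k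
  obtain ⟨N, hN⟩ := TwistedComplex.exists_totalModelStructure k
  exact ⟨M, N, hM, hN, TwistedComplex.inclusionAdjunction k,
    { toIsQuillenEquivalence := TwistedComplex.isQuillenEquivalence hM hN
      nonempty_braided := TwistedComplex.nonempty_inclusion_braided k
      weakEquivalence_map_unit := fun _ q _ h =>
        TwistedComplex.weakEquivalence_inclusion_map hM hN q h }⟩
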